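/- Let $V$ be a separable real Hilbert space with norm $\|\cdot\|$ and inner product $(\cdot,\cdot)$, and let $\tfrac12<\beta<\beta'<1$ and $1-\beta'<\alpha<\beta$. Let $-A$ be a strictly positive symmetric operator in $V$ with compact inverse, let $S$ be the (analytic) semigroup on $V$ generated by $A$, and let $(e_i)$ be a complete orthonormal basis of $V$ consisting of eigenvectors of $-A$. Let $F:V\to V$ be continuous with $\|F(u)\|\le c_F+L_F\|u\|$ for all $u\in V$, and let $G:V\to L_2(V)$ be Lipschitz continuous, where $L_2(V)$ is the space of Hilbert--Schmidt operators on $V$. *Paths.* Let $\Omega=C_0^{0,\beta'}(\mathbb R,V)$ be the set of continuous $\omega:\mathbb R\to V$ with $\omega(0)=0$ whose restriction to every $[-n,n]$ lies in the closure of $C^\infty([-n,n],V)$ in the Hölder space $C^{\beta'}([-n,n],V)$. For $s\in\mathbb R$ let $\theta_s\omega(\cdot)=\omega(s+\cdot)-\omega(s)$; $\theta_s$ maps $\Omega$ into $\Omega$. *Integral.* For real functions $g,w$ put $$D^{\alpha}_{s+}g[r]=\frac1{\Gamma(1-\alpha)}\Big(\frac{g(r)}{(r-s)^\alpha}+\alpha\int_s^r\frac{g(r)-g(q)}{(r-q)^{1+\alpha}}\,dq\Big),$$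 $$D^{1-\alpha}_{t-}w_{t-}[r]=\frac{(-1)^{1-\alpha}}{\Gamma(\alpha)}\Big(\frac{w(r)-w(t)}{(t-r)^{1-\alpha}}+(1-\alpha)\int_r^t\frac{w(r)-w(q)}{(q-r)^{2-\alpha}}\,dq\Big),$$ and define, with $(-1)^{\alpha}(-1)^{1-\alpha}=-1$, $$\int_s^t g\,d\omega=(-1)^\alpha\sum_{j}\Big(\sum_{i}\int_s^t D^\alpha_{s+}(e_j,g(\cdot)e_i)[r]\;D^{1-\alpha}_{t-}(e_i,\omega(\cdot))_{t-}[r]\,dr\Big)e_j .$$ *Solutions.* For $T>0$ let $C^\beta_\beta([0,T],V)$ be the set of continuous $u:[0,T]\to V$ with $\sup_{0<s<t\le T}s^\beta\|u(t)-u(s)\|/(t-s)^\beta<\infty$. A mild solution on $[0,T]$ for the path $\omega$ and initial value $u_0\in V$ is a function $u\in C^\beta_\beta([0,T],V)$ with $$u(t)=S(t)u_0+\int_0^tS(t-r)F(u(r))\,dr+\int_0^tS(t-r)G(u(r))\,d\omega,\qquad t\in[0,T].$$ Let $\mathcal F(u_0,\omega)$ be the set of all globally defined mild solutions, i.e. functions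 $u:[0,\infty)\to V$ whose restriction to $[0,T]$ is a mild solution on $[0,T]$ for every $T>0$, and put $$\Phi(t,\omega,u_0)=\{u(t):u\in\mathcal F(u_0,\omega)\},\qquad \Phi(t,\omega,B)=\bigcup_{x\in B}\Phi(t,\omega,x)\quad(B\subset V).$$ **Lemma.** For all $t,s\ge0$, $\omega\in\Omega$ and $u_0\in V$, $$\Phi(t+s,\omega,u_0)=\Phi\big(t,\theta_s\omega,\Phi(s,\omega,u_0)\big).$$ -/

import Mathlib

open Set Filter Topology MeasureTheory
open scoped NNReal ENNReal

noncomputable section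

namespace RoughEvolution

/-! ### Hölder norms and spaces of Hölder functions -/

section Holder

variable {E : Type*} [NormedAddCommGroup E]

/-- The supremum norm of `f` on `[a, b]`, with values in `[0, ∞]`. -/
def supNorm (f : ℝ → E) (a b : ℝ) : ℝ≥0∞ :=
  ⨆ (t : ℝ) (_ : t ∈ Icc a b), ‖f t‖ₑ

/-- The `γ`-Hölder seminorm of `f` on `[a, b]`, with values in `[0, ∞]`. -/
def holderSeminorm (γ : ℝ) (f : ℝ → E) (a b : ℝ) : ℝ≥0∞ :=
  ⨆ (s : ℝ) (t : ℝ) (_ : a ≤ s ∧ s < t ∧ t ≤ b),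
    ‖f t - f s‖ₑ / ENNReal.ofReal ((t - s) ^ γ)

/-- The norm of the space `C^γ([a, b], E)` of Hölder continuous functions. -/
def holderNorm (γ : ℝ) (f : ℝ → E) (a b : ℝ) : ℝ≥0∞ :=
  supNorm f a b + holderSeminorm γ f a b

/-- The weighted Hölder seminorm `sup_{a < s < t ≤ b} (s - a)^β ‖f t - f s‖ / (t - s)^β`. -/
def weightedHolderSeminorm (β : ℝ) (f : ℝ → E) (a b : ℝ) : ℝ≥0∞ :=
  ⨆ (s : ℝ) (t : ℝ) (_ : a < s ∧ s < t ∧ t ≤ b),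
    ENNReal.ofReal ((s - a) ^ β) * (‖f t - f s‖ₑ / ENNReal.ofReal ((t - s) ^ β))

/-- The norm of the space `C^β_β([a, b], E)`. -/
def weightedHolderNorm (β : ℝ) (f : ℝ → E) (a b : ℝ) : ℝ≥0∞ :=
  supNorm f a b + weightedHolderSeminorm β f a b

/-- Membership (of the restriction to `[a, b]`) in the space `C^β_β([a, b], E)`. -/
def MemWeightedHolder (β : ℝ) (f : ℝ → E) (a b : ℝ) : Prop :=
  ContinuousOn f (Icc a b) ∧ weightedHolderNorm β f a b < ∞

/-- The Wiener shift `θ_t ω = ω (t + ·) - ω t` of a function. -/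
def wienerShift (t : ℝ) (ω : ℝ → E) : ℝ → E := fun r => ω (t + r) - ω t

lemma supNorm_wienerShift_le (t : ℝ) (f : ℝ → E) {a b c d : ℝ} (h0 : (0 : ℝ) ∈ Icc a b)
    (hac : c ≤ t + a) (hbd : t + b ≤ d) :
    supNorm (wienerShift t f) a b ≤ 2 * supNorm f c d := by
  have key : ∀ r ∈ Icc a b, ‖f (t + r)‖ₑ ≤ supNorm f c d := fun r hr =>
    le_iSup₂_of_le (t + r) ⟨by linarith [hr.1], by linarith [hr.2]⟩ le_rfl
  refine iSup₂_le fun r hr => ?_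
  rw [two_mul]
  have h1 := key r hr
  have h2 := key 0 h0
  rw [add_zero] at h2
  exact enorm_sub_le.trans (add_le_add h1 h2)

lemma holderSeminorm_wienerShift_le (γ t : ℝ) (f : ℝ → E) {a b c d : ℝ}
    (hac : c ≤ t + a) (hbd : t + b ≤ d) :
    holderSeminorm γ (wienerShift t f) a b ≤ holderSeminorm γ f c d := by
  refine iSup_le fun r => iSup_le fun q => iSup_le fun h => ?_
  refine le_iSup_of_le (t + r) <| le_iSup_of_le (t + q) <|
    le_iSup_of_le ⟨by linarith [h.1], by linarith [h.2.1], by linarith [h.2.2]⟩ ?_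
  simp [wienerShift]

lemma holderNorm_wienerShift_le (γ t : ℝ) (f : ℝ → E) {a b c d : ℝ} (h0 : (0 : ℝ) ∈ Icc a b)
    (hac : c ≤ t + a) (hbd : t + b ≤ d) :
    holderNorm γ (wienerShift t f) a b ≤ 2 * holderNorm γ f c d := by
  unfold holderNorm
  rw [mul_add]
  refine add_le_add (supNorm_wienerShift_le t f h0 hac hbd)
    ((holderSeminorm_wienerShift_le γ t f hac hbd).trans ?_)
  rw [two_mul]
  exact le_self_add

variable [NormedSpace ℝ E]

/-- Membership (of the restriction to `[a, b]`) in `C^{0,γ}([a, b], E)`, the closure of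
`C^∞([a, b], E)` in the Hölder space `C^γ([a, b], E)`. -/
def MemLittleHolder (γ : ℝ) (f : ℝ → E) (a b : ℝ) : Prop :=
  holderNorm γ f a b < ∞ ∧
    ∀ ε : ℝ≥0∞, 0 < ε → ∃ p : ℝ → E, ContDiffOn ℝ ((⊤ : ℕ∞) : WithTop ℕ∞) p (Icc a b) ∧
      holderNorm γ (fun t => f t - p t) a b < ε

variable (E) in
/-- The space `C_0^{0,γ}(ℝ, E)`: continuous paths, zero at zero, whose restriction to each
`[-n, n]` is in `C^{0,γ}([-n, n], E)`. -/
def PathSpace (γ : ℝ) : Type _ :=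
  {ω : ℝ → E // Continuous ω ∧ ω 0 = 0 ∧ ∀ n : ℕ, MemLittleHolder γ ω (-(n : ℝ)) n}

/-- The Wiener shift maps the path space into itself. -/
def PathSpace.shift {γ : ℝ} (t : ℝ) (ω : PathSpace E γ) : PathSpace E γ :=
  ⟨wienerShift t ω.1, by
    obtain ⟨ω, hc, h0, hω⟩ := ω
    refine ⟨(hc.comp (continuous_const.add continuous_id)).sub continuous_const, by simp [wienerShift], fun n => ?_⟩
    obtain ⟨N, hN⟩ := exists_nat_ge ((n : ℝ) + |t|)
    have hz : (0 : ℝ) ∈ Icc (-(n : ℝ)) n := by simp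
    have hl : -(N : ℝ) ≤ t + -(n : ℝ) := by linarith [neg_abs_le t]
    have hr : t + (n : ℝ) ≤ N := by linarith [le_abs_self t]
    obtain ⟨hfin, happ⟩ := hω N
    refine ⟨(holderNorm_wienerShift_le γ t ω hz hl hr).trans_lt
      (ENNReal.mul_lt_top (by simp) hfin), fun ε hε => ?_⟩
    obtain ⟨p, hp, hpε⟩ := happ (ε / 2) (ENNReal.half_pos hε.ne')
    refine ⟨wienerShift t p, ?_, ?_⟩
    · unfold wienerShift
      refine ContDiffOn.sub (hp.comp (by fun_prop) fun r h => ?_) contDiffOn_const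
      exact ⟨by linarith [h.1], by linarith [h.2]⟩
    · have heq : (fun r => wienerShift t ω r - wienerShift t p r)
          = wienerShift t (fun r => ω r - p r) := by
        funext r; simp only [wienerShift]; abel
      rw [heq]
      refine (holderNorm_wienerShift_le γ t _ hz hl hr).trans_lt ?_
      rw [mul_comm]
      exact (ENNReal.lt_div_iff_mul_lt (by simp) (by simp)).1 hpε⟩

end Holder

/-! ### Fractional derivatives -/

/-- The left sided fractional derivative `D_{s+}^α g [r]` of a scalar function. -/
def leftFracDeriv (α s : ℝ) (g : ℝ → ℝ) (r : ℝ) : ℝ :=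
  (1 / Real.Gamma (1 - α)) *
    (g r / (r - s) ^ α + α * ∫ q in s..r, (g r - g q) / (r - q) ^ (1 + α))

/-- The right sided fractional derivative `D_{t-}^{1-α} w_{t-} [r]` of `w_{t-} = w - w t`
for a scalar function `w`, without its phase factor `(-1)^{1-α}`. -/
def rightFracDeriv (α t : ℝ) (w : ℝ → ℝ) (r : ℝ) : ℝ :=
  (1 / Real.Gamma α) *
    ((w r - w t) / (t - r) ^ (1 - α) +
      (1 - α) * ∫ q in r..t, (w r - w q) / (q - r) ^ (2 - α))

section Hilbert

variable {V : Type*} [NormedAddCommGroup V] [InnerProductSpace ℝ V] {ι : Type*}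

/-- The pathwise integral `∫_s^t g dω` of an operator valued integrand. The phases in
`(-1)^α` and in `(-1)^{1-α}` of the right sided derivative multiply to the leading `-1`. -/
def pathIntegral (e : HilbertBasis ι ℝ V) (α s t : ℝ) (g : ℝ → V →L[ℝ] V) (ω : ℝ → V) : V :=
  (-1 : ℝ) • ∑' j, (∑' i, ∫ r in s..t,
    leftFracDeriv α s (fun q => inner ℝ (e j) (g q (e i))) r *
      rightFracDeriv α t (fun q => inner ℝ (e i) (ω q)) r) • e j

/-- The Hilbert-Schmidt norm, with values in `[0, ∞]`. -/
def hsNorm (e : HilbertBasis ι ℝ V) (T : V →L[ℝ] V) : ℝ≥0∞ :=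
  (∑' i, ‖T (e i)‖ₑ ^ 2) ^ (1 / 2 : ℝ)

/-! ### The linear part of the equation -/

/-- A strictly positive, symmetric, densely defined operator with a compact inverse. -/
structure IsPosSymmCompactInv (B : V →ₗ.[ℝ] V) : Prop where
  dense : Dense (B.domain : Set V)
  symm : ∀ x y : B.domain, inner ℝ (B x) (y : V) = inner ℝ (x : V) (B y)
  pos : ∀ x : B.domain, (x : V) ≠ 0 → 0 < inner ℝ (B x) (x : V)
  compact_inv : ∃ K : V →L[ℝ] V, IsCompactOperator K ∧ ∀ x y : V, (x, y) ∈ B.graph ↔ K y = x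

/-- `(S t)_{t ≥ 0}` is a strongly continuous semigroup (values at `t < 0` are irrelevant). -/
structure IsC0Semigroup (S : ℝ → V →L[ℝ] V) : Prop where
  zero : S 0 = ContinuousLinearMap.id ℝ V
  add : ∀ s t : ℝ, 0 ≤ s → 0 ≤ t → S (s + t) = (S s).comp (S t)
  cont : ∀ x : V, ContinuousOn (fun t => S t x) (Ici 0)

/-- `A` is the infinitesimal generator of `S`. -/
def IsGenerator (A : V →ₗ.[ℝ] V) (S : ℝ → V →L[ℝ] V) : Prop :=
  ∀ x y : V, (x, y) ∈ A.graph ↔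
    Tendsto (fun h : ℝ => h⁻¹ • (S h x - x)) (𝓝[>] 0) (𝓝 y)

/-! ### Mild solutions and the solution-set map -/

/-- `u` is a mild pathwise solution on `[0, T]` of `du = (A u + F u) dt + G u dω`,
`u 0 = u₀`, where `S` is the semigroup generated by `A`. -/
def IsMildSolution (e : HilbertBasis ι ℝ V) (S : ℝ → V →L[ℝ] V) (F : V → V)
    (G : V → V →L[ℝ] V) (α β : ℝ) (ω : ℝ → V) (u₀ : V) (T : ℝ) (u : ℝ → V) : Prop :=
  MemWeightedHolder β u 0 T ∧
    ∀ t ∈ Icc 0 T, u t = S t u₀ + (∫ r in (0 : ℝ)..t, S (t - r) (F (u r))) +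
      pathIntegral e α 0 t (fun r => (S (t - r)).comp (G (u r))) ω

/-- The globally defined mild solutions with initial value `u₀` and driving path `ω`
(functions on `[0, ∞)`; their values at negative times are irrelevant). -/
def globalSolutions (e : HilbertBasis ι ℝ V) (S : ℝ → V →L[ℝ] V) (F : V → V)
    (G : V → V →L[ℝ] V) (α β : ℝ) (u₀ : V) (ω : ℝ → V) : Set (ℝ → V) :=
  {u | ∀ T : ℝ, 0 < T → IsMildSolution e S F G α β ω u₀ T u}

/-- The solution-set map `Φ(t, ω, u₀) = {u t : u a global mild solution}`. -/
def solutionMap (e : HilbertBasis ι ℝ V) (S : ℝ → V →L[ℝ] V) (F : V → V)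
    (G : V → V →L[ℝ] V) (α β : ℝ) {β' : ℝ} (t : ℝ≥0) (ω : PathSpace V β') (u₀ : V) : Set V :=
  {x | ∃ u ∈ globalSolutions e S F G α β u₀ ω.1, u t = x}

end Hilbert

end RoughEvolution

end

/-! For a fixed path, mild solutions can be restarted at time `s` and concatenated there, provided
two things hold: the convolution over `[0, s + t]` equals `S t` of the convolution over `[0, s]`
plus the convolution over `[0, t]` of the translated integrand against `θ_s ω`, and a concatenation
stays in `C^β_β`.

Additivity is not formal, because both fractional derivatives depend on the endpoints of the
interval. For a C¹ integrator `w`, Fubini and Abel inversion turn the pairing of the derivatives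
into a constant times `∫ h w'` (`WeightedPath.pairing_of_C1`), which is additive. The pairing is
controlled by the `β'`-Hölder constant of the integrator (`abs_pairing_le`), and paths in `Ω` are
Hölder limits of smooth ones, so additivity survives in the limit (`pairing_add_adjacent`). Operator
valued integrands are treated weakly: `S` is diagonal in `e`, hence symmetric, so testing the
integral with `y` gives the pairing of `r ↦ (B r)* S (t - r) y` with the path
(`inner_pathIntegral`). For `y = e j` the semigroup acts by a scalar, and `pathIntegral_add`
follows. With it, the shift of a solution is a solution, which is the inclusion from left to right.

For the converse, let `v` start at `u s`. Near its own initial time `v` is only known to be Hölder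
with a degenerating weight, whereas the weight of the glued function degenerates at time zero only.
The smoothing of `S` repairs this when `s > 0`: the orbit of `u s` is `β`-Hölder
(`exists_orbit_bound_of_isMildSolution`), and a solution starting from such a point is `β`-Hölder up
to its initial time (`holder_of_isMildSolution`). For `s = 0` there is nothing to glue. -/

noncomputable section

namespace RoughEvolution

/-! ### Beta integrals -/

/-- The beta integral `∫_0^1 x^a (1 - x)^b dx`. -/
def betaInt (a b : ℝ) : ℝ := ∫ x in (0 : ℝ)..1, x ^ a * (1 - x) ^ b

lemma betaInt_nonneg (a b : ℝ) : 0 ≤ betaInt a b :=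
  intervalIntegral.integral_nonneg zero_le_one fun x hx =>
    mul_nonneg (Real.rpow_nonneg hx.1 _) (Real.rpow_nonneg (by linarith [hx.2]) _)

/-- On `[0, 1/2]` only the factor `x ^ a` can be singular; the reflection `x ↦ 1 - x` reduces the
other half to this one. -/
lemma intervalIntegrable_beta_unit {a b : ℝ} (ha : -1 < a) (hb : -1 < b) :
    IntervalIntegrable (fun x : ℝ => x ^ a * (1 - x) ^ b) volume 0 1 := by
  have key : ∀ {a b : ℝ}, -1 < a → -1 < b →
      IntervalIntegrable (fun x : ℝ => x ^ a * (1 - x) ^ b) volume 0 (1 / 2) := by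
    intro a b ha _
    refine (intervalIntegral.intervalIntegrable_rpow' ha).mul_continuousOn ?_
    refine ContinuousOn.rpow_const (by fun_prop) fun x hx => Or.inl ?_
    rw [uIcc_of_le (by norm_num)] at hx
    linarith [hx.2]
  refine (key ha hb).trans ?_
  have h := (key hb ha).comp_sub_left 1
  norm_num at h
  refine h.symm.congr_ae (Eventually.of_forall fun x => ?_)
  ring

lemma beta_scale {a b s t x : ℝ} (hst : s < t) (hx : x ∈ Icc (0 : ℝ) 1) :
    (s + (t - s) * x - s) ^ a * (t - (s + (t - s) * x)) ^ b =
      (t - s) ^ (a + b) * (x ^ a * (1 - x) ^ b) := by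
  have h0 : 0 < t - s := sub_pos.2 hst
  have e1 : s + (t - s) * x - s = (t - s) * x := by ring
  have e2 : t - (s + (t - s) * x) = (t - s) * (1 - x) := by ring
  rw [e1, e2, Real.mul_rpow h0.le hx.1, Real.mul_rpow h0.le (by linarith [hx.2]),
    Real.rpow_add h0]
  ring

lemma intervalIntegrable_beta {a b s t : ℝ} (ha : -1 < a) (hb : -1 < b) (hst : s < t) :
    IntervalIntegrable (fun r : ℝ => (r - s) ^ a * (t - r) ^ b) volume s t := by
  have h0 : t - s ≠ 0 := (sub_pos.2 hst).ne'
  have h1 : IntervalIntegrable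
      (fun x : ℝ => (s + (t - s) * x - s) ^ a * (t - (s + (t - s) * x)) ^ b) volume 0 1 := by
    refine ((intervalIntegrable_beta_unit ha hb).const_mul ((t - s) ^ (a + b))).congr ?_
    intro x hx
    rw [uIoc_of_le zero_le_one] at hx
    exact (beta_scale hst ⟨hx.1.le, hx.2⟩).symm
  have h2 := (h1.comp_mul_left (c := (t - s)⁻¹)).comp_sub_right s
  have e0 : (0 : ℝ) / (t - s)⁻¹ + s = s := by simp
  have e1 : (1 : ℝ) / (t - s)⁻¹ + s = t := by simp
  rw [e0, e1] at h2
  refine h2.congr fun r _ => ?_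
  have : s + (t - s) * ((t - s)⁻¹ * (r - s)) = r := by field_simp; ring
  simp only [this]

lemma integral_beta {a b s t : ℝ} (hst : s < t) :
    ∫ r in s..t, (r - s) ^ a * (t - r) ^ b = betaInt a b * (t - s) ^ (a + b + 1) := by
  have h0 : 0 < t - s := sub_pos.2 hst
  have h := intervalIntegral.mul_integral_comp_add_mul (a := 0) (b := 1)
    (f := fun r : ℝ => (r - s) ^ a * (t - r) ^ b) (t - s) s
  have e1 : s + (t - s) * 0 = s := by ring
  have e2 : s + (t - s) * 1 = t := by ring
  rw [e1, e2] at h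
  rw [← h, intervalIntegral.integral_congr (g := fun x => (t - s) ^ (a + b) *
    (x ^ a * (1 - x) ^ b)) (fun x hx => by
      rw [uIcc_of_le zero_le_one] at hx
      exact beta_scale hst hx), intervalIntegral.integral_const_mul,
    Real.rpow_add_one h0.ne' (a + b), betaInt]
  ring

/-! ### Vector valued fractional derivatives -/

section Frac

variable {E : Type*} [NormedAddCommGroup E] [NormedSpace ℝ E]

/-- The left sided fractional derivative of a vector valued function, without its Gamma factor. -/
def leftD (α s : ℝ) (h : ℝ → E) (r : ℝ) : E :=
  ((r - s) ^ α)⁻¹ • h r + α • ∫ q in s..r, ((r - q) ^ (1 + α))⁻¹ • (h r - h q)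

/-- The right sided fractional derivative of order `1 - α` of `w - w t`, without its
Gamma factor, for a vector valued function `w`. -/
def rightD (α t : ℝ) (w : ℝ → E) (r : ℝ) : E :=
  ((t - r) ^ (1 - α))⁻¹ • (w r - w t) +
    (1 - α) • ∫ q in r..t, ((q - r) ^ (2 - α))⁻¹ • (w r - w q)

lemma leftFracDeriv_eq (α s : ℝ) (g : ℝ → ℝ) (r : ℝ) :
    leftFracDeriv α s g r = (1 / Real.Gamma (1 - α)) * leftD α s g r := by
  simp only [leftFracDeriv, leftD, smul_eq_mul, div_eq_inv_mul]

lemma rightFracDeriv_eq (α t : ℝ) (w : ℝ → ℝ) (r : ℝ) :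
    rightFracDeriv α t w r = (1 / Real.Gamma α) * rightD α t w r := by
  simp only [rightFracDeriv, rightD, smul_eq_mul, div_eq_inv_mul]

/-- Time reversal exchanges the two kinds of derivative, so estimates, convergence and measurability
on the right are all inherited from the left. -/
lemma rightD_eq_leftD (α t : ℝ) (w : ℝ → E) (r : ℝ) :
    rightD α t w r = leftD (1 - α) (-t) (fun x => w (-x) - w t) (-r) := by
  have h := intervalIntegral.integral_comp_neg (a := r) (b := t)
    (fun q => ((-r - q) ^ (1 + (1 - α)))⁻¹ • (w r - w (-q)))
  have e1 : ∀ q : ℝ, -r - -q = q - r := fun q => by ring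
  have e2 : (1 : ℝ) + (1 - α) = 2 - α := by ring
  simp only [neg_neg, e1, e2] at h
  simp only [rightD, leftD, neg_neg, sub_sub_sub_cancel_right, e2, h, e1]

lemma leftD_comp_add (α s c : ℝ) (h : ℝ → E) (r : ℝ) :
    leftD α s (fun q => h (c + q)) r = leftD α (c + s) h (c + r) := by
  have := intervalIntegral.integral_comp_add_left (a := s) (b := r)
    (fun q => ((c + r - q) ^ (1 + α))⁻¹ • (h (c + r) - h q)) c
  simp only [add_sub_add_left_eq_sub] at this
  simp only [leftD, add_sub_add_left_eq_sub, this]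

/-- Only increments of `w` enter, so the constant subtracted by the Wiener shift disappears. -/
lemma rightD_comp_add (α t c : ℝ) (w : ℝ → E) (r : ℝ) :
    rightD α t (fun q => w (c + q) - w c) r = rightD α (c + t) w (c + r) := by
  have := intervalIntegral.integral_comp_add_left (a := r) (b := t)
    (fun q => ((q - (c + r)) ^ (2 - α))⁻¹ • (w (c + r) - w q)) c
  simp only [add_sub_add_left_eq_sub] at this
  simp only [rightD, add_sub_add_left_eq_sub, sub_sub_sub_cancel_right, this]

lemma leftD_const_smul (α s c : ℝ) (h : ℝ → E) (r : ℝ) :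
    leftD α s (fun q => c • h q) r = c • leftD α s h r := by
  have : ∀ q, ((r - q) ^ (1 + α))⁻¹ • (c • h r - c • h q) =
      c • (((r - q) ^ (1 + α))⁻¹ • (h r - h q)) := fun q => by
    rw [← smul_sub, smul_comm]
  unfold leftD
  simp only [this]
  rw [intervalIntegral.integral_smul, smul_add, smul_comm c, smul_comm c]

lemma leftD_congr {α s r : ℝ} (hr : s ≤ r) {h k : ℝ → E} (hk : ∀ q ∈ Icc s r, h q = k q) :
    leftD α s h r = leftD α s k r := by
  have hr' := hk r ⟨hr, le_rfl⟩
  simp only [leftD, hr']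
  congr 2
  refine intervalIntegral.integral_congr fun q hq => ?_
  rw [uIcc_of_le hr] at hq
  simp only [hk q hq]

lemma rightD_congr {α t r : ℝ} (hr : r ≤ t) {h k : ℝ → E} (hk : ∀ q ∈ Icc r t, h q = k q) :
    rightD α t h r = rightD α t k r := by
  have hr' := hk r ⟨le_rfl, hr⟩
  have ht' := hk t ⟨hr, le_rfl⟩
  simp only [rightD, hr', ht']
  congr 2
  refine intervalIntegral.integral_congr fun q hq => ?_
  rw [uIcc_of_le hr] at hq
  simp only [hk q hq]

/-! ### Bounds -/

lemma leftD_kernel_bound {α β γ s r P Q x : ℝ} {q : ℝ} (hq : q ∈ Ioo s r)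
    (hx : x ≤ P * (r - q) ^ γ + Q * ((q - s) ^ (-β) * (r - q) ^ β)) :
    ((r - q) ^ (1 + α))⁻¹ * x ≤
      P * ((q - s) ^ (0 : ℝ) * (r - q) ^ (γ - 1 - α)) +
        Q * ((q - s) ^ (-β) * (r - q) ^ (β - 1 - α)) := by
  have h0 : 0 < r - q := sub_pos.2 hq.2
  have e : ∀ c : ℝ, (r - q) ^ (c - 1 - α) = ((r - q) ^ (1 + α))⁻¹ * (r - q) ^ c := fun c => by
    rw [← Real.rpow_neg h0.le, ← Real.rpow_add h0]; congr 1; ring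
  rw [e, e, Real.rpow_zero]
  refine (mul_le_mul_of_nonneg_left hx (inv_nonneg.2 (Real.rpow_nonneg h0.le _))).trans
    (le_of_eq ?_)
  ring

lemma intervalIntegrable_leftD_majorant {α β γ s r : ℝ} (P Q : ℝ) (hsr : s < r)
    (hαγ : α < γ) (hαβ : α < β) (hβ : β < 1) :
    IntervalIntegrable (fun q => P * ((q - s) ^ (0 : ℝ) * (r - q) ^ (γ - 1 - α)) +
        Q * ((q - s) ^ (-β) * (r - q) ^ (β - 1 - α))) volume s r :=
  ((intervalIntegrable_beta (by norm_num) (by linarith) hsr).const_mul P).add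
    ((intervalIntegrable_beta (by linarith) (by linarith) hsr).const_mul Q)

lemma ae_Ioc_mem_Ioo (s r : ℝ) : ∀ᵐ q : ℝ, q ∈ Ioc s r → q ∈ Ioo s r := by
  filter_upwards [(measure_eq_zero_iff_ae_notMem (μ := volume) (s := {r})).1 (by simp)] with q hq h
  exact ⟨h.1, lt_of_le_of_ne h.2 hq⟩

omit [NormedSpace ℝ E] in
lemma intervalIntegrable_of_bound {s r : ℝ} (hsr : s ≤ r) {f : ℝ → E} {g : ℝ → ℝ}
    (hf : AEStronglyMeasurable f (volume.restrict (Ioc s r)))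
    (hg : IntervalIntegrable g volume s r) (hfg : ∀ q ∈ Ioo s r, ‖f q‖ ≤ g q) :
    IntervalIntegrable f volume s r := by
  rw [intervalIntegrable_iff_integrableOn_Ioc_of_le hsr] at hg ⊢
  refine hg.mono' hf ?_
  rw [ae_restrict_iff' measurableSet_Ioc]
  filter_upwards [ae_Ioc_mem_Ioo s r] with q hq h using hfg q (hq h)

lemma norm_integral_le_of_bound {s r : ℝ} (hsr : s ≤ r) {f : ℝ → E} {g : ℝ → ℝ}
    (hg : IntervalIntegrable g volume s r) (hfg : ∀ q ∈ Ioo s r, ‖f q‖ ≤ g q) :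
    ‖∫ q in s..r, f q‖ ≤ ∫ q in s..r, g q := by
  refine intervalIntegral.norm_integral_le_of_norm_le hsr ?_ hg
  filter_upwards [ae_Ioc_mem_Ioo s r] with q hq h using hfg q (hq h)

lemma leftD_integrand_norm_le {α β γ s r P Q : ℝ} {h : ℝ → E}
    (hh : ∀ q ∈ Ioo s r, ‖h r - h q‖ ≤ P * (r - q) ^ γ + Q * ((q - s) ^ (-β) * (r - q) ^ β))
    {q : ℝ} (hq : q ∈ Ioo s r) :
    ‖((r - q) ^ (1 + α))⁻¹ • (h r - h q)‖ ≤
      P * ((q - s) ^ (0 : ℝ) * (r - q) ^ (γ - 1 - α)) +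
        Q * ((q - s) ^ (-β) * (r - q) ^ (β - 1 - α)) := by
  rw [norm_smul, Real.norm_of_nonneg
    (inv_nonneg.2 (Real.rpow_nonneg (by linarith [hq.2]) _))]
  exact leftD_kernel_bound hq (hh q hq)

lemma measurable_leftD_integrand {α r : ℝ} {h : ℝ → E} (hc : Continuous h) :
    StronglyMeasurable fun q : ℝ => ((r - q) ^ (1 + α))⁻¹ • (h r - h q) :=
  (((measurable_const.sub measurable_id).pow_const _).inv.stronglyMeasurable).smul
    (continuous_const.sub hc).stronglyMeasurable

lemma intervalIntegrable_leftD_integrand {α β γ s r P Q : ℝ} {h : ℝ → E} (hc : Continuous h)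
    (hsr : s < r) (hαγ : α < γ) (hαβ : α < β) (hβ : β < 1)
    (hh : ∀ q ∈ Ioo s r, ‖h r - h q‖ ≤ P * (r - q) ^ γ + Q * ((q - s) ^ (-β) * (r - q) ^ β)) :
    IntervalIntegrable (fun q => ((r - q) ^ (1 + α))⁻¹ • (h r - h q)) volume s r :=
  intervalIntegrable_of_bound hsr.le (measurable_leftD_integrand hc).aestronglyMeasurable
    (intervalIntegrable_leftD_majorant P Q hsr hαγ hαβ hβ)
    fun _ hq => leftD_integrand_norm_le hh hq

/-- The increment has a genuinely `γ`-Hölder part and a part whose weight degenerates at `s`.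
Divided by the kernel, each becomes a beta integrand; in the weighted part the exponents `-β` and
`β` cancel, leaving the integrable singularity `(r - s) ^ (-α)`. -/
lemma norm_leftD_le {α β γ s r A P Q : ℝ} {h : ℝ → E}
    (hsr : s < r) (hα : 0 < α) (hαγ : α < γ) (hαβ : α < β) (hβ : β < 1) (hA : ‖h r‖ ≤ A)
    (hh : ∀ q ∈ Ioo s r, ‖h r - h q‖ ≤ P * (r - q) ^ γ + Q * ((q - s) ^ (-β) * (r - q) ^ β)) :
    ‖leftD α s h r‖ ≤ A * (r - s) ^ (-α) + α * (P * (betaInt 0 (γ - 1 - α) * (r - s) ^ (γ - α)) +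
      Q * (betaInt (-β) (β - 1 - α) * (r - s) ^ (-α))) := by
  have h0 : 0 < r - s := sub_pos.2 hsr
  refine (norm_add_le _ _).trans (add_le_add ?_ ?_)
  · rw [norm_smul, Real.norm_of_nonneg (inv_nonneg.2 (Real.rpow_nonneg h0.le _)),
      ← Real.rpow_neg h0.le, mul_comm]
    exact mul_le_mul_of_nonneg_right hA (Real.rpow_nonneg h0.le _)
  · rw [norm_smul, Real.norm_of_nonneg hα.le]
    refine mul_le_mul_of_nonneg_left ?_ hα.le
    refine (norm_integral_le_of_bound hsr.le
      (intervalIntegrable_leftD_majorant P Q hsr hαγ hαβ hβ)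
      fun _ hq => leftD_integrand_norm_le hh hq).trans (le_of_eq ?_)
    rw [intervalIntegral.integral_add
      ((intervalIntegrable_beta (by norm_num) (by linarith) hsr).const_mul P)
      ((intervalIntegrable_beta (by linarith) (by linarith) hsr).const_mul Q),
      intervalIntegral.integral_const_mul, intervalIntegral.integral_const_mul,
      integral_beta hsr, integral_beta hsr]
    have e1 : 0 + (γ - 1 - α) + 1 = γ - α := by ring
    have e2 : -β + (β - 1 - α) + 1 = -α := by ring
    rw [e1, e2]

omit [NormedSpace ℝ E] in
lemma rightD_reflected_hyp {β' t r L : ℝ} {w : ℝ → E}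
    (hw : ∀ q ∈ Ioc r t, ‖w r - w q‖ ≤ L * (q - r) ^ β') :
    ∀ q ∈ Ioo (-t) (-r), ‖(w (- -r) - w t) - (w (-q) - w t)‖ ≤
      L * (-r - q) ^ β' + 0 * ((q - -t) ^ (-β') * (-r - q) ^ β') := by
  intro q hq
  have := hw (-q) ⟨by linarith [hq.2], by linarith [hq.1]⟩
  have e : -q - r = -r - q := by ring
  rw [e] at this
  simpa using this

lemma norm_rightD_le {α β' t r L : ℝ} {w : ℝ → E} (hrt : r < t) (hα : α < 1)
    (hβ' : β' < 1) (hαβ' : 1 - β' < α)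
    (hw : ∀ q ∈ Ioc r t, ‖w r - w q‖ ≤ L * (q - r) ^ β') :
    ‖rightD α t w r‖ ≤
      (1 + (1 - α) * betaInt 0 (β' + α - 2)) * L * (t - r) ^ (β' + α - 1) := by
  have h0 : 0 < t - r := sub_pos.2 hrt
  rw [rightD_eq_leftD]
  -- After reflection the path has no weighted part, so `Q = 0` and `β'` fills both exponent slots.
  refine (norm_leftD_le (α := 1 - α) (β := β') (γ := β') (s := -t) (r := -r)
    (A := L * (t - r) ^ β') (by linarith) (by linarith) (by linarith) (by linarith) hβ' (by simpa using hw t ⟨hrt, le_rfl⟩)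
    (rightD_reflected_hyp hw)).trans (le_of_eq ?_)
  have e1 : -r - -t = t - r := by ring
  have e2 : β' - 1 - (1 - α) = β' + α - 2 := by ring
  have e3 : β' - (1 - α) = β' + α - 1 := by ring
  have e4 : β' + α - 1 = β' + -(1 - α) := by ring
  rw [e1, e2, e3, zero_mul, add_zero, mul_assoc L, e4, ← Real.rpow_add h0]
  ring

lemma intervalIntegrable_rightD_integrand {α β' t r L : ℝ} {w : ℝ → E} (hc : Continuous w)
    (hrt : r < t) (hβ' : β' < 1) (hαβ' : 1 - β' < α)
    (hw : ∀ q ∈ Ioc r t, ‖w r - w q‖ ≤ L * (q - r) ^ β') :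
    IntervalIntegrable (fun q => ((q - r) ^ (2 - α))⁻¹ • (w r - w q)) volume r t := by
  have h := intervalIntegrable_leftD_integrand (α := 1 - α) (β := β') (γ := β') (s := -t)
    (r := -r) (h := fun x => w (-x) - w t) (by fun_prop) (by linarith) (by linarith) (by linarith)
    hβ' (rightD_reflected_hyp hw)
  have h2 := h.comp_sub_left 0
  simp only [sub_neg_eq_add, zero_add, zero_sub, neg_neg, sub_sub_sub_cancel_right] at h2
  refine h2.symm.congr fun q _ => ?_
  have e1 : -r + q = q - r := by ring
  have e2 : (1 : ℝ) + (1 - α) = 2 - α := by ring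
  rw [e1, e2]

end Frac

/-! ### The pairing of the two fractional derivatives -/

/-- The relations between the exponents under which the pairing of fractional derivatives is
absolutely convergent. -/
structure Exponents (α β β' γ ρ : ℝ) : Prop where
  α_pos : 0 < α
  α_lt_β : α < β
  β_lt : β < 1
  α_lt_γ : α < γ
  β'_lt : β' < 1
  β'_gt : 1 - β' < α
  -- The right derivative contributes `(t - r) ^ (β' + α - 1)` and the integrand loses up to `(t -
  -- r) ^ (-(ρ + γ))`; the product must remain integrable at `t`.
  sum_lt : ρ + γ < β' + α

section Frac

variable {E : Type*} [NormedAddCommGroup E]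

/-- A continuous function on `[s, t]` with a Hölder bound degenerating at both endpoints. -/
structure SingularHolder (β γ ρ A s t : ℝ) (h : ℝ → E) : Prop where
  cont : Continuous h
  norm_le : ∀ r ∈ Ioo s t, ‖h r‖ ≤ A * (t - r) ^ (-ρ)
  sub_le : ∀ r ∈ Ioo s t, ∀ q ∈ Ioo s r, ‖h r - h q‖ ≤
    A * (t - r) ^ (-(ρ + γ)) * (r - q) ^ γ + A * (t - r) ^ (-ρ) * ((q - s) ^ (-β) * (r - q) ^ β)

/-- A continuous function which is `β'`-Hölder on `[s, t]` with constant `L`. -/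
structure HolderPath (β' L s t : ℝ) (w : ℝ → E) : Prop where
  cont : Continuous w
  sub_le : ∀ r q, s ≤ r → r < q → q ≤ t → ‖w r - w q‖ ≤ L * (q - r) ^ β'

/-- The constant in the bound of the pairing. -/
def pairConst (α β β' γ : ℝ) : ℝ :=
  (1 + α * (betaInt 0 (γ - 1 - α) + betaInt (-β) (β - 1 - α))) *
    (1 + (1 - α) * betaInt 0 (β' + α - 2))

/-- The majorant of the pairing of the two fractional derivatives. -/
def pairMaj (α β β' γ ρ s t r : ℝ) : ℝ :=
  pairConst α β β' γ * ((r - s) ^ (-α) * (t - r) ^ (β' + α - 1 - ρ) +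
    (r - s) ^ (γ - α) * (t - r) ^ (β' + α - 1 - ρ - γ))

lemma Exponents.pairConst_nonneg {α β β' γ ρ : ℝ} (hx : Exponents α β β' γ ρ) :
    0 ≤ pairConst α β β' γ := by
  have := hx.α_pos
  have : 0 ≤ 1 - α := by linarith [hx.α_lt_β, hx.β_lt]
  have := betaInt_nonneg 0 (γ - 1 - α)
  have := betaInt_nonneg (-β) (β - 1 - α)
  have := betaInt_nonneg 0 (β' + α - 2)
  unfold pairConst
  positivity

lemma Exponents.intervalIntegrable_pairMaj {α β β' γ ρ s t : ℝ} (hx : Exponents α β β' γ ρ)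
    (hst : s < t) : IntervalIntegrable (pairMaj α β β' γ ρ s t) volume s t := by
  obtain ⟨h1, h2, h3, h4, h5, h6, h7⟩ := hx
  exact ((intervalIntegrable_beta (by linarith) (by linarith) hst).add
    (intervalIntegrable_beta (by linarith) (by linarith) hst)).const_mul _

/-- The constant in the bound of the integral of the pairing. -/
def pairIntConst (α β β' γ ρ : ℝ) : ℝ :=
  pairConst α β β' γ * (betaInt (-α) (β' + α - 1 - ρ) + betaInt (γ - α) (β' + α - 1 - ρ - γ))

lemma Exponents.pairIntConst_nonneg {α β β' γ ρ : ℝ} (hx : Exponents α β β' γ ρ) :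
    0 ≤ pairIntConst α β β' γ ρ :=
  mul_nonneg hx.pairConst_nonneg (add_nonneg (betaInt_nonneg _ _) (betaInt_nonneg _ _))

lemma Exponents.integral_pairMaj {α β β' γ ρ s t : ℝ} (hx : Exponents α β β' γ ρ)
    (hst : s < t) : ∫ r in s..t, pairMaj α β β' γ ρ s t r =
      pairIntConst α β β' γ ρ * (t - s) ^ (β' - ρ) := by
  obtain ⟨h1, h2, h3, h4, h5, h6, h7⟩ := hx
  unfold pairMaj
  rw [intervalIntegral.integral_const_mul, intervalIntegral.integral_add
    (intervalIntegrable_beta (by linarith) (by linarith) hst)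
    (intervalIntegrable_beta (by linarith) (by linarith) hst), integral_beta hst,
    integral_beta hst]
  have e1 : -α + (β' + α - 1 - ρ) + 1 = β' - ρ := by ring
  have e2 : γ - α + (β' + α - 1 - ρ - γ) + 1 = β' - ρ := by ring
  rw [e1, e2, pairIntConst]
  ring

variable [NormedSpace ℝ E]

lemma SingularHolder.norm_leftD_le {α β β' γ ρ A s t r : ℝ} {h : ℝ → E}
    (hx : Exponents α β β' γ ρ) (hh : SingularHolder β γ ρ A s t h) (hA : 0 ≤ A)
    (hr : r ∈ Ioo s t) : ‖leftD α s h r‖ ≤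
      (1 + α * (betaInt 0 (γ - 1 - α) + betaInt (-β) (β - 1 - α))) * A *
      ((r - s) ^ (-α) * (t - r) ^ (-ρ) + (r - s) ^ (γ - α) * (t - r) ^ (-(ρ + γ))) := by
  refine (RoughEvolution.norm_leftD_le hr.1 hx.α_pos hx.α_lt_γ hx.α_lt_β hx.β_lt
    (hh.norm_le r hr) (hh.sub_le r hr)).trans ?_
  have h1 : 0 ≤ r - s := by linarith [hr.1]
  have h2 : 0 ≤ t - r := by linarith [hr.2]
  have := hx.α_pos
  have a1 := betaInt_nonneg 0 (γ - 1 - α)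
  have a2 := betaInt_nonneg (-β) (β - 1 - α)
  have p1 := Real.rpow_nonneg h1 (-α)
  have p2 := Real.rpow_nonneg h1 (γ - α)
  have p3 := Real.rpow_nonneg h2 (-ρ)
  have p4 := Real.rpow_nonneg h2 (-(ρ + γ))
  generalize (r - s) ^ (-α) = x1 at *
  generalize (r - s) ^ (γ - α) = x2 at *
  generalize (t - r) ^ (-ρ) = x3 at *
  generalize (t - r) ^ (-(ρ + γ)) = x4 at *
  generalize betaInt 0 (γ - 1 - α) = b1 at *
  generalize betaInt (-β) (β - 1 - α) = b2 at *
  have : 0 ≤ A * (x2 * x4) + α * b1 * A * (x1 * x3) + α * b2 * A * (x2 * x4) := by positivity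
  linarith

lemma norm_leftD_mul_rightD_le {E' : Type*} [NormedAddCommGroup E'] [NormedSpace ℝ E']
    {α β β' γ ρ A L s t r : ℝ} {h : ℝ → E} {w : ℝ → E'}
    (hx : Exponents α β β' γ ρ) (hh : SingularHolder β γ ρ A s t h) (hA : 0 ≤ A)
    (hw : HolderPath β' L s t w) (hr : r ∈ Ioo s t) :
    ‖leftD α s h r‖ * ‖rightD α t w r‖ ≤ A * L * pairMaj α β β' γ ρ s t r := by
  have h1 : 0 ≤ r - s := by linarith [hr.1]
  have h2 : 0 < t - r := by linarith [hr.2]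
  have hα := hx.α_pos
  have a1 := betaInt_nonneg 0 (γ - 1 - α)
  have a2 := betaInt_nonneg (-β) (β - 1 - α)
  have k1 := hh.norm_leftD_le hx hA hr
  have k2 := norm_rightD_le (α := α) hr.2 (by linarith [hx.α_lt_β, hx.β_lt]) hx.β'_lt hx.β'_gt
    (L := L) (w := w) fun q hq => hw.sub_le r q hr.1.le hq.1 hq.2
  refine (mul_le_mul k1 k2 (norm_nonneg _) (by positivity)).trans (le_of_eq ?_)
  unfold pairMaj pairConst
  have e1 : β' + α - 1 - ρ = -ρ + (β' + α - 1) := by ring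
  have e2 : β' + α - 1 - ρ - γ = -(ρ + γ) + (β' + α - 1) := by ring
  rw [e1, show -ρ + (β' + α - 1) - γ = -(ρ + γ) + (β' + α - 1) by ring, Real.rpow_add h2,
    Real.rpow_add h2]
  ring

/-- The interval integral is the difference of its two orientations, each being an integral over the
whole line of an indicator on the plane; measurability in `r` is then that of a partial integral
over a product. -/
lemma stronglyMeasurable_leftD {α s : ℝ} {h : ℝ → E} (hc : Continuous h) :
    StronglyMeasurable (leftD α s h) := by
  have hm : StronglyMeasurable
      fun p : ℝ × ℝ => ((p.1 - p.2) ^ (1 + α))⁻¹ • (h p.1 - h p.2) :=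
    (((measurable_fst.sub measurable_snd).pow_const _).inv.stronglyMeasurable).smul
      ((hc.comp continuous_fst).sub (hc.comp continuous_snd)).stronglyMeasurable
  have hi : ∀ S : Set (ℝ × ℝ), MeasurableSet S → StronglyMeasurable fun r : ℝ => ∫ q : ℝ,
      S.indicator (fun p : ℝ × ℝ => ((p.1 - p.2) ^ (1 + α))⁻¹ • (h p.1 - h p.2)) (r, q) :=
    fun S hS => StronglyMeasurable.integral_prod_right (f := fun r q => S.indicator
      (fun p : ℝ × ℝ => ((p.1 - p.2) ^ (1 + α))⁻¹ • (h p.1 - h p.2)) (r, q)) (hm.indicator hS)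
  have e : leftD α s h = fun r => ((r - s) ^ α)⁻¹ • h r + α •
      ((∫ q : ℝ, {p : ℝ × ℝ | s < p.2 ∧ p.2 ≤ p.1}.indicator
          (fun p : ℝ × ℝ => ((p.1 - p.2) ^ (1 + α))⁻¹ • (h p.1 - h p.2)) (r, q)) -
        ∫ q : ℝ, {p : ℝ × ℝ | p.1 < p.2 ∧ p.2 ≤ s}.indicator
          (fun p : ℝ × ℝ => ((p.1 - p.2) ^ (1 + α))⁻¹ • (h p.1 - h p.2)) (r, q)) := by
    funext r
    rw [leftD, intervalIntegral, ← integral_indicator measurableSet_Ioc,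
      ← integral_indicator measurableSet_Ioc]
    congr 3
  rw [e]
  refine StronglyMeasurable.add ?_ (StronglyMeasurable.const_smul ((hi _ ?_).sub (hi _ ?_)) α)
  · exact (((measurable_id.sub measurable_const).pow_const _).inv.stronglyMeasurable).smul
      hc.stronglyMeasurable
  · exact (measurableSet_lt measurable_const measurable_snd).inter
      (measurableSet_le measurable_snd measurable_fst)
  · exact (measurableSet_lt measurable_fst measurable_snd).inter
      (measurableSet_le measurable_snd measurable_const)

lemma stronglyMeasurable_rightD {α t : ℝ} {w : ℝ → E} (hc : Continuous w) :
    StronglyMeasurable (rightD α t w) := by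
  rw [show rightD α t w = fun r => leftD (1 - α) (-t) (fun x => w (-x) - w t) (-r) from
    funext fun r => rightD_eq_leftD α t w r]
  exact (stronglyMeasurable_leftD (by fun_prop)).comp_measurable measurable_neg

end Frac

/-! ### Bounds, linearity and translation of the integrated pairing. -/

section Pair

variable {E : Type*} [NormedAddCommGroup E] [InnerProductSpace ℝ E]

/-- The integral of the pairing of the two fractional derivatives. -/
def pairing (α s t : ℝ) (h w : ℝ → E) : ℝ :=
  ∫ r in s..t, inner ℝ (leftD α s h r) (rightD α t w r)

lemma measurable_inner_leftD_rightD {α s t : ℝ} {h w : ℝ → E} (hh : Continuous h)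
    (hw : Continuous w) :
    StronglyMeasurable fun r => inner ℝ (leftD α s h r) (rightD α t w r) :=
  (stronglyMeasurable_leftD hh).inner (stronglyMeasurable_rightD hw)

variable {α β β' γ ρ A L s t : ℝ} {h w : ℝ → E}

lemma norm_inner_leftD_rightD_le {r : ℝ} (hx : Exponents α β β' γ ρ)
    (hh : SingularHolder β γ ρ A s t h) (hA : 0 ≤ A) (hw : HolderPath β' L s t w)
    (hr : r ∈ Ioo s t) : ‖inner ℝ (leftD α s h r) (rightD α t w r)‖ ≤
      A * L * pairMaj α β β' γ ρ s t r :=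
  (norm_inner_le_norm _ _).trans (norm_leftD_mul_rightD_le hx hh hA hw hr)

lemma intervalIntegrable_pairing (hx : Exponents α β β' γ ρ) (hst : s < t)
    (hh : SingularHolder β γ ρ A s t h) (hA : 0 ≤ A) (hw : HolderPath β' L s t w) :
    IntervalIntegrable (fun r => inner ℝ (leftD α s h r) (rightD α t w r)) volume s t :=
  intervalIntegrable_of_bound hst.le
    (measurable_inner_leftD_rightD hh.cont hw.cont).aestronglyMeasurable
    ((hx.intervalIntegrable_pairMaj hst).const_mul (A * L))
    fun _ hr => norm_inner_leftD_rightD_le hx hh hA hw hr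

lemma abs_pairing_le (hx : Exponents α β β' γ ρ) (hst : s < t)
    (hh : SingularHolder β γ ρ A s t h) (hA : 0 ≤ A) (hw : HolderPath β' L s t w) :
    |pairing α s t h w| ≤ pairIntConst α β β' γ ρ * (A * L) * (t - s) ^ (β' - ρ) := by
  refine (norm_integral_le_of_bound hst.le
    ((hx.intervalIntegrable_pairMaj hst).const_mul (A * L))
    fun _ hr => norm_inner_leftD_rightD_le hx hh hA hw hr).trans (le_of_eq ?_)
  rw [intervalIntegral.integral_const_mul, hx.integral_pairMaj hst]
  ring

lemma leftD_add {k : ℝ → E} {r A' : ℝ} (hx : Exponents α β β' γ ρ)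
    (hh : SingularHolder β γ ρ A s t h) (hk : SingularHolder β γ ρ A' s t k)
    (hr : r ∈ Ioo s t) :
    leftD α s (fun q => h q + k q) r = leftD α s h r + leftD α s k r := by
  have h1 := intervalIntegrable_leftD_integrand hh.cont hr.1 hx.α_lt_γ hx.α_lt_β hx.β_lt
    (hh.sub_le r hr)
  have h2 := intervalIntegrable_leftD_integrand hk.cont hr.1 hx.α_lt_γ hx.α_lt_β hx.β_lt
    (hk.sub_le r hr)
  have e : ∀ q, ((r - q) ^ (1 + α))⁻¹ • (h r + k r - (h q + k q)) =
      ((r - q) ^ (1 + α))⁻¹ • (h r - h q) + ((r - q) ^ (1 + α))⁻¹ • (k r - k q) := fun q => by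
    rw [← smul_add, add_sub_add_comm]
  simp only [leftD, e]
  rw [intervalIntegral.integral_add h1 h2, smul_add, smul_add]
  abel

lemma rightD_sub {v : ℝ → E} {r L' : ℝ} (hβ' : β' < 1) (hαβ' : 1 - β' < α)
    (hw : HolderPath β' L s t w) (hv : HolderPath β' L' s t v) (hr : r ∈ Ioo s t) :
    rightD α t (fun q => w q - v q) r = rightD α t w r - rightD α t v r := by
  have h1 := intervalIntegrable_rightD_integrand hw.cont hr.2 hβ' hαβ'
    fun q hq => hw.sub_le r q hr.1.le hq.1 hq.2
  have h2 := intervalIntegrable_rightD_integrand hv.cont hr.2 hβ' hαβ'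
    fun q hq => hv.sub_le r q hr.1.le hq.1 hq.2
  have e : ∀ q, ((q - r) ^ (2 - α))⁻¹ • (w r - v r - (w q - v q)) =
      ((q - r) ^ (2 - α))⁻¹ • (w r - w q) - ((q - r) ^ (2 - α))⁻¹ • (v r - v q) := fun q => by
    rw [← smul_sub, sub_sub_sub_comm]
  simp only [rightD, e]
  rw [intervalIntegral.integral_sub h1 h2]
  module

lemma inner_leftD [CompleteSpace E] {r : ℝ} (x : E) (hx : Exponents α β β' γ ρ)
    (hh : SingularHolder β γ ρ A s t h) (hr : r ∈ Ioo s t) :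
    inner ℝ x (leftD α s h r) = leftD α s (fun q => inner ℝ x (h q)) r := by
  have h1 := intervalIntegrable_leftD_integrand hh.cont hr.1 hx.α_lt_γ hx.α_lt_β hx.β_lt
    (hh.sub_le r hr)
  have := (innerSL ℝ x).intervalIntegral_comp_comm h1
  simp only [innerSL_apply_apply] at this
  simp only [leftD, inner_add_right, inner_smul_right, ← this, inner_sub_right, smul_eq_mul]

lemma inner_rightD [CompleteSpace E] {r : ℝ} (x : E) (hβ' : β' < 1) (hαβ' : 1 - β' < α)
    (hw : HolderPath β' L s t w) (hr : r ∈ Ioo s t) :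
    inner ℝ x (rightD α t w r) = rightD α t (fun q => inner ℝ x (w q)) r := by
  have h1 := intervalIntegrable_rightD_integrand hw.cont hr.2 hβ' hαβ'
    fun q hq => hw.sub_le r q hr.1.le hq.1 hq.2
  have := (innerSL ℝ x).intervalIntegral_comp_comm h1
  simp only [innerSL_apply_apply] at this
  simp only [rightD, inner_add_right, inner_smul_right, ← this, inner_sub_right, smul_eq_mul]

lemma integral_congr_Ioo {s t : ℝ} (hst : s ≤ t) {f g : ℝ → ℝ} (hfg : ∀ r ∈ Ioo s t, f r = g r) :
    ∫ r in s..t, f r = ∫ r in s..t, g r := by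
  refine intervalIntegral.integral_congr_ae ?_
  rw [uIoc_of_le hst]
  filter_upwards [ae_Ioc_mem_Ioo s t] with r hr h using hfg r (hr h)

lemma pairing_sub_right {v : ℝ → E} {L' : ℝ} (hx : Exponents α β β' γ ρ) (hst : s < t)
    (hA : 0 ≤ A) (hh : SingularHolder β γ ρ A s t h)
    (hw : HolderPath β' L s t w) (hv : HolderPath β' L' s t v) :
    pairing α s t h (fun q => w q - v q) = pairing α s t h w - pairing α s t h v := by
  unfold pairing
  rw [← intervalIntegral.integral_sub (intervalIntegrable_pairing hx hst hh hA hw)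
    (intervalIntegrable_pairing hx hst hh hA hv)]
  refine integral_congr_Ioo hst.le fun r hr => ?_
  rw [rightD_sub hx.β'_lt hx.β'_gt hw hv hr, inner_sub_right]

lemma pairing_add_left {k : ℝ → E} {A' : ℝ} (hx : Exponents α β β' γ ρ) (hst : s < t)
    (hA : 0 ≤ A) (hA' : 0 ≤ A') (hh : SingularHolder β γ ρ A s t h)
    (hk : SingularHolder β γ ρ A' s t k) (hw : HolderPath β' L s t w) :
    pairing α s t (fun q => h q + k q) w = pairing α s t h w + pairing α s t k w := by
  unfold pairing
  rw [← intervalIntegral.integral_add (intervalIntegrable_pairing hx hst hh hA hw)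
    (intervalIntegrable_pairing hx hst hk hA' hw)]
  refine integral_congr_Ioo hst.le fun r hr => ?_
  rw [leftD_add hx hh hk hr, inner_add_left]

lemma pairing_const_smul (c : ℝ) : pairing α s t (fun q => c • h q) w = c * pairing α s t h w := by
  unfold pairing
  simp only [leftD_const_smul, real_inner_smul_left, intervalIntegral.integral_const_mul]

lemma pairing_congr (hst : s ≤ t) {k v : ℝ → E} (hk : ∀ q ∈ Icc s t, h q = k q)
    (hv : ∀ q ∈ Icc s t, w q = v q) : pairing α s t h w = pairing α s t k v := by
  refine integral_congr_Ioo hst fun r hr => ?_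
  rw [leftD_congr hr.1.le fun q hq => hk q ⟨hq.1, hq.2.trans hr.2.le⟩,
    rightD_congr hr.2.le fun q hq => hv q ⟨hr.1.le.trans hq.1, hq.2⟩]

lemma pairing_comp_add (c : ℝ) : pairing α s t (fun q => h (c + q)) (fun q => w (c + q) - w c) =
    pairing α (c + s) (c + t) h w := by
  unfold pairing
  simp only [leftD_comp_add, rightD_comp_add]
  exact intervalIntegral.integral_comp_add_left
    (fun r => inner ℝ (leftD α (c + s) h r) (rightD α (c + t) w r)) c

end Pair

/-! ### The pairing for continuously differentiable functions -/

/-- Fubini on the triangle `s < r < x ≤ t`. Cutting off `k` at zero encodes `r < x`, so the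
integrand on the plane is a convolution integrand times one further factor. -/
lemma integral_triangle_swap {s t : ℝ} (hst : s ≤ t) {a k b : ℝ → ℝ}
    (hI : Integrable (fun p : ℝ × ℝ => (Ioc s t).indicator a p.2 *
      (Ioc 0 (t - s)).indicator k (p.1 - p.2) * (Ioc s t).indicator b p.1)
      (volume.prod volume)) :
    ∫ r in s..t, a r * ∫ x in r..t, k (x - r) * b x =
      ∫ x in s..t, (∫ r in s..x, a r * k (x - r)) * b x := by
  have hsw := integral_integral_swap (f := fun x r => (Ioc s t).indicator a r *
      (Ioc 0 (t - s)).indicator k (x - r) * (Ioc s t).indicator b x) hI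
  rw [intervalIntegral.integral_of_le hst, intervalIntegral.integral_of_le hst,
    ← integral_indicator measurableSet_Ioc, ← integral_indicator measurableSet_Ioc]
  refine (Eq.trans ?_ hsw.symm).trans ?_
  · refine integral_congr_ae (Eventually.of_forall fun r => ?_)
    by_cases hr : r ∈ Ioc s t
    · simp only [indicator_of_mem hr]
      rw [intervalIntegral.integral_of_le hr.2, ← integral_indicator measurableSet_Ioc,
        ← integral_const_mul]
      refine integral_congr_ae (Eventually.of_forall fun x => ?_)
      by_cases hx : x ∈ Ioc r t
      · have h1 : x - r ∈ Ioc 0 (t - s) := ⟨by linarith [hx.1], by linarith [hx.2, hr.1]⟩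
        have h2 : x ∈ Ioc s t := ⟨hr.1.trans hx.1, hx.2⟩
        simp only [indicator_of_mem hx, indicator_of_mem h1, indicator_of_mem h2, mul_assoc]
      · simp only [indicator_of_notMem hx, mul_zero]
        by_cases h1 : x - r ∈ Ioc 0 (t - s)
        · have h2 : x ∉ Ioc s t := fun h => hx ⟨by linarith [h1.1], h.2⟩
          simp [indicator_of_notMem h2]
        · simp [indicator_of_notMem h1]
    · simp [indicator_of_notMem hr]
  · refine integral_congr_ae (Eventually.of_forall fun x => ?_)
    by_cases hx : x ∈ Ioc s t
    · simp only [indicator_of_mem hx]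
      rw [integral_mul_const, intervalIntegral.integral_of_le hx.1.le,
        integral_Ioc_eq_integral_Ioo, ← integral_indicator measurableSet_Ioo]
      congr 1
      refine integral_congr_ae (Eventually.of_forall fun r => ?_)
      by_cases hr : r ∈ Ioo s x
      · have h1 : x - r ∈ Ioc 0 (t - s) := ⟨by linarith [hr.2], by linarith [hx.2, hr.1]⟩
        have h2 : r ∈ Ioc s t := ⟨hr.1, hr.2.le.trans hx.2⟩
        simp only [indicator_of_mem hr, indicator_of_mem h1, indicator_of_mem h2]
      · simp only [indicator_of_notMem hr]
        by_cases h1 : x - r ∈ Ioc 0 (t - s)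
        · have h2 : r ∉ Ioc s t := fun h => hr ⟨h.1, by linarith [h1.1]⟩
          simp [indicator_of_notMem h2]
        · simp [indicator_of_notMem h1]
    · simp [indicator_of_notMem hx]

/-- Two integrable functions give an integrable convolution integrand, and the third factor may be
any bounded one. This variant serves `pairing_of_C1`, its mirror image `integral_leftD_mul_kernel`.
-/
lemma integrable_triangle_of_bdd_right {s t M : ℝ} (hst : s ≤ t) {a k b : ℝ → ℝ}
    (ha : IntervalIntegrable a volume s t) (hk : IntervalIntegrable k volume 0 (t - s))
    (hb : Measurable b) (hbM : ∀ x ∈ Ioc s t, |b x| ≤ M) :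
    Integrable (fun p : ℝ × ℝ => (Ioc s t).indicator a p.2 *
      (Ioc 0 (t - s)).indicator k (p.1 - p.2) * (Ioc s t).indicator b p.1)
      (volume.prod volume) := by
  rw [intervalIntegrable_iff_integrableOn_Ioc_of_le (by linarith)] at ha hk
  have h := Integrable.convolution_integrand (ContinuousLinearMap.mul ℝ ℝ)
    (ha.integrable_indicator measurableSet_Ioc) (hk.integrable_indicator measurableSet_Ioc)
  refine h.mul_bdd (c := max M 0) ?_ (Eventually.of_forall fun p => ?_)
  · exact ((hb.indicator measurableSet_Ioc).comp measurable_fst).aestronglyMeasurable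
  · by_cases hp : p.1 ∈ Ioc s t
    · rw [indicator_of_mem hp]; exact (hbM _ hp).trans (le_max_left _ _)
    · rw [indicator_of_notMem hp]; simp

lemma integrable_triangle_of_bdd_left {s t M : ℝ} (hst : s ≤ t) {a k b : ℝ → ℝ}
    (hb : IntervalIntegrable b volume s t) (hk : IntervalIntegrable k volume 0 (t - s))
    (ha : Measurable a) (haM : ∀ x ∈ Ioc s t, |a x| ≤ M) :
    Integrable (fun p : ℝ × ℝ => (Ioc s t).indicator a p.2 *
      (Ioc 0 (t - s)).indicator k (p.1 - p.2) * (Ioc s t).indicator b p.1)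
      (volume.prod volume) := by
  rw [intervalIntegrable_iff_integrableOn_Ioc_of_le (by linarith)] at hb hk
  have h := (Integrable.convolution_integrand (ContinuousLinearMap.mul ℝ ℝ)
    (hb.integrable_indicator measurableSet_Ioc)
    (hk.integrable_indicator measurableSet_Ioc).comp_neg).swap
  have h2 := h.bdd_mul (c := max M 0) (f := fun p : ℝ × ℝ => (Ioc s t).indicator a p.2)
    ((ha.indicator measurableSet_Ioc).comp measurable_snd).aestronglyMeasurable
    (Eventually.of_forall fun p => ?_)
  · refine h2.congr (Eventually.of_forall fun p => ?_)
    simp only [Function.comp_apply, Prod.fst_swap, Prod.snd_swap, ContinuousLinearMap.mul_apply',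
      neg_sub]
    ring
  · by_cases hp : p.2 ∈ Ioc s t
    · rw [indicator_of_mem hp]; exact (haM _ hp).trans (le_max_left _ _)
    · rw [indicator_of_notMem hp]; simp

/-- `h` is continuous, with derivative on `(s, t)` given by the continuous function `h'`. -/
structure C1Data (s t : ℝ) (h h' : ℝ → ℝ) : Prop where
  cont : Continuous h
  cont' : Continuous h'
  deriv : ∀ x ∈ Ioo s t, HasDerivAt h (h' x) x

lemma C1Data.mono {s t s' t' : ℝ} {h h' : ℝ → ℝ} (H : C1Data s t h h') (hs : s ≤ s')
    (ht : t' ≤ t) : C1Data s' t' h h' :=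
  ⟨H.cont, H.cont', fun x hx => H.deriv x ⟨hs.trans_lt hx.1, hx.2.trans_le ht⟩⟩

lemma C1Data.exists_lipschitz {s t : ℝ} {h h' : ℝ → ℝ} (H : C1Data s t h h') :
    ∃ M, 0 ≤ M ∧ (∀ x ∈ Icc s t, |h' x| ≤ M) ∧ (∀ x ∈ Icc s t, |h x| ≤ M) ∧
      ∀ r q, s ≤ r → r < q → q ≤ t → |h q - h r| ≤ M * (q - r) := by
  obtain ⟨M₁, hM₁⟩ := isCompact_Icc.exists_bound_of_continuousOn (s := Icc s t)
    H.cont'.continuousOn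
  obtain ⟨M₂, hM₂⟩ := isCompact_Icc.exists_bound_of_continuousOn (s := Icc s t)
    H.cont.continuousOn
  have h1 : M₁ ≤ max (max M₁ M₂) 0 := (le_max_left _ _).trans (le_max_left _ _)
  have h2 : M₂ ≤ max (max M₁ M₂) 0 := (le_max_right _ _).trans (le_max_left _ _)
  refine ⟨max (max M₁ M₂) 0, le_max_right _ _, fun x hx => (hM₁ x hx).trans h1,
    fun x hx => (hM₂ x hx).trans h2, fun r q hr hrq hq => ?_⟩
  obtain ⟨c, hc, hcd⟩ := exists_hasDerivAt_eq_slope h h' hrq H.cont.continuousOn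
    fun x hx => H.deriv x ⟨hr.trans_lt hx.1, hx.2.trans_le hq⟩
  have h0 : 0 < q - r := sub_pos.2 hrq
  rw [eq_div_iff h0.ne'] at hcd
  rw [← hcd, abs_mul, abs_of_pos h0]
  exact mul_le_mul_of_nonneg_right
    ((hM₁ c ⟨hr.trans hc.1.le, hc.2.le.trans hq⟩).trans h1) h0.le

lemma intervalIntegrable_sub_rpow {c r s : ℝ} (hc : -1 < c) (hsr : s < r) :
    IntervalIntegrable (fun q => (r - q) ^ c) volume s r := by
  simpa using intervalIntegrable_beta (a := 0) (by norm_num) hc hsr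

/-- Integration by parts: differentiate `(h r - h q) * (r - q) ^ (-α)` in `q` and integrate over
`[s, r]`. -/
lemma leftD_of_C1 {α s r : ℝ} (hα1 : α < 1) (hsr : s < r) {h h' : ℝ → ℝ}
    (H : C1Data s r h h') :
    leftD α s h r = (r - s) ^ (-α) * h s + ∫ q in s..r, h' q * (r - q) ^ (-α) := by
  obtain ⟨M, hM0, -, -, hM⟩ := H.exists_lipschitz
  -- At `q = r` the kernel blows up, but the Lipschitz bound leaves `M * (r - q) ^ (1 - α)`, which
  -- tends to zero.
  have hcont : ContinuousOn (fun q => (h r - h q) * (r - q) ^ (-α)) (Icc s r) := by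
    intro q hq
    rcases eq_or_lt_of_le hq.2 with rfl | hlt
    · rw [ContinuousWithinAt, sub_self, zero_mul]
      refine squeeze_zero_norm' (a := fun x => M * (q - x) ^ (1 - α)) ?_ ?_
      · filter_upwards [self_mem_nhdsWithin] with x hx
        rcases eq_or_lt_of_le hx.2 with rfl | hlt
        · simp [Real.zero_rpow (by linarith : (1 - α) ≠ 0)]
        · have h0 : 0 < q - x := sub_pos.2 hlt
          rw [norm_mul, Real.norm_of_nonneg (Real.rpow_nonneg h0.le _), sub_eq_add_neg 1 α,
            Real.rpow_add h0, Real.rpow_one, ← mul_assoc]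
          exact mul_le_mul_of_nonneg_right (hM x q hx.1 hlt le_rfl) (Real.rpow_nonneg h0.le _)
      · have : ContinuousAt (fun x => M * (q - x) ^ (1 - α)) q :=
          continuousAt_const.mul ((by fun_prop : ContinuousAt (fun x => q - x) q).rpow_const
            (Or.inr (by linarith)))
        have h2 := this.tendsto
        simp only [sub_self, Real.zero_rpow (by linarith : (1 - α) ≠ 0), mul_zero] at h2
        exact h2.mono_left nhdsWithin_le_nhds
    · refine ContinuousAt.continuousWithinAt ?_
      have hc := H.cont
      refine ContinuousAt.mul (by fun_prop) ?_
      exact (by fun_prop : ContinuousAt (fun x => r - x) q).rpow_const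
        (Or.inl (sub_pos.2 hlt).ne')
  have hint1 : IntervalIntegrable (fun q => ((r - q) ^ (1 + α))⁻¹ • (h r - h q)) volume s r :=
    -- With `Q = 0` the weighted exponent is immaterial; `(α + 1) / 2` merely lies between `α` and
    -- `1`.
    intervalIntegrable_leftD_integrand (α := α) (γ := 1) (β := (α + 1) / 2) (P := M) (Q := 0)
      H.cont hsr hα1 (by linarith) (by linarith) fun q hq => by
        simpa using hM q r hq.1.le hq.2 le_rfl
  have hint2 : IntervalIntegrable (fun q => h' q * (r - q) ^ (-α)) volume s r :=
    (intervalIntegrable_sub_rpow (by linarith) hsr).continuousOn_mul H.cont'.continuousOn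
  have hftc := intervalIntegral.integral_eq_sub_of_hasDerivAt_of_le hsr.le hcont
    (f' := fun q => α * (((r - q) ^ (1 + α))⁻¹ • (h r - h q)) - h' q * (r - q) ^ (-α))
    (fun q hq => by
      have h0 : 0 < r - q := sub_pos.2 hq.2
      have d1 := (H.deriv q hq).const_sub (h r)
      have d2 := ((hasDerivAt_id q).const_sub r).rpow_const (p := -α) (Or.inl h0.ne')
      refine (d1.mul d2).congr_deriv ?_
      have : -α - 1 = -(1 + α) := by ring
      simp only [id, smul_eq_mul, this, Real.rpow_neg h0.le]
      ring)
    ((hint1.const_mul α).sub hint2)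
  rw [intervalIntegral.integral_sub (hint1.const_mul α) hint2,
    intervalIntegral.integral_const_mul] at hftc
  have h0 : 0 < r - s := sub_pos.2 hsr
  simp only [leftD, smul_eq_mul, sub_self, zero_mul, ← Real.rpow_neg h0.le] at hftc ⊢
  linarith

lemma rightD_of_C1 {α t r : ℝ} (hα : 0 < α) (hrt : r < t) {w w' : ℝ → ℝ}
    (H : C1Data r t w w') :
    rightD α t w r = -∫ x in r..t, (x - r) ^ (α - 1) * w' x := by
  have h1 : C1Data (-t) (-r) (fun x => w (-x) - w t) (fun x => -w' (-x)) := by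
    obtain ⟨hc, hc', hd⟩ := H
    refine ⟨by fun_prop, by fun_prop, fun x hx => ?_⟩
    have := (hd (-x) ⟨by linarith [hx.2], by linarith [hx.1]⟩).comp x (hasDerivAt_neg x)
    simpa using this.sub_const (w t)
  rw [rightD_eq_leftD, leftD_of_C1 (by linarith) (by linarith) h1]
  have h2 := intervalIntegral.integral_comp_neg (a := r) (b := t)
    (fun q => -w' (-q) * (-r - q) ^ (-(1 - α)))
  simp only [neg_neg] at h2 ⊢
  rw [← h2, ← intervalIntegral.integral_neg]
  simp only [sub_self, mul_zero, zero_add]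
  congr 1
  funext x
  have e1 : -r - -x = x - r := by ring
  have e2 : -(1 - α) = α - 1 := by ring
  rw [e1, e2]
  ring

lemma C1Data.abs_leftD_le {α s t : ℝ} (hα : 0 < α) (hα1 : α < 1) {h h' : ℝ → ℝ}
    (H : C1Data s t h h') : ∃ X, ∀ r ∈ Ioc s t, |leftD α s h r| ≤ X * (r - s) ^ (-α) := by
  obtain ⟨M, hM0, -, hA, hM⟩ := H.exists_lipschitz
  refine ⟨M + α * (M * (betaInt 0 (1 - 1 - α) * (t - s))), fun r hr => ?_⟩
  have h0 : 0 < r - s := sub_pos.2 hr.1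
  have h := norm_leftD_le (α := α) (γ := 1) (β := (α + 1) / 2) (P := M) (Q := 0) (A := M)
    (h := h) hr.1 hα hα1 (by linarith) (by linarith) (hA r ⟨hr.1.le, hr.2⟩) fun q hq => by
        simpa using hM q r hq.1.le hq.2 hr.2
  rw [zero_mul, add_zero, sub_eq_add_neg 1 α, Real.rpow_add h0, Real.rpow_one] at h
  refine h.trans ?_
  rw [add_mul]
  have hb := betaInt_nonneg 0 (1 - 1 - α)
  have e : α * (M * (betaInt 0 (1 - 1 - α) * (t - s))) * (r - s) ^ (-α) =
    α * (M * (betaInt 0 (1 - 1 - α) * ((t - s) * (r - s) ^ (-α)))) := by ring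
  rw [e]
  have := Real.rpow_nonneg h0.le (-α)
  have h3 := hr.2
  gcongr

/-- Abel inversion: the fractional integral undoes the fractional derivative. After the exchange of
integrals the inner one, of `(r - q) ^ (-α) * (x - r) ^ (α - 1)`, is scale invariant and hence the
same constant for every `q`, so that `h'` integrates back to `h x - h s`. -/
lemma integral_leftD_mul_kernel {α s x : ℝ} (hα : 0 < α) (hα1 : α < 1) (hsx : s < x)
    {h h' : ℝ → ℝ} (H : C1Data s x h h') :
    ∫ r in s..x, leftD α s h r * (x - r) ^ (α - 1) = betaInt (-α) (α - 1) * h x := by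
  obtain ⟨X, hX⟩ := H.abs_leftD_le hα hα1
  obtain ⟨M, -, hM', -, -⟩ := H.exists_lipschitz
  have hb := intervalIntegrable_beta (s := s) (t := x) (a := -α) (b := α - 1)
    (by linarith) (by linarith) hsx
  have hexp : ∀ q < x, ∫ r in q..x, (r - q) ^ (-α) * (x - r) ^ (α - 1) =
      betaInt (-α) (α - 1) := fun q hq => by
    rw [integral_beta hq, show -α + (α - 1) + 1 = 0 by ring, Real.rpow_zero, mul_one]
  have hI : IntervalIntegrable (fun r => leftD α s h r * (x - r) ^ (α - 1)) volume s x := by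
    refine intervalIntegrable_of_bound hsx.le ?_ (hb.const_mul X) fun r hr => ?_
    · exact ((stronglyMeasurable_leftD H.cont).mul
        ((measurable_const.sub measurable_id).pow_const _).stronglyMeasurable).aestronglyMeasurable
    · have h0 : 0 ≤ (x - r) ^ (α - 1) := Real.rpow_nonneg (by linarith [hr.2]) _
      rw [norm_mul, Real.norm_of_nonneg h0, ← mul_assoc]
      exact mul_le_mul_of_nonneg_right (hX r ⟨hr.1, hr.2.le⟩) h0
  have hsw := integral_triangle_swap hsx.le (integrable_triangle_of_bdd_left (M := M) hsx.le
    (a := h') (k := fun y => y ^ (-α)) (b := fun r => (x - r) ^ (α - 1))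
    (intervalIntegrable_sub_rpow (by linarith) hsx)
    (intervalIntegral.intervalIntegrable_rpow' (by linarith)) H.cont'.measurable
    fun q hq => hM' q ⟨hq.1.le, hq.2⟩)
  have hL : ∫ q in s..x, h' q * ∫ r in q..x, (r - q) ^ (-α) * (x - r) ^ (α - 1) =
      (h x - h s) * betaInt (-α) (α - 1) := by
    rw [integral_congr_Ioo hsx.le (g := fun q => h' q * betaInt (-α) (α - 1))
      fun q hq => by rw [hexp q hq.2], intervalIntegral.integral_mul_const,
      intervalIntegral.integral_eq_sub_of_hasDerivAt_of_le hsx.le H.cont.continuousOn H.deriv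
      (H.cont'.intervalIntegrable _ _)]
  rw [hL, integral_congr_Ioo hsx.le (g := fun r => leftD α s h r * (x - r) ^ (α - 1) -
      h s * ((r - s) ^ (-α) * (x - r) ^ (α - 1))) fun r hr => by
      rw [leftD_of_C1 hα1 hr.1 (H.mono le_rfl hr.2.le)]; ring,
    intervalIntegral.integral_sub hI (hb.const_mul _), intervalIntegral.integral_const_mul,
    hexp s hsx] at hsw
  linarith

/-- The right derivative is a fractional integral of `w'`; moving the kernel onto the left
derivative by Fubini allows Abel inversion. The right-hand side no longer depends on the endpoints
except through the domain of integration. -/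
lemma pairing_of_C1 {α s t : ℝ} (hα : 0 < α) (hα1 : α < 1) (hst : s < t)
    {h h' w w' : ℝ → ℝ} (H : C1Data s t h h') (W : C1Data s t w w') :
    pairing α s t h w = -betaInt (-α) (α - 1) * ∫ x in s..t, h x * w' x := by
  obtain ⟨X, hX⟩ := H.abs_leftD_le hα hα1
  obtain ⟨M, -, hM', -, -⟩ := W.exists_lipschitz
  have hI : IntervalIntegrable (leftD α s h) volume s t := by
    have hb := intervalIntegrable_beta (s := s) (t := t) (a := -α) (b := 0)
      (by linarith) (by norm_num) hst
    refine intervalIntegrable_of_bound hst.le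
      (stronglyMeasurable_leftD H.cont).aestronglyMeasurable (hb.const_mul X) fun r hr => ?_
    simpa using hX r ⟨hr.1, hr.2.le⟩
  have hsw := integral_triangle_swap hst.le (integrable_triangle_of_bdd_right (M := M) hst.le
    (a := leftD α s h) (k := fun y => y ^ (α - 1)) (b := w') hI
    (intervalIntegral.intervalIntegrable_rpow' (by linarith)) W.cont'.measurable
    fun q hq => hM' q ⟨hq.1.le, hq.2⟩)
  rw [integral_congr_Ioo hst.le (g := fun r => -(inner ℝ (leftD α s h r) (rightD α t w r)))
    fun r hr => by
      rw [rightD_of_C1 hα hr.2 (W.mono hr.1.le le_rfl), RCLike.inner_apply, conj_trivial]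
      ring, intervalIntegral.integral_neg,
    integral_congr_Ioo hst.le (f := fun x => (∫ r in s..x, leftD α s h r * (x - r) ^ (α - 1)) * w' x)
      (g := fun x => betaInt (-α) (α - 1) * (h x * w' x)) fun x hx => by
      rw [integral_leftD_mul_kernel hα hα1 hx.1 (H.mono le_rfl hx.2.le)]; ring,
    intervalIntegral.integral_const_mul] at hsw
  rw [pairing]
  linarith

/-! ### Steklov averages -/

/-- A bounded continuous function whose `β`-Hölder bound degenerates at `s` only. -/
structure WeightedPath {E : Type*} [NormedAddCommGroup E] (β A s : ℝ) (h : ℝ → E) : Prop where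
  cont : Continuous h
  norm_le : ∀ r, ‖h r‖ ≤ A
  sub_le : ∀ r q, s < q → q < r → ‖h r - h q‖ ≤ A * ((q - s) ^ (-β) * (r - q) ^ β)

section Weighted

variable {E : Type*} [NormedAddCommGroup E] {β A s : ℝ} {h : ℝ → E}

lemma WeightedPath.nonneg (hh : WeightedPath β A s h) : 0 ≤ A :=
  (norm_nonneg _).trans (hh.norm_le 0)

lemma WeightedPath.mono (hh : WeightedPath β A s h) (hβ : 0 ≤ β) {s' : ℝ} (hs : s ≤ s') :
    WeightedPath β A s' h := by
  refine ⟨hh.cont, hh.norm_le, fun r q hq hr => (hh.sub_le r q (hs.trans_lt hq) hr).trans ?_⟩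
  have h0 := hh.nonneg
  have h1 : 0 < q - s' := sub_pos.2 hq
  have h2 := Real.rpow_le_rpow_of_nonpos h1 (by linarith : q - s' ≤ q - s) (neg_nonpos.2 hβ)
  have h3 : 0 ≤ (r - q) ^ β := Real.rpow_nonneg (by linarith) _
  gcongr

lemma WeightedPath.singularHolder (hh : WeightedPath β A s h) (γ t : ℝ) :
    SingularHolder β γ 0 A s t h := by
  refine ⟨hh.cont, fun r _ => by simpa using hh.norm_le r, fun r hr q hq => ?_⟩
  have h0 := hh.nonneg
  have h1 : 0 ≤ (t - r) ^ (-(0 + γ)) := Real.rpow_nonneg (by linarith [hr.2]) _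
  have h2 : 0 ≤ (r - q) ^ γ := Real.rpow_nonneg (by linarith [hq.2]) _
  rw [neg_zero, Real.rpow_zero, mul_one]
  have := mul_nonneg (mul_nonneg h0 h1) h2
  linarith [hh.sub_le r q hq.1 hq.2]

end Weighted

/-- The Steklov average `ε⁻¹ ∫_0^ε h (r + y) dy`. -/
def steklov (ε : ℝ) (h : ℝ → ℝ) (r : ℝ) : ℝ := ε⁻¹ * ∫ y in (0 : ℝ)..ε, h (r + y)

lemma steklov_eq {ε : ℝ} {h : ℝ → ℝ} (hc : Continuous h) (r : ℝ) :
    steklov ε h r = ε⁻¹ * ((∫ y in (0 : ℝ)..(r + ε), h y) - ∫ y in (0 : ℝ)..r, h y) := by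
  rw [steklov, intervalIntegral.integral_comp_add_left, add_zero,
    intervalIntegral.integral_interval_sub_left (hc.intervalIntegrable _ _)
      (hc.intervalIntegrable _ _)]

lemma steklov_hasDerivAt {ε : ℝ} {h : ℝ → ℝ} (hc : Continuous h) (r : ℝ) :
    HasDerivAt (steklov ε h) (ε⁻¹ * (h (r + ε) - h r)) r := by
  rw [show steklov ε h = fun r => ε⁻¹ *
    ((∫ y in (0 : ℝ)..(r + ε), h y) - ∫ y in (0 : ℝ)..r, h y) from
    funext fun r => steklov_eq hc r]
  have d : ∀ x, HasDerivAt (fun x => ∫ y in (0 : ℝ)..x, h y) (h x) x := fun x =>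
    (hc.integral_hasStrictDerivAt 0 x).hasDerivAt
  exact (((d (r + ε)).comp_add_const r ε).sub (d r)).const_mul _

lemma steklov_C1 {ε : ℝ} {h : ℝ → ℝ} (hc : Continuous h) (s t : ℝ) :
    C1Data s t (steklov ε h) fun r => ε⁻¹ * (h (r + ε) - h r) :=
  ⟨continuous_iff_continuousAt.2 fun r => (steklov_hasDerivAt hc r).continuousAt, by fun_prop,
    fun r _ => steklov_hasDerivAt hc r⟩

lemma steklov_tendsto {h : ℝ → ℝ} (hc : Continuous h) (r : ℝ) :
    Tendsto (fun ε => steklov ε h r) (𝓝[>] 0) (𝓝 (h r)) := by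
  have d : HasDerivAt (fun x => ∫ y in (0 : ℝ)..x, h y) (h r) r :=
    (hc.integral_hasStrictDerivAt 0 r).hasDerivAt
  refine d.tendsto_slope_zero_right.congr fun ε => ?_
  rw [steklov_eq hc, smul_eq_mul]

lemma abs_steklov_le {ε M : ℝ} (hε : 0 < ε) {h : ℝ → ℝ} {r : ℝ}
    (hM : ∀ y, 0 < y → |h (r + y)| ≤ M) : |steklov ε h r| ≤ M := by
  have := intervalIntegral.norm_integral_le_of_norm_le_const (a := 0) (b := ε) (C := M)
    (f := fun y => h (r + y)) fun y hy => by
      rw [uIoc_of_le hε.le] at hy; exact hM y hy.1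
  rw [sub_zero, abs_of_pos hε, Real.norm_eq_abs] at this
  rw [steklov, abs_mul, abs_of_pos (inv_pos.2 hε), inv_mul_le_iff₀ hε]
  linarith

/-- The average looks forward only, away from the singularity at `s`, where the weight decreases.
The constant `A` is therefore kept for all `ε`, as dominated convergence requires. -/
lemma WeightedPath.steklov {β A s ε : ℝ} {h : ℝ → ℝ} (hh : WeightedPath β A s h) (hβ : 0 ≤ β)
    (hε : 0 < ε) : WeightedPath β A s (steklov ε h) := by
  refine ⟨(steklov_C1 hh.cont 0 0).cont, fun r => abs_steklov_le hε fun y _ => hh.norm_le _,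
    fun r q hq hr => ?_⟩
  have hc := hh.cont
  have e : RoughEvolution.steklov ε h r - RoughEvolution.steklov ε h q =
      RoughEvolution.steklov ε (fun y => h (r - q + y) - h y) q := by
    have e1 : ∀ y, r - q + (q + y) = r + y := fun y => by ring
    simp only [RoughEvolution.steklov, e1]
    rw [intervalIntegral.integral_sub ((by fun_prop : Continuous _).intervalIntegrable _ _)
      ((by fun_prop : Continuous _).intervalIntegrable _ _), mul_sub]
  rw [e]
  refine abs_steklov_le hε fun y hy => ?_
  have h1 := hh.sub_le (r - q + (q + y)) (q + y) (by linarith) (by linarith)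
  rw [show r - q + (q + y) - (q + y) = r - q by ring] at h1
  refine h1.trans ?_
  have h0 := hh.nonneg
  have h1 : 0 < q - s := sub_pos.2 hq
  have h2 := Real.rpow_le_rpow_of_nonpos h1 (by linarith : q - s ≤ q + y - s) (neg_nonpos.2 hβ)
  have h3 : 0 ≤ (r - q) ^ β := Real.rpow_nonneg (by linarith) _
  gcongr

lemma C1Data.holderPath {β' s t : ℝ} (hβ' : β' < 1) {w w' : ℝ → ℝ}
    (W : C1Data s t w w') : ∃ L, HolderPath β' L s t w := by
  obtain ⟨M, hM0, -, -, hM⟩ := W.exists_lipschitz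
  refine ⟨M * (t - s) ^ (1 - β'), W.cont, fun r q hr hrq hq => ?_⟩
  have h0 : 0 < q - r := sub_pos.2 hrq
  rw [norm_sub_rev]
  refine (hM r q hr hrq hq).trans ?_
  have e : q - r = (q - r) ^ (1 - β') * (q - r) ^ β' := by
    rw [← Real.rpow_add h0]; simp
  have h1 : (q - r) ^ (1 - β') ≤ (t - s) ^ (1 - β') :=
    Real.rpow_le_rpow h0.le (by linarith) (by linarith)
  have h2 := Real.rpow_nonneg h0.le β'
  calc M * (q - r) = M * ((q - r) ^ (1 - β') * (q - r) ^ β') := by rw [← e]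
    _ ≤ M * ((t - s) ^ (1 - β') * (q - r) ^ β') := by gcongr
    _ = _ := by ring

lemma Exponents.β_nonneg {α β β' γ ρ : ℝ} (hx : Exponents α β β' γ ρ) : 0 ≤ β :=
  (hx.α_pos.trans hx.α_lt_β).le

lemma WeightedPath.leftD_steklov_tendsto {α β β' γ A s r : ℝ} (hx : Exponents α β β' γ 0)
    {h : ℝ → ℝ} (hh : WeightedPath β A s h) (hsr : s < r) :
    Tendsto (fun ε => leftD α s (RoughEvolution.steklov ε h) r) (𝓝[>] 0) (𝓝 (leftD α s h r)) := by
  refine ((steklov_tendsto hh.cont r).const_smul _).add (Tendsto.const_smul ?_ _)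
  refine intervalIntegral.tendsto_integral_filter_of_dominated_convergence
    (fun q => 0 * ((q - s) ^ (0 : ℝ) * (r - q) ^ (γ - 1 - α)) +
        A * ((q - s) ^ (-β) * (r - q) ^ (β - 1 - α))) ?_ ?_
    (intervalIntegrable_leftD_majorant 0 A hsr hx.α_lt_γ hx.α_lt_β hx.β_lt) ?_
  · exact Eventually.of_forall fun ε =>
      (measurable_leftD_integrand (steklov_C1 hh.cont 0 0).cont).aestronglyMeasurable
  · filter_upwards [self_mem_nhdsWithin] with ε hε
    rw [uIoc_of_le hsr.le]
    filter_upwards [ae_Ioc_mem_Ioo s r] with q hq hq'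
    refine leftD_integrand_norm_le (fun q hq => ?_) (hq hq')
    rw [zero_mul, zero_add]
    exact (hh.steklov hx.β_nonneg hε).sub_le r q hq.1 hq.2
  · exact Eventually.of_forall fun q _ =>
      ((steklov_tendsto hh.cont r).sub (steklov_tendsto hh.cont q)).const_smul _

/-- The formula holds for the C¹ Steklov averages of `h`, and both sides converge by dominated
convergence as `ε` tends to zero. -/
lemma WeightedPath.pairing_of_C1 {α β β' γ A s t : ℝ} (hx : Exponents α β β' γ 0) (hst : s < t)
    {h w w' : ℝ → ℝ} (hh : WeightedPath β A s h) (W : C1Data s t w w') :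
    pairing α s t h w = -betaInt (-α) (α - 1) * ∫ x in s..t, h x * w' x := by
  have hα1 : α < 1 := hx.α_lt_β.trans hx.β_lt
  obtain ⟨L, hL⟩ := W.holderPath hx.β'_lt
  have T1 : Tendsto (fun ε => pairing α s t (RoughEvolution.steklov ε h) w) (𝓝[>] 0)
      (𝓝 (pairing α s t h w)) := by
    refine intervalIntegral.tendsto_integral_filter_of_dominated_convergence
      (fun r => A * L * pairMaj α β β' γ 0 s t r) ?_ ?_
      ((hx.intervalIntegrable_pairMaj hst).const_mul _) ?_
    · exact Eventually.of_forall fun ε => (measurable_inner_leftD_rightD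
        (steklov_C1 hh.cont 0 0).cont hL.cont).aestronglyMeasurable
    · filter_upwards [self_mem_nhdsWithin] with ε hε
      rw [uIoc_of_le hst.le]
      filter_upwards [ae_Ioc_mem_Ioo s t] with q hq hq'
      exact norm_inner_leftD_rightD_le hx
        ((hh.steklov hx.β_nonneg hε).singularHolder γ t) hh.nonneg hL (hq hq')
    · refine Eventually.of_forall fun r hr => ?_
      rw [uIoc_of_le hst.le] at hr
      exact (hh.leftD_steklov_tendsto hx hr.1).inner tendsto_const_nhds
  have T2 : Tendsto (fun ε => -betaInt (-α) (α - 1) *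
      ∫ x in s..t, RoughEvolution.steklov ε h x * w' x) (𝓝[>] 0)
      (𝓝 (-betaInt (-α) (α - 1) * ∫ x in s..t, h x * w' x)) := by
    refine Tendsto.const_mul _ ?_
    refine intervalIntegral.tendsto_integral_filter_of_dominated_convergence
      (fun r => A * |w' r|) ?_ ?_ ?_ ?_
    · exact Eventually.of_forall fun ε =>
        ((steklov_C1 hh.cont 0 0).cont.mul W.cont').aestronglyMeasurable
    · filter_upwards [self_mem_nhdsWithin] with ε hε
      refine Eventually.of_forall fun r _ => ?_
      rw [norm_mul]
      exact mul_le_mul_of_nonneg_right ((hh.steklov hx.β_nonneg hε).norm_le r) (abs_nonneg _)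
    · exact (continuous_const.mul W.cont'.abs).intervalIntegrable _ _
    · exact Eventually.of_forall fun r _ => (steklov_tendsto hh.cont r).mul tendsto_const_nhds
  exact tendsto_nhds_unique T1 (T2.congr fun ε =>
    (RoughEvolution.pairing_of_C1 hx.α_pos hα1 hst (steklov_C1 hh.cont s t) W).symm)

/-! ### Additivity of the pairing -/

/-- A `β'`-Hölder function on `[s, t]` in the closure of the continuously differentiable
functions with respect to the Hölder seminorm. -/
structure LittlePath (β' L s t : ℝ) (w : ℝ → ℝ) : Prop where
  holder : HolderPath β' L s t w
  approx : ∀ ε > 0, ∃ v v' : ℝ → ℝ, C1Data s t v v' ∧ HolderPath β' ε s t fun r => w r - v r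

lemma HolderPath.mono {E : Type*} [NormedAddCommGroup E] {β' L s t s' t' : ℝ} {w : ℝ → E}
    (hw : HolderPath β' L s t w) (hs : s ≤ s') (ht : t' ≤ t) : HolderPath β' L s' t' w :=
  ⟨hw.cont, fun r q h1 h2 h3 => hw.sub_le r q (hs.trans h1) h2 (h3.trans ht)⟩

lemma abs_pairing_sub_le {α β β' γ A L s t ε : ℝ} (hx : Exponents α β β' γ 0) (hst : s < t)
    {h w v v' : ℝ → ℝ} (hh : WeightedPath β A s h) (hw : HolderPath β' L s t w)
    (W : C1Data s t v v') (hε : HolderPath β' ε s t fun r => w r - v r) :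
    |pairing α s t h w - -betaInt (-α) (α - 1) * ∫ x in s..t, h x * v' x| ≤
      pairIntConst α β β' γ 0 * (A * ε) * (t - s) ^ (β' - 0) := by
  obtain ⟨L', hL'⟩ := W.holderPath hx.β'_lt
  rw [← hh.pairing_of_C1 hx hst W,
    ← pairing_sub_right hx hst hh.nonneg (hh.singularHolder γ t) hw hL']
  exact abs_pairing_le hx hst (hh.singularHolder γ t) hh.nonneg hε

/-- Replacing `w` by a C¹ function `ε`-close in Hölder seminorm changes each of the three pairings
by a multiple of `ε`, and for the replacement all three are the same constant times ordinary
integrals of `h v'`. -/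
lemma pairing_add_adjacent_real {α β β' γ A L s m t : ℝ} (hx : Exponents α β β' γ 0)
    (hsm : s < m) (hmt : m < t) {h w : ℝ → ℝ} (hh : WeightedPath β A s h)
    (hw : LittlePath β' L s t w) :
    pairing α s t h w = pairing α s m h w + pairing α m t h w := by
  set K := pairIntConst α β β' γ 0
  have hK : 0 ≤ K := hx.pairIntConst_nonneg
  have hA := hh.nonneg
  set C := K * A * ((t - s) ^ (β' - 0) + (m - s) ^ (β' - 0) + (t - m) ^ (β' - 0))
  have hC : 0 ≤ C := mul_nonneg (mul_nonneg hK hA) (add_nonneg (add_nonneg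
    (Real.rpow_nonneg (by linarith) _) (Real.rpow_nonneg (by linarith) _))
    (Real.rpow_nonneg (by linarith) _))
  have key : ∀ ε > 0, |pairing α s t h w - (pairing α s m h w + pairing α m t h w)| ≤ C * ε := by
    intro ε hε
    obtain ⟨v, v', hv, hwv⟩ := hw.approx ε hε
    have b1 := abs_pairing_sub_le hx (hsm.trans hmt) hh hw.holder hv hwv
    have b2 := abs_pairing_sub_le hx hsm hh (hw.holder.mono le_rfl hmt.le) (hv.mono le_rfl hmt.le)
      (hwv.mono le_rfl hmt.le)
    have b3 := abs_pairing_sub_le hx hmt (hh.mono hx.β_nonneg hsm.le)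
      (hw.holder.mono hsm.le le_rfl) (hv.mono hsm.le le_rfl) (hwv.mono hsm.le le_rfl)
    have hcont : Continuous fun x => h x * v' x := hh.cont.mul hv.cont'
    have hadd := intervalIntegral.integral_add_adjacent_intervals (μ := volume)
      (hcont.intervalIntegrable s m) (hcont.intervalIntegrable m t)
    rw [← hadd, mul_add] at b1
    have e : C * ε = K * (A * ε) * (t - s) ^ (β' - 0) + K * (A * ε) * (m - s) ^ (β' - 0) +
        K * (A * ε) * (t - m) ^ (β' - 0) := by simp only [C]; ring
    rw [e]
    rw [abs_le] at b1 b2 b3 ⊢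
    constructor <;> linarith [b1.1, b1.2, b2.1, b2.2, b3.1, b3.2]
  by_contra hne
  have hpos : 0 < |pairing α s t h w - (pairing α s m h w + pairing α m t h w)| :=
    abs_pos.2 (sub_ne_zero.2 hne)
  -- This `ε` makes the error at most `C / (2 * (C + 1))` times the defect itself, which is absurd
  -- for a positive defect.
  have h1 := key _ (div_pos hpos (by linarith : 0 < 2 * (C + 1)))
  rw [mul_div_assoc', le_div_iff₀ (by linarith)] at h1
  nlinarith

/-! ### Expansion in an orthonormal basis -/

section Basis

variable {V : Type*} [NormedAddCommGroup V] [InnerProductSpace ℝ V] {ι : Type*}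

/-- Basis vectors are `√2` apart, so balls of radius `1/2` around them are disjoint. Countability
makes the filter of finite index sets countably generated, which dominated convergence for series
needs. -/
lemma countable_of_hilbertBasis [TopologicalSpace.SeparableSpace V] (e : HilbertBasis ι ℝ V) :
    Countable ι := by
  have hd : ∀ i j, i ≠ j → dist (e i) (e j) = √2 := by
    intro i j hij
    rw [dist_eq_norm, ← Real.sqrt_sq (norm_nonneg (e i - e j)), norm_sub_sq_real,
      e.orthonormal.1, e.orthonormal.1, e.orthonormal.2 hij]
    norm_num
  refine Pairwise.countable_of_isOpen_disjoint (s := fun i => Metric.ball (e i) (1 / 2)) ?_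
    (fun i => Metric.isOpen_ball) fun i => ⟨e i, Metric.mem_ball_self (by norm_num)⟩
  intro i j hij
  refine Metric.ball_disjoint_ball ?_
  rw [hd i j hij]
  exact Real.le_sqrt_of_sq_le (by norm_num)

lemma abs_sum_inner_mul_inner_le (e : HilbertBasis ι ℝ V) (J : Finset ι) (x y : V) :
    |∑ i ∈ J, inner ℝ (e i) x * inner ℝ (e i) y| ≤ ‖x‖ * ‖y‖ := by
  have h1 := e.orthonormal.sum_inner_products_le x (s := J)
  have h2 := e.orthonormal.sum_inner_products_le y (s := J)
  simp only [Real.norm_eq_abs, sq_abs] at h1 h2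
  refine abs_le_of_sq_le_sq ?_ (by positivity)
  refine (Finset.sum_mul_sq_le_sq_mul_sq J _ _).trans ?_
  rw [mul_pow]
  exact mul_le_mul h1 h2 (Finset.sum_nonneg fun _ _ => sq_nonneg _) (sq_nonneg _)

variable [CompleteSpace V]

omit [CompleteSpace V] in
lemma SingularHolder.inner {β γ ρ A s t : ℝ} {h : ℝ → V} (hh : SingularHolder β γ ρ A s t h)
    (x : V) (hx : ‖x‖ ≤ 1) : SingularHolder β γ ρ A s t fun q => inner ℝ x (h q) := by
  have key : ∀ y : V, ‖(Inner.inner ℝ x y : ℝ)‖ ≤ ‖y‖ := fun y =>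
    (norm_inner_le_norm x y).trans (mul_le_of_le_one_left (norm_nonneg _) hx)
  have hc := hh.cont
  refine ⟨by fun_prop, fun r hr => (key _).trans (hh.norm_le r hr), fun r hr q hq => ?_⟩
  rw [← inner_sub_right]
  exact (key _).trans (hh.sub_le r hr q hq)

omit [CompleteSpace V] in
lemma HolderPath.inner {β' L s t : ℝ} {w : ℝ → V} (hw : HolderPath β' L s t w)
    (x : V) (hx : ‖x‖ ≤ 1) : HolderPath β' L s t fun q => inner ℝ x (w q) := by
  have hc := hw.cont
  refine ⟨by fun_prop, fun r q h1 h2 h3 => ?_⟩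
  rw [← inner_sub_right]
  exact ((norm_inner_le_norm x _).trans (mul_le_of_le_one_left (norm_nonneg _) hx)).trans
    (hw.sub_le r q h1 h2 h3)

omit [CompleteSpace V] in
lemma WeightedPath.inner {β A s : ℝ} {h : ℝ → V} (hh : WeightedPath β A s h)
    (x : V) (hx : ‖x‖ ≤ 1) : WeightedPath β A s fun q => inner ℝ x (h q) := by
  have key : ∀ y : V, ‖(Inner.inner ℝ x y : ℝ)‖ ≤ ‖y‖ := fun y =>
    (norm_inner_le_norm x y).trans (mul_le_of_le_one_left (norm_nonneg _) hx)
  have hc := hh.cont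
  refine ⟨by fun_prop, fun r => (key _).trans (hh.norm_le r), fun r q hq hr => ?_⟩
  rw [← inner_sub_right]
  exact (key _).trans (hh.sub_le r q hq hr)

/-- Parseval at each `r`, then dominated convergence: by Cauchy–Schwarz and Bessel every partial sum
is bounded by the product of the two norms, hence by the same majorant. -/
lemma hasSum_pairing [Countable ι] (e : HilbertBasis ι ℝ V) {α β β' γ ρ A L s t : ℝ} {h w : ℝ → V}
    (hx : Exponents α β β' γ ρ) (hst : s < t) (hA : 0 ≤ A)
    (hh : SingularHolder β γ ρ A s t h) (hw : HolderPath β' L s t w) :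
    HasSum (fun i => pairing α s t (fun q => inner ℝ (e i) (h q)) fun q => inner ℝ (e i) (w q))
      (pairing α s t h w) := by
  have hn : ∀ i, ‖e i‖ ≤ 1 := fun i => (e.orthonormal.1 i).le
  have hi := fun i => intervalIntegrable_pairing hx hst (hh.inner (e i) (hn i)) hA
    (hw.inner (e i) (hn i))
  have hpt : ∀ i, ∀ r ∈ Ioo s t,
      inner ℝ (leftD α s (fun q => inner ℝ (e i) (h q)) r)
        (rightD α t (fun q => inner ℝ (e i) (w q)) r) =
      inner ℝ (e i) (leftD α s h r) * inner ℝ (e i) (rightD α t w r) := fun i r hr => by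
    rw [inner_leftD (e i) hx hh hr, inner_rightD (e i) hx.β'_lt hx.β'_gt hw hr,
      RCLike.inner_apply, conj_trivial, mul_comm]
  unfold HasSum
  simp only [SummationFilter.unconditional_filter, pairing]
  simp only [← intervalIntegral.integral_finsetSum fun i _ => hi i]
  refine intervalIntegral.tendsto_integral_filter_of_dominated_convergence
    (fun r => A * L * pairMaj α β β' γ ρ s t r) ?_ ?_
    ((hx.intervalIntegrable_pairMaj hst).const_mul _) ?_
  · refine Eventually.of_forall fun J => ?_
    rw [uIoc_of_le hst.le]
    simpa only [Finset.sum_fn] using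
      (IntervalIntegrable.sum J fun i _ => hi i).1.aestronglyMeasurable
  · refine Eventually.of_forall fun J => ?_
    rw [uIoc_of_le hst.le]
    filter_upwards [ae_Ioc_mem_Ioo s t] with r hr hr'
    rw [Finset.sum_congr rfl fun i _ => hpt i r (hr hr')]
    exact (abs_sum_inner_mul_inner_le e J _ _).trans (norm_leftD_mul_rightD_le hx hh hA hw (hr hr'))
  · rw [uIoc_of_le hst.le]
    filter_upwards [ae_Ioc_mem_Ioo s t] with r hr hr'
    have := e.hasSum_inner_mul_inner (leftD α s h r) (rightD α t w r)
    refine Tendsto.congr (fun J => ?_) this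
    refine Finset.sum_congr rfl fun i _ => ?_
    rw [hpt i r (hr hr'), real_inner_comm]

lemma pairing_add_adjacent [Countable ι] (e : HilbertBasis ι ℝ V) {α β β' γ A L s m t : ℝ}
    (hx : Exponents α β β' γ 0) (hsm : s ≤ m) (hmt : m ≤ t) {h w : ℝ → V}
    (hh : WeightedPath β A s h) (hw : HolderPath β' L s t w)
    (hwi : ∀ i, LittlePath β' L s t fun q => inner ℝ (e i) (w q)) :
    pairing α s t h w = pairing α s m h w + pairing α m t h w := by
  rcases eq_or_lt_of_le hsm with rfl | hsm
  · simp [pairing]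
  rcases eq_or_lt_of_le hmt with rfl | hmt
  · simp [pairing]
  have hA := hh.nonneg
  have S1 := hasSum_pairing e hx (hsm.trans hmt) hA (hh.singularHolder γ t) hw
  have S2 := hasSum_pairing e hx hsm hA (hh.singularHolder γ m) (hw.mono le_rfl hmt.le)
  have S3 := hasSum_pairing e hx hmt hA ((hh.mono hx.β_nonneg hsm.le).singularHolder γ t)
    (hw.mono hsm.le le_rfl)
  refine S1.unique ((S2.add S3).congr_fun fun i => ?_)
  exact pairing_add_adjacent_real hx hsm hmt
    (hh.inner (e i) (e.orthonormal.1 i).le) (hwi i)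

end Basis

/-! ### The semigroup -/

section Semigroup

variable {V : Type*} [NormedAddCommGroup V] [InnerProductSpace ℝ V] {ι : Type*}

/-- A semigroup which is diagonal in the basis `e`, with nonnegative decay rates `μ`. -/
structure IsDiagonalSemigroup (e : HilbertBasis ι ℝ V) (S : ℝ → V →L[ℝ] V) (μ : ι → ℝ) :
    Prop where
  c0 : IsC0Semigroup S
  rate_nonneg : ∀ i, 0 ≤ μ i
  apply_basis : ∀ i t, 0 ≤ t → S t (e i) = Real.exp (-(μ i * t)) • e i

/-- The generator supplies right derivatives only, and these suffice: `r ↦ exp (μ r) • S r x` is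
continuous with vanishing right derivative, hence constant. -/
lemma apply_eigenvector {A : V →ₗ.[ℝ] V} {S : ℝ → V →L[ℝ] V} (hS : IsC0Semigroup S)
    (hAS : IsGenerator A S) {x : V} {μ : ℝ} (hx : (x, -(μ • x)) ∈ A.graph) {t : ℝ} (ht : 0 ≤ t) :
    S t x = Real.exp (-(μ * t)) • x := by
  have hg := (hAS x (-(μ • x))).1 hx
  have hderiv : ∀ r, 0 ≤ r → HasDerivWithinAt (fun r => S r x) (-(μ • S r x)) (Ici r) r := by
    intro r hr
    rw [← hasDerivWithinAt_Ioi_iff_Ici, hasDerivWithinAt_iff_tendsto_slope' self_notMem_Ioi]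
    have h1 : Tendsto (fun h : ℝ => S r (h⁻¹ • (S h x - x))) (𝓝[>] 0) (𝓝 (S r (-(μ • x)))) :=
      ((S r).continuous.tendsto _).comp hg
    have h2 : Tendsto (fun q : ℝ => q - r) (𝓝[>] r) (𝓝[>] 0) := by
      refine tendsto_nhdsWithin_iff.2 ⟨?_, ?_⟩
      · have : Tendsto (fun q : ℝ => q - r) (𝓝 r) (𝓝 (r - r)) :=
          (continuous_id.sub continuous_const).tendsto r
        rw [sub_self] at this
        exact this.mono_left nhdsWithin_le_nhds
      · filter_upwards [self_mem_nhdsWithin] with q hq using mem_Ioi.2 (sub_pos.2 (mem_Ioi.1 hq))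
    rw [map_neg, map_smul] at h1
    refine (h1.comp h2).congr' ?_
    filter_upwards [self_mem_nhdsWithin] with q hq
    have hq' : 0 ≤ q - r := (sub_pos.2 (mem_Ioi.1 hq)).le
    have := hS.add r (q - r) hr hq'
    rw [add_sub_cancel] at this
    simp only [Function.comp_apply, map_smul, map_sub, slope_def_module, this,
      ContinuousLinearMap.comp_apply]
  have hconst := constant_of_has_deriv_right_zero (a := 0) (b := t)
    (f := fun r => Real.exp (μ * r) • S r x)
    (((by fun_prop : Continuous fun r : ℝ => Real.exp (μ * r)).continuousOn).smul
      ((hS.cont x).mono Icc_subset_Ici_self)) (fun r hr => by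
      have d1 : HasDerivWithinAt (fun r : ℝ => Real.exp (μ * r)) (Real.exp (μ * r) * μ)
          (Ici r) r := by
        have := ((hasDerivAt_id r).const_mul μ).exp
        simpa using this.hasDerivWithinAt
      refine (d1.smul (hderiv r hr.1)).congr_deriv ?_
      module) t ⟨ht, le_rfl⟩
  simp only [mul_zero, Real.exp_zero, one_smul, hS.zero, ContinuousLinearMap.id_apply] at hconst
  have h2 := congrArg (Real.exp (-(μ * t)) • ·) hconst
  simpa only [smul_smul, ← Real.exp_add, neg_add_cancel, Real.exp_zero, one_smul] using h2

lemma exists_isDiagonalSemigroup {A : V →ₗ.[ℝ] V} (hA : IsPosSymmCompactInv (-A))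
    {S : ℝ → V →L[ℝ] V} (hS : IsC0Semigroup S) (hAS : IsGenerator A S) (e : HilbertBasis ι ℝ V)
    (he : ∀ i, ∃ μ : ℝ, (e i, μ • e i) ∈ (-A).graph) : ∃ μ, IsDiagonalSemigroup e S μ := by
  choose μ hμ using he
  refine ⟨μ, hS, fun i => ?_, fun i t ht => apply_eigenvector hS hAS ?_ ht⟩
  · obtain ⟨y, hy, hy'⟩ := (LinearPMap.mem_graph_iff _).1 (hμ i)
    simp only at hy hy'
    have hne : e i ≠ 0 := by
      intro h
      have := e.orthonormal.1 i
      simp [h] at this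
    have := hA.pos y (by rw [hy]; exact hne)
    rw [hy', hy, real_inner_smul_left, real_inner_self_eq_norm_sq, e.orthonormal.1 i] at this
    linarith
  · obtain ⟨y, hy, hy'⟩ := (LinearPMap.mem_graph_iff _).1 (hμ i)
    refine (LinearPMap.mem_graph_iff _).2 ⟨y, hy, ?_⟩
    simp only at hy'
    rw [← hy', LinearPMap.neg_apply, neg_neg]

lemma one_sub_exp_neg_le_rpow {γ b : ℝ} (hγ : 0 ≤ γ) (hγ1 : γ ≤ 1) (hb : 0 ≤ b) :
    1 - Real.exp (-b) ≤ b ^ γ := by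
  rcases le_total b 1 with h | h
  · have : b ≤ b ^ γ := by
      rcases eq_or_lt_of_le hb with h0 | h0
      · rw [← h0]; exact Real.rpow_nonneg le_rfl _
      · simpa using Real.rpow_le_rpow_of_exponent_ge h0 h hγ1
    linarith [Real.add_one_le_exp (-b)]
  · have := Real.one_le_rpow h hγ
    linarith [Real.exp_pos (-b)]

namespace IsDiagonalSemigroup

variable {e : HilbertBasis ι ℝ V} {S : ℝ → V →L[ℝ] V} {μ : ι → ℝ}
  (hS : IsDiagonalSemigroup e S μ)
include hS

lemma inner_basis (i : ι) {t : ℝ} (ht : 0 ≤ t) (x : V) :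
    inner ℝ (e i) (S t x) = Real.exp (-(μ i * t)) * inner ℝ (e i) x := by
  have h1 := ((innerSL ℝ (e i)).comp (S t)).hasSum (e.hasSum_repr x)
  have h2 := ((Real.exp (-(μ i * t))) • innerSL ℝ (e i)).hasSum (e.hasSum_repr x)
  simp only [_root_.smul_apply, ContinuousLinearMap.comp_apply,
    innerSL_apply_apply, smul_eq_mul] at h1 h2
  refine h1.unique (h2.congr_fun fun k => ?_)
  rw [map_smul, hS.apply_basis k t ht, inner_smul_right, inner_smul_right, inner_smul_right]
  rcases eq_or_ne i k with rfl | hik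
  · ring
  · rw [e.orthonormal.2 hik]; ring

omit hS in
lemma norm_le_of_inner {x y : V} {c : ℝ} (hc : 0 ≤ c)
    (h : ∀ i, |inner ℝ (e i) y| ≤ c * |inner ℝ (e i) x|) : ‖y‖ ≤ c * ‖x‖ := by
  have p : ∀ z : V, HasSum (fun i => inner ℝ (e i) z ^ 2) (‖z‖ ^ 2) := fun z => by
    rw [← real_inner_self_eq_norm_sq]
    refine (e.hasSum_inner_mul_inner z z).congr_fun fun i => ?_
    rw [sq, real_inner_comm]
  refine abs_le_of_sq_le_sq' ?_ (by positivity) |>.2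
  rw [mul_pow]
  refine hasSum_le (fun i => ?_) (p y) ((p x).mul_left (c ^ 2))
  rw [← sq_abs, ← sq_abs (inner ℝ (e i) x), ← mul_pow]
  exact pow_le_pow_left₀ (abs_nonneg _) (h i) 2

lemma exp_le_one (i : ι) {t : ℝ} (ht : 0 ≤ t) : Real.exp (-(μ i * t)) ≤ 1 :=
  Real.exp_le_one_iff.2 (neg_nonpos.2 (mul_nonneg (hS.rate_nonneg i) ht))

lemma norm_apply_le {t : ℝ} (ht : 0 ≤ t) (x : V) : ‖S t x‖ ≤ ‖x‖ := by
  refine (norm_le_of_inner (e := e) zero_le_one fun i => ?_).trans (one_mul _).le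
  rw [hS.inner_basis i ht, abs_mul, abs_of_pos (Real.exp_pos _)]
  exact mul_le_mul_of_nonneg_right (hS.exp_le_one i ht) (abs_nonneg _)

lemma inner_apply_left {t : ℝ} (ht : 0 ≤ t) (x y : V) :
    inner ℝ (S t x) y = inner ℝ x (S t y) := by
  refine (e.hasSum_inner_mul_inner (S t x) y).unique
    ((e.hasSum_inner_mul_inner x (S t y)).congr_fun fun i => ?_)
  rw [real_inner_comm, hS.inner_basis i ht, hS.inner_basis i ht, real_inner_comm (e i) x]
  ring

lemma apply_add {s t : ℝ} (hs : 0 ≤ s) (ht : 0 ≤ t) (x : V) : S (s + t) x = S s (S t x) := by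
  rw [hS.c0.add s t hs ht]; rfl

lemma apply_zero (x : V) : S 0 x = x := by rw [hS.c0.zero]; rfl

/-- The smoothing estimate for increments of the semigroup. -/
lemma norm_apply_sub_le {γ : ℝ} (hγ : 0 ≤ γ) (hγ1 : γ ≤ 1) {τ τ' : ℝ} (hτ : 0 < τ)
    (hττ' : τ ≤ τ') (x : V) : ‖S τ' x - S τ x‖ ≤ (τ' - τ) ^ γ * τ ^ (-γ) * ‖x‖ := by
  have hd : 0 ≤ τ' - τ := sub_nonneg.2 hττ'
  refine norm_le_of_inner (e := e) (by positivity) fun i => ?_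
  rw [inner_sub_right, hS.inner_basis i (hτ.le.trans hττ'), hS.inner_basis i hτ.le, ← sub_mul,
    abs_mul]
  refine mul_le_mul_of_nonneg_right ?_ (abs_nonneg _)
  have hm := hS.rate_nonneg i
  set a := μ i * τ
  set b := μ i * (τ' - τ)
  have ha : 0 ≤ a := mul_nonneg hm hτ.le
  have hb : 0 ≤ b := mul_nonneg hm hd
  have e1 : μ i * τ' = a + b := by simp only [a, b]; ring
  have hrp : ∀ z : ℝ, 0 ≤ z → z ^ γ ≤ max 1 z := fun z hz => by
    rcases le_total z 1 with h | h
    · exact (Real.rpow_le_one hz h hγ).trans (le_max_left _ _)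
    · refine (Real.rpow_le_rpow_of_exponent_le h hγ1).trans ?_
      rw [Real.rpow_one]; exact le_max_right _ _
  have h1 : 1 - Real.exp (-b) ≤ b ^ γ := one_sub_exp_neg_le_rpow hγ hγ1 hb
  have h2 : Real.exp (-a) * a ^ γ ≤ 1 := by
    have h3 : a ^ γ ≤ Real.exp a :=
      (hrp a ha).trans (max_le (Real.one_le_exp ha) (by linarith [Real.add_one_le_exp a]))
    calc Real.exp (-a) * a ^ γ ≤ Real.exp (-a) * Real.exp a := by gcongr
      _ = 1 := by rw [← Real.exp_add]; simp
  -- The factor `a ^ γ` carries the unbounded rate `μ i`; it is absorbed by `exp (-a)` through `h2`.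
  have e2 : b ^ γ = a ^ γ * ((τ' - τ) ^ γ * τ ^ (-γ)) := by
    rw [Real.rpow_neg hτ.le, Real.mul_rpow hm hd, Real.mul_rpow hm hτ.le]
    have : τ ^ γ ≠ 0 := (Real.rpow_pos_of_pos hτ γ).ne'
    field_simp
  have hge : Real.exp (-(a + b)) ≤ Real.exp (-a) := Real.exp_le_exp.2 (by linarith)
  rw [e1, abs_of_nonpos (by linarith), neg_add, Real.exp_add]
  have hk : 0 ≤ (τ' - τ) ^ γ * τ ^ (-γ) := by positivity
  calc -(Real.exp (-a) * Real.exp (-b) - Real.exp (-a))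
      = Real.exp (-a) * (1 - Real.exp (-b)) := by ring
    _ ≤ Real.exp (-a) * b ^ γ := by gcongr
    _ = (Real.exp (-a) * a ^ γ) * ((τ' - τ) ^ γ * τ ^ (-γ)) := by rw [e2]; ring
    _ ≤ 1 * ((τ' - τ) ^ γ * τ ^ (-γ)) := by gcongr
    _ = _ := one_mul _

/-- Joint smoothing estimate for second differences of the semigroup. -/
lemma norm_apply_sub_sub_le {β γ : ℝ} (hβ : 0 ≤ β) (hβ1 : β ≤ 1) (hγ : 0 ≤ γ) (hγ1 : γ ≤ 1)
    {τ τ' δ : ℝ} (hτ : 0 < τ) (hττ' : τ ≤ τ') (hδ : 0 ≤ δ) (x : V) :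
    ‖S τ' (S δ x - x) - S τ (S δ x - x)‖ ≤
      2 ^ (β + γ) * δ ^ β * ‖x‖ * ((τ' - τ) ^ γ * τ ^ (-(β + γ))) := by
  have h2 : 0 < τ / 2 := by linarith
  have hττ : 0 ≤ τ' - τ := by linarith
  -- Half of the time `τ` is spent on smoothing each of the two differences, whence the factor `2 ^
  -- (β + γ)`.
  set z := S (τ' - τ + τ / 2) x - S (τ / 2) x
  have e : S τ' (S δ x - x) - S τ (S δ x - x) = S (τ / 2 + δ) z - S (τ / 2) z := by
    simp only [z, map_sub]
    rw [← hS.apply_add (by linarith) hδ, ← hS.apply_add (by linarith) hδ,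
      ← hS.apply_add (by linarith) (by linarith), ← hS.apply_add (by linarith) (by linarith),
      ← hS.apply_add (by linarith) (by linarith), ← hS.apply_add (by linarith) (by linarith)]
    have e1 : τ / 2 + δ + (τ' - τ + τ / 2) = τ' + δ := by ring
    have e2 : τ / 2 + δ + τ / 2 = τ + δ := by ring
    have e3 : τ / 2 + (τ' - τ + τ / 2) = τ' := by ring
    have e4 : τ / 2 + τ / 2 = τ := by ring
    rw [e1, e2, e3, e4]
    abel
  have b1 := hS.norm_apply_sub_le hβ hβ1 h2 (by linarith : τ / 2 ≤ τ / 2 + δ) z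
  have b2 := hS.norm_apply_sub_le hγ hγ1 h2 (by linarith : τ / 2 ≤ τ' - τ + τ / 2) x
  rw [add_sub_cancel_left] at b1
  rw [add_sub_cancel_right] at b2
  rw [e]
  refine b1.trans ((mul_le_mul_of_nonneg_left b2 (by positivity)).trans (le_of_eq ?_))
  have h3 : (τ / 2) ^ (-β) * (τ / 2) ^ (-γ) = 2 ^ (β + γ) * τ ^ (-(β + γ)) := by
    rw [← Real.rpow_add h2, show -β + -γ = -(β + γ) by ring, Real.div_rpow hτ.le zero_le_two,
      Real.rpow_neg zero_le_two, div_inv_eq_mul, mul_comm]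
  calc δ ^ β * (τ / 2) ^ (-β) * ((τ' - τ) ^ γ * (τ / 2) ^ (-γ) * ‖x‖)
      = δ ^ β * ‖x‖ * (τ' - τ) ^ γ * ((τ / 2) ^ (-β) * (τ / 2) ^ (-γ)) := by ring
    _ = _ := by rw [h3]; ring

/-- Joint strong continuity, with the time variable truncated at zero. -/
lemma continuous_apply {X : Type*} [TopologicalSpace X] {τ : X → ℝ} {x : X → V}
    (hτ : Continuous τ) (hx : Continuous x) : Continuous fun p => S (max (τ p) 0) (x p) := by
  rw [continuous_iff_continuousAt]
  intro p
  have h1 : Tendsto (fun q => S (max (τ q) 0) (x p)) (𝓝 p) (𝓝 (S (max (τ p) 0) (x p))) := by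
    have hc : Tendsto (fun q => max (τ q) 0) (𝓝 p) (𝓝[Ici 0] (max (τ p) 0)) :=
      tendsto_nhdsWithin_iff.2 ⟨(hτ.max continuous_const).tendsto p,
        Eventually.of_forall fun q => mem_Ici.2 (le_max_right _ _)⟩
    exact (hS.c0.cont (x p) _ (mem_Ici.2 (le_max_right _ _))).tendsto.comp hc
  -- Contractivity makes the convergence in the vector uniform in time.
  have h2 : Tendsto (fun q => S (max (τ q) 0) (x q - x p)) (𝓝 p) (𝓝 0) := by
    refine squeeze_zero_norm (fun q => hS.norm_apply_le (le_max_right _ _) _) ?_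
    have : Tendsto (fun q => ‖x q - x p‖) (𝓝 p) (𝓝 ‖x p - x p‖) :=
      ((hx.sub continuous_const).norm).tendsto p
    simpa using this
  have h3 := h1.add h2
  rw [add_zero] at h3
  exact h3.congr fun q => by rw [map_sub]; abel

end IsDiagonalSemigroup

/-! ### Hilbert-Schmidt norm and operator norm -/

/-- Cauchy–Schwarz on the expansion of `x`, with Bessel for its coefficients. The operator norm is
all that the later estimates of `G` require. -/
lemma norm_apply_le_hsNorm (e : HilbertBasis ι ℝ V) (T : V →L[ℝ] V) {c : ℝ≥0}
    (hT : hsNorm e T ≤ c) : ‖T‖ ≤ c := by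
  have hsum : ∀ J : Finset ι, ∑ i ∈ J, ‖T (e i)‖ ^ 2 ≤ (c : ℝ) ^ 2 := by
    intro J
    have h1 : (∑ i ∈ J, ‖T (e i)‖ₑ ^ 2) ≤ (c : ℝ≥0∞) ^ 2 := by
      refine (ENNReal.sum_le_tsum J).trans ?_
      have h2 := ENNReal.rpow_le_rpow hT (by norm_num : (0 : ℝ) ≤ 2)
      rw [hsNorm, ← ENNReal.rpow_mul] at h2
      norm_num at h2
      exact h2
    have h3 : ((∑ i ∈ J, ‖T (e i)‖₊ ^ 2 : ℝ≥0) : ℝ≥0∞) ≤ ((c ^ 2 : ℝ≥0) : ℝ≥0∞) := by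
      push_cast
      exact h1
    have h4 := ENNReal.coe_le_coe.1 h3
    have h5 := NNReal.coe_le_coe.2 h4
    push_cast at h5
    exact h5
  refine T.opNorm_le_bound c.2 fun x => ?_
  have hx := T.hasSum (e.hasSum_repr x)
  refine le_of_tendsto hx.norm (Eventually.of_forall fun J => ?_)
  refine (norm_sum_le _ _).trans ?_
  have h5 : ∀ i, ‖T (e.repr x i • e i)‖ = |inner ℝ (e i) x| * ‖T (e i)‖ := fun i => by
    rw [map_smul, norm_smul, e.repr_apply_apply, Real.norm_eq_abs]
  simp only [h5]
  refine abs_le_of_sq_le_sq' ?_ (by positivity) |>.2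
  refine (Finset.sum_mul_sq_le_sq_mul_sq J _ _).trans ?_
  rw [mul_pow, mul_comm ((c : ℝ) ^ 2)]
  have h6 := e.orthonormal.sum_inner_products_le x (s := J)
  simp only [Real.norm_eq_abs] at h6
  exact mul_le_mul h6 (hsum J) (Finset.sum_nonneg fun _ _ => sq_nonneg _) (sq_nonneg _)

lemma norm_sub_le_of_hsNorm_lipschitz (e : HilbertBasis ι ℝ V) {G : V → V →L[ℝ] V} {LG : ℝ≥0}
    (hG : ∀ u v : V, hsNorm e (G u - G v) ≤ LG * ‖u - v‖ₑ) (u v : V) :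
    ‖G u - G v‖ ≤ LG * ‖u - v‖ := by
  have := norm_apply_le_hsNorm e (G u - G v) (c := LG * ‖u - v‖₊) (by
    push_cast; exact hG u v)
  simpa using this

end Semigroup

/-! ### Paths -/

section Paths

lemma holder_of_seminorm {E : Type*} [NormedAddCommGroup E] {γ a b : ℝ} {f : ℝ → E}
    {L : ℝ} (hL : 0 ≤ L) (hf : holderSeminorm γ f a b ≤ ENNReal.ofReal L) {r q : ℝ} (hr : a ≤ r)
    (hrq : r < q) (hq : q ≤ b) : ‖f r - f q‖ ≤ L * (q - r) ^ γ := by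
  have h0 : 0 < (q - r) ^ γ := Real.rpow_pos_of_pos (sub_pos.2 hrq) _
  have h1 : ‖f q - f r‖ₑ / ENNReal.ofReal ((q - r) ^ γ) ≤ ENNReal.ofReal L := by
    refine le_trans ?_ hf
    unfold holderSeminorm
    exact le_iSup_of_le r (le_iSup_of_le q (le_iSup_of_le ⟨hr, hrq, hq⟩ le_rfl))
  rw [ENNReal.div_le_iff (by simpa using h0) (by simp), ← ENNReal.ofReal_mul hL,
    ← ofReal_norm, ENNReal.ofReal_le_ofReal_iff (by positivity), norm_sub_rev] at h1
  exact h1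

variable {V : Type*} [NormedAddCommGroup V] [InnerProductSpace ℝ V] {β' : ℝ}

lemma PathSpace.exists_holderPath (ω : PathSpace V β') (T : ℝ) :
    ∃ L, 0 ≤ L ∧ HolderPath β' L (-T) T ω.1 := by
  obtain ⟨ω, hc, h0, hω⟩ := ω
  obtain ⟨N, hN⟩ := exists_nat_ge T
  have hfin : holderSeminorm β' ω (-N) N < ∞ := lt_of_le_of_lt le_add_self (hω N).1
  refine ⟨(holderSeminorm β' ω (-N) N).toReal, ENNReal.toReal_nonneg, hc,
    fun r q hr hrq hq => ?_⟩
  refine holder_of_seminorm (a := -N) (b := N) ENNReal.toReal_nonneg ?_ (by linarith) hrq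
    (by linarith)
  rw [ENNReal.ofReal_toReal hfin.ne]

lemma PathSpace.littlePath (ω : PathSpace V β') {L s t : ℝ} (hst : s < t) (x : V) (hx : ‖x‖ ≤ 1)
    (hω : HolderPath β' L s t ω.1) : LittlePath β' L s t fun q => inner ℝ x (ω.1 q) := by
  refine ⟨hω.inner x hx, fun ε hε => ?_⟩
  obtain ⟨N, hN⟩ := exists_nat_ge (|s| + |t|)
  have hs : -(N : ℝ) ≤ s := by linarith [neg_abs_le s, abs_nonneg t]
  have ht : t ≤ N := by linarith [le_abs_self t, abs_nonneg s]
  obtain ⟨p, hp, hpε⟩ := (ω.2.2.2 N).2 (ENNReal.ofReal ε) (by simpa using hε)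
  have hsub : Icc s t ⊆ Icc (-(N : ℝ)) N := Icc_subset_Icc hs ht
  have hpi : ContDiffOn ℝ 1 (fun q => inner ℝ x (p q) : ℝ → ℝ) (Icc s t) :=
    contDiffOn_const.inner ℝ ((hp.mono hsub).of_le (by exact_mod_cast le_top))
  have hd : ContinuousOn (derivWithin (fun q => inner ℝ x (p q) : ℝ → ℝ) (Icc s t)) (Icc s t) :=
    hpi.continuousOn_derivWithin (uniqueDiffOn_Icc hst) le_rfl
  -- The approximant is controlled on the interval only. Extending it and its derivative by
  -- constants gives global continuity; the derivative relation is needed in the interior alone.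
  refine ⟨IccExtend hst.le (domRestrict (Icc s t) fun q => inner ℝ x (p q)),
    IccExtend hst.le (domRestrict (Icc s t) (derivWithin (fun q => inner ℝ x (p q)) (Icc s t))),
    ⟨?_, ?_, ?_⟩, ⟨?_, ?_⟩⟩
  · exact (continuousOn_iff_continuous_domRestrict.1 hpi.continuousOn).Icc_extend'
  · exact (continuousOn_iff_continuous_domRestrict.1 hd).Icc_extend'
  · intro y hy
    have hmem := Ioo_subset_Icc_self hy
    rw [IccExtend_of_mem hst.le _ hmem, domRestrict_apply]
    have h1 := ((hpi.differentiableOn one_ne_zero) y hmem).hasDerivWithinAt.hasDerivAt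
      (Icc_mem_nhds hy.1 hy.2)
    refine h1.congr_of_eventuallyEq ?_
    filter_upwards [Icc_mem_nhds hy.1 hy.2] with z hz
    rw [IccExtend_of_mem hst.le _ hz, domRestrict_apply]
  · have hc := ω.2.1
    exact (continuous_const.inner hc).sub
      (continuousOn_iff_continuous_domRestrict.1 hpi.continuousOn).Icc_extend'
  · intro r q hr hrq hq
    rw [IccExtend_of_mem hst.le _ ⟨hr, hrq.le.trans hq⟩, IccExtend_of_mem hst.le _
      ⟨hr.trans hrq.le, hq⟩, domRestrict_apply, domRestrict_apply, ← inner_sub_right, ← inner_sub_right,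
      ← inner_sub_right]
    refine ((norm_inner_le_norm x _).trans (mul_le_of_le_one_left (norm_nonneg _) hx)).trans ?_
    exact holder_of_seminorm (f := fun r => ω.1 r - p r) hε.le
      ((le_add_self).trans hpε.le) (hs.trans hr) hrq (hq.trans ht)

end Paths

/-! ### The stochastic convolution -/

section Convolution

variable {V : Type*} [NormedAddCommGroup V] [InnerProductSpace ℝ V] [CompleteSpace V] {ι : Type*}

/-- The test function `r ↦ (B r)* S(t - r) y` paired with the driving path. -/
def testFun (S : ℝ → V →L[ℝ] V) (B : ℝ → V →L[ℝ] V) (t : ℝ) (y : V) (r : ℝ) : V :=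
  ContinuousLinearMap.adjoint (B r) (S (max (t - r) 0) y)

/-- The factor in front of the pairing in the pathwise integral. -/
def pairFactor (α : ℝ) : ℝ := -(1 / Real.Gamma (1 - α) * (1 / Real.Gamma α))

variable {e : HilbertBasis ι ℝ V} {S : ℝ → V →L[ℝ] V} {μ : ι → ℝ}
  {α β β' γ ρ M L t : ℝ} {B : ℝ → V →L[ℝ] V} {w : ℝ → V}

lemma continuous_testFun (hS : IsDiagonalSemigroup e S μ) (hB : Continuous B) (t : ℝ) (y : V) :
    Continuous (testFun S B t y) :=
  (((ContinuousLinearMap.adjoint : (V →L[ℝ] V) ≃ₗᵢ⋆[ℝ] (V →L[ℝ] V)).continuous.comp hB)).clm_apply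
    (hS.continuous_apply (by fun_prop) continuous_const)

lemma norm_adjoint_apply_le (T : V →L[ℝ] V) {c : ℝ} (hT : ‖T‖ ≤ c) (x : V) :
    ‖ContinuousLinearMap.adjoint T x‖ ≤ c * ‖x‖ := by
  refine (ContinuousLinearMap.le_opNorm _ _).trans ?_
  rw [LinearIsometryEquiv.norm_map]
  exact mul_le_mul_of_nonneg_right hT (norm_nonneg _)

lemma norm_testFun_sub_le (hB : WeightedPath β M 0 B) (y : V) {q r : ℝ}
    (hq : 0 < q) (hqr : q < r) :
    ‖testFun S B t y r - testFun S B t y q‖ ≤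
      M * ‖S (max (t - r) 0) y - S (max (t - q) 0) y‖ +
        M * (q ^ (-β) * (r - q) ^ β) * ‖S (max (t - q) 0) y‖ := by
  have e1 : testFun S B t y r - testFun S B t y q =
      ContinuousLinearMap.adjoint (B r) (S (max (t - r) 0) y - S (max (t - q) 0) y) +
        ContinuousLinearMap.adjoint (B r - B q) (S (max (t - q) 0) y) := by
    simp only [testFun, map_sub, _root_.sub_apply]
    abel
  rw [e1]
  refine (norm_add_le _ _).trans (add_le_add (norm_adjoint_apply_le _ (hB.norm_le r) _)
    (norm_adjoint_apply_le _ ?_ _))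
  simpa using hB.sub_le r q hq hqr

/-- The two singularities separate: that at `0` comes from the weighted regularity of `B`, that at
`t` from the orbit of `y`. Here `ρ = 0` serves the size of the integral and `ρ = β` its increments
under the semigroup. -/
lemma singularHolder_testFun (hS : IsDiagonalSemigroup e S μ) (hB : WeightedPath β M 0 B)
    (hρ : 0 ≤ ρ) {Y : ℝ} {y : V} (hY : ∀ τ, 0 < τ → ‖S τ y‖ ≤ Y * τ ^ (-ρ))
    (hYs : ∀ τ τ', 0 < τ → τ ≤ τ' →
      ‖S τ' y - S τ y‖ ≤ Y * ((τ' - τ) ^ γ * τ ^ (-(ρ + γ)))) :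
    SingularHolder β γ ρ (M * Y) 0 t (testFun S B t y) := by
  have hM := hB.nonneg
  have hY0 : 0 ≤ Y := by simpa using (norm_nonneg _).trans (hY 1 one_pos)
  refine ⟨continuous_testFun hS hB.cont t y, fun r hr => ?_, fun r hr q hq => ?_⟩
  · have h0 : 0 < t - r := sub_pos.2 hr.2
    rw [testFun, max_eq_left h0.le, mul_assoc]
    exact (norm_adjoint_apply_le _ (hB.norm_le r) _).trans
      (mul_le_mul_of_nonneg_left (hY _ h0) hM)
  · have h0 : 0 < t - r := sub_pos.2 hr.2
    have h1 : t - r ≤ t - q := by linarith [hq.2]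
    have h2 : 0 < t - q := h0.trans_le h1
    refine (norm_testFun_sub_le hB y hq.1 hq.2).trans ?_
    rw [max_eq_left h0.le, max_eq_left h2.le, norm_sub_rev, sub_zero]
    have b1 := hYs (t - r) (t - q) h0 h1
    rw [show t - q - (t - r) = r - q by ring] at b1
    have b2 : ‖S (t - q) y‖ ≤ Y * (t - r) ^ (-ρ) := (hY _ h2).trans
      (mul_le_mul_of_nonneg_left (Real.rpow_le_rpow_of_nonpos h0 h1 (neg_nonpos.2 hρ)) hY0)
    have b3 : 0 ≤ q ^ (-β) := Real.rpow_nonneg hq.1.le _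
    have b4 : 0 ≤ (r - q) ^ β := Real.rpow_nonneg (by linarith [hq.2]) _
    calc _ ≤ M * (Y * ((r - q) ^ γ * (t - r) ^ (-(ρ + γ)))) +
          M * (q ^ (-β) * (r - q) ^ β) * (Y * (t - r) ^ (-ρ)) := by gcongr
      _ = _ := by ring

lemma singularHolder_testFun_zero (hS : IsDiagonalSemigroup e S μ) (hB : WeightedPath β M 0 B)
    (hγ : 0 ≤ γ) (hγ1 : γ ≤ 1) (y : V) :
    SingularHolder β γ 0 (M * ‖y‖) 0 t (testFun S B t y) := by
  refine singularHolder_testFun hS hB le_rfl (fun τ hτ => ?_) fun τ τ' hτ hττ' => ?_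
  · simpa using hS.norm_apply_le hτ.le y
  · rw [zero_add, mul_comm]
    exact hS.norm_apply_sub_le hγ hγ1 hτ hττ' y

lemma singularHolder_testFun_increment (hS : IsDiagonalSemigroup e S μ)
    (hB : WeightedPath β M 0 B) (hβ : 0 ≤ β) (hβ1 : β ≤ 1) (hγ : 0 ≤ γ) (hγ1 : γ ≤ 1) {δ : ℝ}
    (hδ : 0 ≤ δ) (y : V) :
    SingularHolder β γ β (M * (2 ^ (β + γ) * δ ^ β * ‖y‖)) 0 t (testFun S B t (S δ y - y)) := by
  refine singularHolder_testFun hS hB hβ (fun τ hτ => ?_) fun τ τ' hτ hττ' => ?_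
  · rw [map_sub, ← hS.apply_add hτ.le hδ]
    refine (hS.norm_apply_sub_le hβ hβ1 hτ (by linarith) y).trans ?_
    rw [add_sub_cancel_left]
    have h2 : (1 : ℝ) ≤ 2 ^ (β + γ) := Real.one_le_rpow one_le_two (by linarith)
    have h3 : 0 ≤ δ ^ β * τ ^ (-β) * ‖y‖ := by positivity
    calc _ ≤ 2 ^ (β + γ) * (δ ^ β * τ ^ (-β) * ‖y‖) := le_mul_of_one_le_left h3 h2
      _ = _ := by ring
  · exact hS.norm_apply_sub_sub_le hβ hβ1 hγ hγ1 hτ hττ' hδ y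

/-- The orbit of a basis vector is Hölder up to time zero, so the singularity at `t` is absent and
additivity over adjacent intervals applies. The constant depends on `j`, which is harmless for an
identity. -/
lemma weightedPath_testFun (hS : IsDiagonalSemigroup e S μ) (hB : WeightedPath β M 0 B)
    (hβ : 0 ≤ β) (hβ1 : β ≤ 1) (ht : 0 ≤ t) (j : ι) :
    ∃ A, WeightedPath β A 0 (testFun S B t (e j)) := by
  have hM := hB.nonneg
  have he := e.orthonormal.1 j
  have hle : ∀ τ, 0 ≤ τ → ‖S τ (e j)‖ ≤ 1 := fun τ hτ => (hS.norm_apply_le hτ _).trans he.le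
  have hsub : ∀ a b, 0 ≤ a → a ≤ b → ‖S a (e j) - S b (e j)‖ ≤ (μ j) ^ β * (b - a) ^ β := by
    intro a b ha hab
    have hm := hS.rate_nonneg j
    have hba : 0 ≤ b - a := sub_nonneg.2 hab
    rw [hS.apply_basis j a ha, hS.apply_basis j b (ha.trans hab), ← sub_smul, norm_smul, he,
      mul_one, ← Real.mul_rpow hm hba]
    have e1 : Real.exp (-(μ j * b)) =
        Real.exp (-(μ j * a)) * Real.exp (-(μ j * (b - a))) := by
      rw [← Real.exp_add]; congr 1; ring
    have h1 := hS.exp_le_one j ha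
    have h2 := hS.exp_le_one j hba
    have h3 := one_sub_exp_neg_le_rpow hβ hβ1 (mul_nonneg hm hba)
    rw [e1, ← mul_one_sub, Real.norm_of_nonneg (mul_nonneg (Real.exp_pos _).le (by linarith))]
    exact (mul_le_of_le_one_left (by linarith) h1).trans h3
  have hY : 0 ≤ (μ j) ^ β * t ^ β := by have := hS.rate_nonneg j; positivity
  refine ⟨M * ((μ j) ^ β * t ^ β + 1), continuous_testFun hS hB.cont t _, fun r => ?_,
    fun r q hq hqr => ?_⟩
  · refine (norm_adjoint_apply_le _ (hB.norm_le r) _).trans (mul_le_mul_of_nonneg_left ?_ hM)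
    exact (hle _ (le_max_right _ _)).trans (by linarith)
  · refine (norm_testFun_sub_le hB _ hq hqr).trans ?_
    have b3 : 0 < q ^ (-β) := Real.rpow_pos_of_pos hq _
    have b4 : 0 ≤ (r - q) ^ β := Real.rpow_nonneg (by linarith) _
    have b1 : ‖S (max (t - r) 0) (e j) - S (max (t - q) 0) (e j)‖ ≤
        (μ j) ^ β * t ^ β * (q ^ (-β) * (r - q) ^ β) := by
      rcases le_total t q with htq | htq
      · rw [max_eq_right (by linarith : t - r ≤ 0), max_eq_right (by linarith : t - q ≤ 0),
          sub_self, norm_zero]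
        positivity
      · have h1 : max (t - r) 0 ≤ max (t - q) 0 := max_le_max_right _ (by linarith)
        refine (hsub _ _ (le_max_right _ _) h1).trans ?_
        have h2 : max (t - q) 0 - max (t - r) 0 ≤ r - q := by
          rw [max_eq_left (by linarith : 0 ≤ t - q)]
          linarith [le_max_left (t - r) 0]
        have h3 := Real.rpow_le_rpow (sub_nonneg.2 h1) h2 hβ
        -- For `q ≤ t` an unweighted Hölder bound becomes a weighted one at the price of `t ^ β`.
        have h4 : 1 ≤ t ^ β * q ^ (-β) := by
          rw [Real.rpow_neg hq.le, ← div_eq_mul_inv, one_le_div (Real.rpow_pos_of_pos hq _)]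
          exact Real.rpow_le_rpow hq.le htq hβ
        have h5 : 0 ≤ (μ j) ^ β := Real.rpow_nonneg (hS.rate_nonneg j) _
        calc _ ≤ (μ j) ^ β * (r - q) ^ β := by gcongr
          _ ≤ ((μ j) ^ β * (r - q) ^ β) * (t ^ β * q ^ (-β)) :=
            le_mul_of_one_le_right (by positivity) h4
          _ = _ := by ring
    have b2 := hle _ (le_max_right (t - q) 0)
    rw [sub_zero]
    calc _ ≤ M * ((μ j) ^ β * t ^ β * (q ^ (-β) * (r - q) ^ β)) +
          M * (q ^ (-β) * (r - q) ^ β) * 1 := by gcongr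
      _ = _ := by ring

/-! ### The pathwise convolution in weak form: bounds and additivity. -/

omit [CompleteSpace V] in
lemma pathIntegral_self (e : HilbertBasis ι ℝ V) (α s : ℝ) (g : ℝ → V →L[ℝ] V) (w : ℝ → V) :
    pathIntegral e α s s g w = 0 := by
  simp [pathIntegral]

lemma inner_testFun (hS : IsDiagonalSemigroup e S μ) (x y : V) {q : ℝ} (hq : q ≤ t) :
    inner ℝ y (((S (t - q)).comp (B q)) x) = inner ℝ x (testFun S B t y q) := by
  have h0 : 0 ≤ t - q := sub_nonneg.2 hq
  rw [testFun, max_eq_left h0, ContinuousLinearMap.adjoint_inner_right,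
    ContinuousLinearMap.comp_apply, ← hS.inner_apply_left h0, real_inner_comm]

/-- The pathwise integral against the semigroup in weak form. -/
lemma inner_pathIntegral [Countable ι] (hS : IsDiagonalSemigroup e S μ)
    (hx : Exponents α β β' γ 0) (hγ1 : γ ≤ 1) (ht : 0 ≤ t) (hB : WeightedPath β M 0 B)
    (hw : HolderPath β' L 0 t w) (y : V) :
    inner ℝ y (pathIntegral e α 0 t (fun r => (S (t - r)).comp (B r)) w) =
      pairFactor α * pairing α 0 t (testFun S B t y) w := by
  rcases eq_or_lt_of_le ht with rfl | ht
  · simp [pathIntegral_self, pairing]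
  have hγ : 0 ≤ γ := (hx.α_pos.trans hx.α_lt_γ).le
  have hM := hB.nonneg
  have hsing := fun y => singularHolder_testFun_zero (t := t) hS hB hγ hγ1 y
  -- The pairing is a bounded linear functional of the test vector. Its Riesz representative `z` is,
  -- up to `pairFactor`, the integral: summing over `i` gives the coefficients of `z`, so the series
  -- over `j` is its basis expansion.
  let c : V →ₗ[ℝ] ℝ :=
    { toFun := fun y => pairing α 0 t (testFun S B t y) w
      map_add' := fun x y => by
        rw [← pairing_add_left hx ht (by positivity) (by positivity) (hsing x) (hsing y) hw]
        congr 1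
        funext q
        simp only [testFun, map_add]
      map_smul' := fun a y => by
        rw [RingHom.id_apply, smul_eq_mul, ← pairing_const_smul]
        congr 1
        funext q
        simp only [testFun, map_smul] }
  let C := c.mkContinuous (pairIntConst α β β' γ 0 * (M * L) * t ^ (β' - 0)) fun y => by
    refine (abs_pairing_le hx ht (hsing y) (by positivity) hw).trans (le_of_eq ?_)
    rw [sub_zero t]
    ring
  set z := (InnerProductSpace.toDual ℝ V).symm C with hz
  have hcz : ∀ y, pairing α 0 t (testFun S B t y) w = inner ℝ y z := fun y => by
    rw [real_inner_comm, hz, InnerProductSpace.toDual_symm_apply]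
    rfl
  have hterm : ∀ j i, (∫ r in (0 : ℝ)..t,
      leftFracDeriv α 0 (fun q => inner ℝ (e j) (((S (t - q)).comp (B q)) (e i))) r *
        rightFracDeriv α t (fun q => inner ℝ (e i) (w q)) r) =
      (1 / Real.Gamma (1 - α) * (1 / Real.Gamma α)) *
        pairing α 0 t (fun q => inner ℝ (e i) (testFun S B t (e j) q))
          fun q => inner ℝ (e i) (w q) := fun j i => by
    rw [pairing, ← intervalIntegral.integral_const_mul]
    refine integral_congr_Ioo ht.le fun r hr => ?_
    rw [leftFracDeriv_eq, rightFracDeriv_eq, leftD_congr hr.1.le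
      (k := fun q => inner ℝ (e i) (testFun S B t (e j) q))
      fun q hq => inner_testFun hS _ _ (hq.2.trans hr.2.le), RCLike.inner_apply, conj_trivial]
    ring
  have hpi : pathIntegral e α 0 t (fun r => (S (t - r)).comp (B r)) w = pairFactor α • z := by
    have hj : ∀ j, (∑' i, ∫ r in (0 : ℝ)..t,
        leftFracDeriv α 0 (fun q => inner ℝ (e j) (((S (t - q)).comp (B q)) (e i))) r *
          rightFracDeriv α t (fun q => inner ℝ (e i) (w q)) r) • e j =
        (1 / Real.Gamma (1 - α) * (1 / Real.Gamma α)) • (e.repr z j • e j) := fun j => by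
      simp only [hterm j]
      rw [((hasSum_pairing e hx ht (by positivity) (hsing (e j)) hw).mul_left _).tsum_eq, hcz,
        e.repr_apply_apply, mul_smul]
    rw [pathIntegral]
    simp only [hj]
    rw [((e.hasSum_repr z).const_smul _).tsum_eq, smul_smul, pairFactor]
    congr 1
    ring
  rw [hpi, hcz, inner_smul_right]

omit [CompleteSpace V] in
lemma norm_le_of_forall_inner {x : V} {c : ℝ} (hc : 0 ≤ c)
    (h : ∀ y, |inner ℝ y x| ≤ c * ‖y‖) : ‖x‖ ≤ c := by
  have h1 := h x
  rw [real_inner_self_eq_norm_sq, abs_of_nonneg (sq_nonneg _), sq] at h1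
  rcases eq_or_lt_of_le (norm_nonneg x) with h0 | h0
  · rw [← h0]; exact hc
  · exact le_of_mul_le_mul_right h1 h0

omit [CompleteSpace V] in
lemma eq_of_inner_basis (e : HilbertBasis ι ℝ V) {x y : V}
    (h : ∀ j, inner ℝ (e j) x = inner ℝ (e j) y) : x = y := by
  refine (e.hasSum_repr x).unique ((e.hasSum_repr y).congr_fun fun j => ?_)
  rw [e.repr_apply_apply, e.repr_apply_apply, h j]

lemma norm_pathIntegral_le [Countable ι] (hS : IsDiagonalSemigroup e S μ)
    (hx : Exponents α β β' γ 0) (hγ1 : γ ≤ 1) (ht : 0 < t) (hB : WeightedPath β M 0 B)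
    (hL : 0 ≤ L) (hw : HolderPath β' L 0 t w) :
    ‖pathIntegral e α 0 t (fun r => (S (t - r)).comp (B r)) w‖ ≤
      |pairFactor α| * pairIntConst α β β' γ 0 * (M * L) * t ^ β' := by
  have hM := hB.nonneg
  have hK := hx.pairIntConst_nonneg
  refine norm_le_of_forall_inner (by positivity) fun y => ?_
  rw [inner_pathIntegral hS hx hγ1 ht.le hB hw, abs_mul]
  have := abs_pairing_le hx ht (singularHolder_testFun_zero hS hB
    (hx.α_pos.trans hx.α_lt_γ).le hγ1 y) (by positivity) hw
  rw [sub_zero, sub_zero] at this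
  refine (mul_le_mul_of_nonneg_left this (abs_nonneg _)).trans (le_of_eq ?_)
  ring

/-- By symmetry `S δ - 1` moves onto the test vector. Its smallness `δ ^ β` is bought with an extra
singularity of order `β` at `t`, hence `ρ = β` and the power `t ^ (β' - β)`. -/
lemma norm_increment_pathIntegral_le [Countable ι] (hS : IsDiagonalSemigroup e S μ)
    (hx : Exponents α β β' γ 0) (hxβ : Exponents α β β' γ β) (hγ1 : γ ≤ 1) (ht : 0 < t)
    (hB : WeightedPath β M 0 B) (hL : 0 ≤ L) (hw : HolderPath β' L 0 t w) {δ : ℝ} (hδ : 0 ≤ δ) :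
    ‖S δ (pathIntegral e α 0 t (fun r => (S (t - r)).comp (B r)) w) -
        pathIntegral e α 0 t (fun r => (S (t - r)).comp (B r)) w‖ ≤
      |pairFactor α| * pairIntConst α β β' γ β * (M * L) * 2 ^ (β + γ) * t ^ (β' - β) * δ ^ β := by
  have hM := hB.nonneg
  have hK := hxβ.pairIntConst_nonneg
  refine norm_le_of_forall_inner (by positivity) fun y => ?_
  rw [inner_sub_right, ← hS.inner_apply_left hδ, ← inner_sub_left,
    inner_pathIntegral hS hx hγ1 ht.le hB hw, abs_mul]
  have := abs_pairing_le hxβ ht (singularHolder_testFun_increment hS hB hx.β_nonneg hx.β_lt.le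
    (hx.α_pos.trans hx.α_lt_γ).le hγ1 hδ y) (by positivity) hw
  rw [sub_zero] at this
  refine (mul_le_mul_of_nonneg_left this (abs_nonneg _)).trans (le_of_eq ?_)
  ring

omit [CompleteSpace V] in
lemma WeightedPath.comp_add {E : Type*} [NormedAddCommGroup E] {A : ℝ} {h : ℝ → E}
    (hh : WeightedPath β A 0 h) (hβ : 0 ≤ β) {s : ℝ} (hs : 0 ≤ s) :
    WeightedPath β A 0 fun r => h (s + r) := by
  have hc := hh.cont
  refine ⟨by fun_prop, fun r => hh.norm_le _, fun r q hq hr => ?_⟩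
  have := (hh.mono hβ hs).sub_le (s + r) (s + q) (by linarith) (by linarith)
  rwa [show s + q - s = q - 0 by ring, show s + r - (s + q) = r - q by ring] at this

lemma HolderPath.wienerShift {E : Type*} [NormedAddCommGroup E] {s t : ℝ} {w : ℝ → E}
    (hs : 0 ≤ s) (hw : HolderPath β' L 0 (s + t) w) :
    HolderPath β' L 0 t (wienerShift s w) := by
  have hc := hw.cont
  refine ⟨by unfold RoughEvolution.wienerShift; fun_prop, fun r q h1 h2 h3 => ?_⟩
  have := hw.sub_le (s + r) (s + q) (by linarith) (by linarith) (by linarith)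
  rw [show s + q - (s + r) = q - r by ring] at this
  simpa [RoughEvolution.wienerShift] using this

/-- Test with `e j` and split the pairing at `s`. On `[0, s]` the remaining time `t` contributes the
scalar `exp (-(μ j * t))`, which is `S t` in coordinate `j`; on `[s, s + t]` translation produces
the Wiener shift. -/
lemma pathIntegral_add [Countable ι] (hS : IsDiagonalSemigroup e S μ)
    (hx : Exponents α β β' γ 0) (hγ1 : γ ≤ 1) {s : ℝ} (hs : 0 ≤ s) (ht : 0 ≤ t)
    (hB : WeightedPath β M 0 B) (ω : PathSpace V β') (hw : HolderPath β' L 0 (s + t) ω.1) :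
    pathIntegral e α 0 (s + t) (fun r => (S (s + t - r)).comp (B r)) ω.1 =
      S t (pathIntegral e α 0 s (fun r => (S (s - r)).comp (B r)) ω.1) +
        pathIntegral e α 0 t (fun r => (S (t - r)).comp (B (s + r))) (wienerShift s ω.1) := by
  rcases eq_or_lt_of_le (add_nonneg hs ht) with hst | hst
  · obtain rfl : s = 0 := by linarith
    obtain rfl : t = 0 := by linarith
    rw [add_zero]
    simp only [pathIntegral_self, map_zero, add_zero]
  refine eq_of_inner_basis e fun j => ?_
  have hβ := hx.β_nonneg
  obtain ⟨A, hA⟩ := weightedPath_testFun hS hB hβ hx.β_lt.le hst.le j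
  rw [inner_add_right, hS.inner_basis j ht,
    inner_pathIntegral hS hx hγ1 hst.le hB hw,
    inner_pathIntegral hS hx hγ1 hs hB (hw.mono le_rfl (by linarith)),
    inner_pathIntegral (B := fun r => B (s + r)) hS hx hγ1 ht (hB.comp_add hβ hs)
      (hw.wienerShift hs),
    pairing_add_adjacent e hx hs (by linarith : s ≤ s + t) hA hw fun i =>
      ω.littlePath hst (e i) (e.orthonormal.1 i).le hw]
  have h1 : pairing α 0 s (testFun S B (s + t) (e j)) ω.1 =
      Real.exp (-(μ j * t)) * pairing α 0 s (testFun S B s (e j)) ω.1 := by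
    rw [← pairing_const_smul]
    refine pairing_congr hs (fun q hq => ?_) fun q _ => rfl
    have h0 : 0 ≤ s - q := sub_nonneg.2 hq.2
    rw [testFun, testFun, max_eq_left h0, max_eq_left (by linarith : 0 ≤ s + t - q),
      show s + t - q = (s - q) + t by ring, hS.apply_add h0 ht, hS.apply_basis j t ht, map_smul,
      map_smul]
  have h2 : pairing α s (s + t) (testFun S B (s + t) (e j)) ω.1 =
      pairing α 0 t (testFun S (fun r => B (s + r)) t (e j)) (wienerShift s ω.1) := by
    have := pairing_comp_add (α := α) (s := 0) (t := t) (h := testFun S B (s + t) (e j))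
      (w := ω.1) s
    rw [add_zero] at this
    rw [← this]
    refine pairing_congr ht (fun q _ => ?_) fun q _ => rfl
    rw [testFun, testFun, show s + t - (s + q) = t - q by ring]
  rw [h1, h2]
  ring

omit [CompleteSpace V] in
lemma pathIntegral_congr (e : HilbertBasis ι ℝ V) (α : ℝ) {s t : ℝ} (hst : s ≤ t)
    {g k : ℝ → V →L[ℝ] V} (hgk : ∀ r ∈ Icc s t, g r = k r) (w : ℝ → V) :
    pathIntegral e α s t g w = pathIntegral e α s t k w := by
  have : ∀ j i, (∫ r in s..t, leftFracDeriv α s (fun q => inner ℝ (e j) (g q (e i))) r *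
      rightFracDeriv α t (fun q => inner ℝ (e i) (w q)) r) =
      ∫ r in s..t, leftFracDeriv α s (fun q => inner ℝ (e j) (k q (e i))) r *
        rightFracDeriv α t (fun q => inner ℝ (e i) (w q)) r := fun j i => by
    refine integral_congr_Ioo hst fun r hr => ?_
    rw [leftFracDeriv_eq, leftFracDeriv_eq, leftD_congr hr.1.le
      (k := fun q => inner ℝ (e j) (k q (e i)))
      fun q hq => by rw [hgk q ⟨hq.1, hq.2.trans hr.2.le⟩]]
  simp only [pathIntegral, this]

/-! ### The deterministic convolution -/

-- Nothing is known about `S` at negative times; the truncation changes nothing on `[a, b]` and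
-- makes the integrand continuous on the line when `f` is.
omit [CompleteSpace V] in
lemma detConv_eq (S : ℝ → V →L[ℝ] V) (f : ℝ → V) {a b t : ℝ} (hab : a ≤ b)
    (hb : b ≤ t) : ∫ r in a..b, S (t - r) (f r) = ∫ r in a..b, S (max (t - r) 0) (f r) := by
  refine intervalIntegral.integral_congr fun r hr => ?_
  rw [uIcc_of_le hab] at hr
  simp only [max_eq_left (by linarith [hr.2] : 0 ≤ t - r)]

lemma detConv_add (hS : IsDiagonalSemigroup e S μ) {f : ℝ → V} (hf : Continuous f) {s t : ℝ}
    (hs : 0 ≤ s) (ht : 0 ≤ t) :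
    ∫ r in (0 : ℝ)..(s + t), S (s + t - r) (f r) =
      S t (∫ r in (0 : ℝ)..s, S (s - r) (f r)) + ∫ r in (0 : ℝ)..t, S (t - r) (f (s + r)) := by
  have hc : ∀ t, Continuous fun r => S (max (t - r) 0) (f r) := fun t =>
    hS.continuous_apply (by fun_prop) hf
  rw [detConv_eq S f (by linarith) le_rfl, ← intervalIntegral.integral_add_adjacent_intervals
    ((hc (s + t)).intervalIntegrable 0 s) ((hc (s + t)).intervalIntegrable s (s + t)),
    detConv_eq S f hs le_rfl,
    ← (S t).intervalIntegral_comp_comm ((hc s).intervalIntegrable 0 s)]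
  congr 1
  · refine intervalIntegral.integral_congr fun r hr => ?_
    rw [uIcc_of_le hs] at hr
    have h0 : 0 ≤ s - r := by linarith [hr.2]
    rw [max_eq_left h0, max_eq_left (by linarith : 0 ≤ s + t - r), ← hS.apply_add ht h0,
      show t + (s - r) = s + t - r by ring]
  · have := intervalIntegral.integral_comp_add_left (a := 0) (b := t)
      (fun r => S (max (s + t - r) 0) (f r)) s
    rw [add_zero] at this
    rw [← this, detConv_eq S (fun r => f (s + r)) ht le_rfl]
    refine intervalIntegral.integral_congr fun r _ => ?_
    rw [show s + t - (s + r) = t - r by ring]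

omit [CompleteSpace V] in
lemma norm_detConv_le (hS : IsDiagonalSemigroup e S μ) {f : ℝ → V} {C : ℝ}
    (hC : ∀ r, ‖f r‖ ≤ C) (ht : 0 ≤ t) : ‖∫ r in (0 : ℝ)..t, S (t - r) (f r)‖ ≤ C * t := by
  have := intervalIntegral.norm_integral_le_of_norm_le_const (a := 0) (b := t) (C := C)
    (f := fun r => S (t - r) (f r)) fun r hr => by
      rw [uIoc_of_le ht] at hr
      exact (hS.norm_apply_le (by linarith [hr.2]) _).trans (hC r)
  rwa [sub_zero, abs_of_nonneg ht] at this

lemma norm_increment_detConv_le (hS : IsDiagonalSemigroup e S μ) {f : ℝ → V} (hf : Continuous f)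
    {C : ℝ} (hC : ∀ r, ‖f r‖ ≤ C) (hβ : 0 ≤ β) (hβ1 : β < 1) (ht : 0 < t) {δ : ℝ} (hδ : 0 ≤ δ) :
    ‖S δ (∫ r in (0 : ℝ)..t, S (t - r) (f r)) - ∫ r in (0 : ℝ)..t, S (t - r) (f r)‖ ≤
      C * betaInt 0 (-β) * t ^ (1 - β) * δ ^ β := by
  have hc : Continuous fun r => S (max (t - r) 0) (f r) :=
    hS.continuous_apply (by fun_prop) hf
  rw [detConv_eq S f ht.le le_rfl,
    ← (S δ).intervalIntegral_comp_comm (hc.intervalIntegrable 0 t),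
    ← intervalIntegral.integral_sub (f := fun r => S δ (S (max (t - r) 0) (f r)))
      (((S δ).continuous.comp hc).intervalIntegrable 0 t) (hc.intervalIntegrable 0 t)]
  have hb := intervalIntegrable_beta (a := 0) (b := -β) (by norm_num) (by linarith) ht
  refine (norm_integral_le_of_bound ht.le (hb.const_mul (C * δ ^ β)) fun r hr => ?_).trans ?_
  · have h0 : 0 < t - r := sub_pos.2 hr.2
    rw [max_eq_left h0.le, ← hS.apply_add hδ h0.le]
    refine (hS.norm_apply_sub_le hβ hβ1.le h0 (by linarith) (f r)).trans ?_
    rw [add_sub_cancel_right, Real.rpow_zero, one_mul]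
    have := mul_le_mul_of_nonneg_left (hC r)
      (mul_nonneg (Real.rpow_nonneg hδ β) (Real.rpow_nonneg h0.le (-β)))
    linarith
  · rw [intervalIntegral.integral_const_mul, integral_beta ht, sub_zero,
      show 0 + -β + 1 = 1 - β by ring]
    exact le_of_eq (by ring)

end Convolution

/-! ### Weighted Hölder paths -/

/-- Membership in `C^β_β([0, T])` with explicit bounds. -/
structure MildPath {E : Type*} [NormedAddCommGroup E] (β U T : ℝ) (u : ℝ → E) : Prop where
  cont : ContinuousOn u (Icc 0 T)
  norm_le : ∀ r ∈ Icc 0 T, ‖u r‖ ≤ U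
  sub_le : ∀ r q, 0 < q → q < r → r ≤ T → ‖u r - u q‖ ≤ U * (q ^ (-β) * (r - q) ^ β)

section MildPath

variable {E : Type*} [NormedAddCommGroup E] {β U T : ℝ} {u : ℝ → E}

lemma MildPath.mono_time (hu : MildPath β U T u) {T' : ℝ} (hT : T' ≤ T) : MildPath β U T' u :=
  ⟨hu.cont.mono (Icc_subset_Icc_right hT), fun r hr => hu.norm_le r ⟨hr.1, hr.2.trans hT⟩,
    fun r q h1 h2 h3 => hu.sub_le r q h1 h2 (h3.trans hT)⟩

lemma MildPath.nonneg (hu : MildPath β U T u) (hT : 0 ≤ T) : 0 ≤ U :=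
  (norm_nonneg _).trans (hu.norm_le 0 ⟨le_rfl, hT⟩)

lemma weightedHolder_quotient_eq {c d : ℝ} (hc : 0 ≤ c) (hd : 0 < d) (x : E) :
    ENNReal.ofReal c * (‖x‖ₑ / ENNReal.ofReal d) = ENNReal.ofReal (c * (‖x‖ / d)) := by
  rw [ENNReal.ofReal_mul hc, ENNReal.ofReal_div_of_pos hd, ofReal_norm]

lemma memWeightedHolder_iff : MemWeightedHolder β u 0 T ↔ ∃ U, MildPath β U T u := by
  have hquot : ∀ {q r : ℝ}, 0 < q → q < r → ENNReal.ofReal ((q - 0) ^ β) *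
      (‖u r - u q‖ₑ / ENNReal.ofReal ((r - q) ^ β)) =
      ENNReal.ofReal (q ^ β * (‖u r - u q‖ / (r - q) ^ β)) := fun {q r} hq hr => by
    rw [sub_zero, weightedHolder_quotient_eq (Real.rpow_nonneg hq.le _)
      (Real.rpow_pos_of_pos (sub_pos.2 hr) _)]
  constructor
  · rintro ⟨hc, hfin⟩
    have h1 : supNorm u 0 T < ∞ := lt_of_le_of_lt le_self_add hfin
    have h2 : weightedHolderSeminorm β u 0 T < ∞ := lt_of_le_of_lt le_add_self hfin
    have n1 : 0 ≤ (supNorm u 0 T).toReal := ENNReal.toReal_nonneg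
    have n2 : 0 ≤ (weightedHolderSeminorm β u 0 T).toReal := ENNReal.toReal_nonneg
    refine ⟨(supNorm u 0 T).toReal + (weightedHolderSeminorm β u 0 T).toReal, hc,
      fun r hr => ?_, fun r q hq hr hT => ?_⟩
    · have h3 : ‖u r‖ₑ ≤ supNorm u 0 T := by
        unfold supNorm; exact le_iSup₂_of_le r hr le_rfl
      have := ENNReal.toReal_mono h1.ne h3
      rw [toReal_enorm] at this
      linarith
    · have h3 : ENNReal.ofReal ((q - 0) ^ β) * (‖u r - u q‖ₑ / ENNReal.ofReal ((r - q) ^ β)) ≤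
          weightedHolderSeminorm β u 0 T := by
        unfold weightedHolderSeminorm
        exact le_iSup_of_le q (le_iSup_of_le r (le_iSup_of_le ⟨hq, hr, hT⟩ le_rfl))
      rw [hquot hq hr] at h3
      have h4 := (ENNReal.ofReal_le_iff_le_toReal h2.ne).1 h3
      have p1 := Real.rpow_pos_of_pos hq β
      have p2 := Real.rpow_pos_of_pos (sub_pos.2 hr) β
      rw [← mul_div_assoc, div_le_iff₀ p2] at h4
      rw [Real.rpow_neg hq.le]
      have h5 : ‖u r - u q‖ ≤ (weightedHolderSeminorm β u 0 T).toReal *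
          ((q ^ β)⁻¹ * (r - q) ^ β) := by
        rw [← mul_assoc, mul_comm _ (q ^ β)⁻¹, mul_assoc, ← div_eq_inv_mul, le_div_iff₀ p1]
        linarith
      refine h5.trans (mul_le_mul_of_nonneg_right (by linarith) (by positivity))
  · rintro ⟨U, hu⟩
    refine ⟨hu.cont, ENNReal.add_lt_top.2 ⟨lt_of_le_of_lt (b := ENNReal.ofReal U) ?_
      ENNReal.ofReal_lt_top, lt_of_le_of_lt (b := ENNReal.ofReal U) ?_ ENNReal.ofReal_lt_top⟩⟩
    · refine iSup₂_le fun r hr => ?_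
      rw [← ofReal_norm]
      exact ENNReal.ofReal_le_ofReal (hu.norm_le r hr)
    · refine iSup_le fun q => iSup_le fun r => iSup_le fun h => ?_
      obtain ⟨hq, hr, hT⟩ := h
      rw [hquot hq hr]
      refine ENNReal.ofReal_le_ofReal ?_
      have p1 := Real.rpow_pos_of_pos hq β
      have p2 := Real.rpow_pos_of_pos (sub_pos.2 hr) β
      have := hu.sub_le r q hq hr hT
      rw [Real.rpow_neg hq.le, ← mul_assoc, mul_comm U, mul_assoc, ← div_eq_inv_mul,
        le_div_iff₀ p1] at this
      rw [← mul_div_assoc, div_le_iff₀ p2]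
      linarith

/-- Freezing the path outside `[0, T]` gives the globally continuous functions that the pairing
estimates demand, without increasing the constant. -/
lemma MildPath.weightedPath_clamp (hu : MildPath β U T u) (hT : 0 ≤ T) (hβ : 0 ≤ β) :
    WeightedPath β U 0 fun r => u (max 0 (min r T)) := by
  have hmem : ∀ r : ℝ, max 0 (min r T) ∈ Icc 0 T := fun r =>
    ⟨le_max_left _ _, max_le hT (min_le_right _ _)⟩
  have hU := hu.nonneg hT
  refine ⟨hu.cont.comp_continuous (by fun_prop) hmem, fun r => hu.norm_le _ (hmem r),
    fun r q hq hr => ?_⟩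
  have hq' : 0 < q := hq
  have p1 : 0 ≤ q ^ (-β) := Real.rpow_nonneg hq'.le _
  have p2 : 0 ≤ (r - q) ^ β := Real.rpow_nonneg (by linarith) _
  rw [sub_zero]
  rcases le_or_gt T q with h | h
  · rw [min_eq_right h, min_eq_right (h.trans hr.le), sub_self, norm_zero]
    positivity
  · have hlt : q < min r T := lt_min hr h
    rw [min_eq_left h.le, max_eq_right hq'.le, max_eq_right (hq'.trans hlt).le]
    refine (hu.sub_le _ _ hq' hlt (min_le_right _ _)).trans ?_
    have := Real.rpow_le_rpow (sub_nonneg.2 hlt.le) (sub_le_sub_right (min_le_left r T) q) hβ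
    gcongr

lemma MildPath.comp_add (hβ : 0 ≤ β) {s : ℝ} (hs : 0 ≤ s) (hT : 0 ≤ T)
    (hu : MildPath β U (s + T) u) :
    MildPath β U T fun r => u (s + r) := by
  refine ⟨hu.cont.comp (by fun_prop) fun r hr => ⟨by linarith [hr.1], by linarith [hr.2]⟩,
    fun r hr => hu.norm_le _ ⟨by linarith [hr.1], by linarith [hr.2]⟩, fun r q hq hr hrT => ?_⟩
  have h := hu.sub_le (s + r) (s + q) (by linarith) (by linarith) (by linarith)
  rw [add_sub_add_left_eq_sub] at h
  refine h.trans ?_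
  have hU := hu.nonneg (add_nonneg hs hT)
  have h2 := Real.rpow_le_rpow_of_nonpos hq (by linarith : q ≤ s + q) (neg_nonpos.2 hβ)
  have h3 : 0 ≤ (r - q) ^ β := Real.rpow_nonneg (by linarith) _
  gcongr

/-- Gluing a weighted Hölder path with a Hölder path. -/
lemma MildPath.glue (hβ : 0 ≤ β) {s C : ℝ} (hs : 0 ≤ s) (hT : 0 ≤ T) (hu : MildPath β U s u)
    {v : ℝ → E} (hv : ContinuousOn v (Icc 0 T))
    (hvC : ∀ a b, 0 ≤ a → a < b → b ≤ T → ‖v b - v a‖ ≤ C * (b - a) ^ β) :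
    ∃ U', MildPath β U' (s + T) fun q => u (min q s) + v (max (q - s) 0) - v 0 := by
  have hcont : ContinuousOn (fun q => u (min q s) + v (max (q - s) 0) - v 0) (Icc 0 (s + T)) := by
    refine ContinuousOn.sub (ContinuousOn.add (hu.cont.comp (by fun_prop) fun q hq => ?_)
      (hv.comp (by fun_prop) fun q hq => ?_)) continuousOn_const
    · exact ⟨le_min hq.1 hs, min_le_right _ _⟩
    · exact ⟨le_max_right _ _, max_le (by linarith [hq.2]) hT⟩
  obtain ⟨N, hN⟩ := isCompact_Icc.exists_bound_of_continuousOn hcont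
  have hU := hu.nonneg hs
  have hsT : 0 ≤ s + T := add_nonneg hs hT
  have hp : 0 ≤ (s + T) ^ β := Real.rpow_nonneg hsT _
  have hle : U + |C| * (s + T) ^ β ≤ max N (U + |C| * (s + T) ^ β) := le_max_right _ _
  refine ⟨max N (U + |C| * (s + T) ^ β), hcont, fun r hr => (hN r hr).trans (le_max_left _ _),
    fun b a ha hab hb => ?_⟩
  have p1 : 0 ≤ a ^ (-β) := Real.rpow_nonneg ha.le _
  have p2 : 0 ≤ (b - a) ^ β := Real.rpow_nonneg (by linarith) _
  have b1 : ‖u (min b s) - u (min a s)‖ ≤ U * (a ^ (-β) * (b - a) ^ β) := by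
    rcases le_or_gt s a with h | h
    · rw [min_eq_right h, min_eq_right (h.trans hab.le), sub_self, norm_zero]
      positivity
    · have hlt : a < min b s := lt_min hab h
      rw [min_eq_left h.le]
      refine (hu.sub_le _ _ ha hlt (min_le_right _ _)).trans ?_
      have := Real.rpow_le_rpow (sub_nonneg.2 hlt.le) (sub_le_sub_right (min_le_left b s) a) hβ
      gcongr
  have b2 : ‖v (max (b - s) 0) - v (max (a - s) 0)‖ ≤ |C| * (b - a) ^ β := by
    rcases le_or_gt b s with h | h
    · rw [max_eq_right (by linarith), max_eq_right (by linarith), sub_self, norm_zero]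
      positivity
    · have hlt : max (a - s) 0 < max (b - s) 0 := by
        rw [max_eq_left (by linarith : 0 ≤ b - s)]
        exact max_lt (by linarith) (by linarith)
      refine (hvC _ _ (le_max_right _ _) hlt (max_le (by linarith) hT)).trans ?_
      have h3 : max (b - s) 0 - max (a - s) 0 ≤ b - a := by
        rw [max_eq_left (by linarith : 0 ≤ b - s)]
        linarith [le_max_left (a - s) 0]
      have h4 := Real.rpow_le_rpow (sub_nonneg.2 hlt.le) h3 hβ
      have h5 : 0 ≤ (max (b - s) 0 - max (a - s) 0) ^ β :=
        Real.rpow_nonneg (sub_nonneg.2 hlt.le) _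
      exact mul_le_mul (le_abs_self C) h4 h5 (abs_nonneg _)
  -- This turns the unweighted bound for `v` into one with the weight based at time zero.
  have b3 : 1 ≤ (s + T) ^ β * a ^ (-β) := by
    rw [Real.rpow_neg ha.le, ← div_eq_mul_inv, one_le_div (Real.rpow_pos_of_pos ha _)]
    exact Real.rpow_le_rpow ha.le (by linarith) hβ
  have e : u (min b s) + v (max (b - s) 0) - v 0 - (u (min a s) + v (max (a - s) 0) - v 0) =
      (u (min b s) - u (min a s)) + (v (max (b - s) 0) - v (max (a - s) 0)) := by abel
  rw [e]
  refine (norm_add_le _ _).trans ((add_le_add b1 b2).trans ?_)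
  calc U * (a ^ (-β) * (b - a) ^ β) + |C| * (b - a) ^ β
      ≤ U * (a ^ (-β) * (b - a) ^ β) + |C| * (b - a) ^ β * ((s + T) ^ β * a ^ (-β)) :=
        add_le_add le_rfl (le_mul_of_one_le_right (by positivity) b3)
    _ = (U + |C| * (s + T) ^ β) * (a ^ (-β) * (b - a) ^ β) := by ring
    _ ≤ _ := by gcongr

end MildPath

/-! ### The mild integral -/

section Mild

variable {V : Type*} [NormedAddCommGroup V] [InnerProductSpace ℝ V] {ι : Type*}

/-- The sum of the deterministic and the pathwise convolution. -/
def mildInt (e : HilbertBasis ι ℝ V) (S : ℝ → V →L[ℝ] V) (α t : ℝ) (f : ℝ → V)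
    (B : ℝ → V →L[ℝ] V) (w : ℝ → V) : V :=
  (∫ r in (0 : ℝ)..t, S (t - r) (f r)) +
    pathIntegral e α 0 t (fun r => (S (t - r)).comp (B r)) w

lemma mildInt_zero (e : HilbertBasis ι ℝ V) (S : ℝ → V →L[ℝ] V) (α : ℝ) (f : ℝ → V)
    (B : ℝ → V →L[ℝ] V) (w : ℝ → V) : mildInt e S α 0 f B w = 0 := by
  rw [mildInt, pathIntegral_self, intervalIntegral.integral_same, add_zero]

lemma mildInt_congr (e : HilbertBasis ι ℝ V) (S : ℝ → V →L[ℝ] V) (α : ℝ) {t : ℝ} (ht : 0 ≤ t)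
    {f f' : ℝ → V} {B B' : ℝ → V →L[ℝ] V} (w : ℝ → V)
    (h : ∀ r ∈ Icc 0 t, f r = f' r ∧ B r = B' r) :
    mildInt e S α t f B w = mildInt e S α t f' B' w := by
  rw [mildInt, mildInt, pathIntegral_congr e α ht
    (k := fun r => (S (t - r)).comp (B' r)) (fun r hr => by rw [(h r hr).2]) w]
  congr 1
  refine intervalIntegral.integral_congr fun r hr => ?_
  rw [uIcc_of_le ht] at hr
  simp only [(h r hr).1]

lemma isMildSolution_iff {e : HilbertBasis ι ℝ V} {S : ℝ → V →L[ℝ] V} {F : V → V}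
    {G : V → V →L[ℝ] V} {α β : ℝ} {w : ℝ → V} {u₀ : V} {T : ℝ} {u : ℝ → V} :
    IsMildSolution e S F G α β w u₀ T u ↔ (∃ U, MildPath β U T u) ∧ ∀ t ∈ Icc 0 T,
      u t = S t u₀ + mildInt e S α t (fun r => F (u r)) (fun r => G (u r)) w := by
  simp only [IsMildSolution, memWeightedHolder_iff, mildInt, add_assoc]

variable [CompleteSpace V] [Countable ι] {e : HilbertBasis ι ℝ V} {S : ℝ → V →L[ℝ] V} {μ : ι → ℝ}
  {α β β' : ℝ}

lemma mildInt_add (hS : IsDiagonalSemigroup e S μ) {γ M L s t : ℝ}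
    (hx : Exponents α β β' γ 0) (hγ1 : γ ≤ 1) (hs : 0 ≤ s) (ht : 0 ≤ t) {f : ℝ → V}
    (hf : Continuous f) {B : ℝ → V →L[ℝ] V} (hB : WeightedPath β M 0 B) (ω : PathSpace V β')
    (hw : HolderPath β' L 0 (s + t) ω.1) :
    mildInt e S α (s + t) f B ω.1 = S t (mildInt e S α s f B ω.1) +
      mildInt e S α t (fun r => f (s + r)) (fun r => B (s + r)) (wienerShift s ω.1) := by
  rw [mildInt, mildInt, mildInt, detConv_add hS hf hs ht, pathIntegral_add hS hx hγ1 hs ht hB ω hw,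
    map_add]
  abel

lemma rpow_le_rpow_mul {t T a b : ℝ} (ht : 0 < t) (hT : t ≤ T) (hab : a ≤ b) :
    t ^ b ≤ T ^ (b - a) * t ^ a := by
  have := Real.rpow_le_rpow ht.le hT (sub_nonneg.2 hab)
  calc t ^ b = t ^ (b - a) * t ^ a := by rw [← Real.rpow_add ht]; simp
    _ ≤ _ := mul_le_mul_of_nonneg_right this (Real.rpow_nonneg ht.le _)

/-- `K` depends only on the bounds `C`, `M`, `L`, `T` and the exponents, so it also covers the
integrals restarted at an intermediate time with shifted data. The surplus powers of `t` are
absorbed into powers of `T`. -/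
lemma exists_mildInt_bound (hS : IsDiagonalSemigroup e S μ) {γ : ℝ}
    (hx : Exponents α β β' γ 0) (hxβ : Exponents α β β' γ β) (hββ' : β ≤ β') (hγ1 : γ ≤ 1)
    {C M L T : ℝ} (hC : 0 ≤ C) (hM : 0 ≤ M) (hL : 0 ≤ L) (hT : 0 ≤ T) :
    ∃ K, 0 ≤ K ∧ ∀ (f : ℝ → V) (B : ℝ → V →L[ℝ] V) (w : ℝ → V) (t : ℝ), Continuous f →
      (∀ r, ‖f r‖ ≤ C) → WeightedPath β M 0 B → HolderPath β' L 0 t w → 0 ≤ t → t ≤ T →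
      ‖mildInt e S α t f B w‖ ≤ K * t ^ β ∧
      ∀ δ, 0 ≤ δ → ‖S δ (mildInt e S α t f B w) - mildInt e S α t f B w‖ ≤ K * δ ^ β := by
  have hβ1 := hx.β_lt
  have hβ := hx.β_nonneg
  have k1 := hx.pairIntConst_nonneg
  have k2 := hxβ.pairIntConst_nonneg
  have k3 := betaInt_nonneg 0 (-β)
  have hP : 0 ≤ |pairFactor α| := abs_nonneg _
  set K₁ := C * T ^ (1 - β) + |pairFactor α| * pairIntConst α β β' γ 0 * (M * L) * T ^ (β' - β)
  set K₂ := C * betaInt 0 (-β) * T ^ (1 - β) +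
    |pairFactor α| * pairIntConst α β β' γ β * (M * L) * 2 ^ (β + γ) * T ^ (β' - β)
  have hK₁ : 0 ≤ K₁ := by positivity
  have hK₂ : 0 ≤ K₂ := by positivity
  refine ⟨K₁ + K₂, by positivity, fun f B w t hf hfC hB hw ht htT => ?_⟩
  rcases eq_or_lt_of_le ht with rfl | ht
  · simp only [mildInt_zero, map_zero, sub_zero, norm_zero]
    exact ⟨by positivity, fun δ hδ => by positivity⟩
  constructor
  · have b1 := norm_detConv_le hS hfC ht.le
    have b2 := norm_pathIntegral_le hS hx hγ1 ht hB hL hw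
    have c1 : t ≤ T ^ (1 - β) * t ^ β := by simpa using rpow_le_rpow_mul ht htT hβ1.le
    have c2 := rpow_le_rpow_mul ht htT hββ'
    have hp : 0 ≤ t ^ β := by positivity
    refine (norm_add_le _ _).trans ((add_le_add b1 b2).trans ?_)
    calc _ ≤ C * (T ^ (1 - β) * t ^ β) +
          |pairFactor α| * pairIntConst α β β' γ 0 * (M * L) * (T ^ (β' - β) * t ^ β) := by gcongr
      _ = K₁ * t ^ β := by simp only [K₁]; ring
      _ ≤ (K₁ + K₂) * t ^ β := by gcongr; linarith
  · intro δ hδ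
    have b1 := norm_increment_detConv_le hS hf hfC hβ hβ1 ht hδ
    have b2 := norm_increment_pathIntegral_le hS hx hxβ hγ1 ht hB hL hw hδ
    have c1 := Real.rpow_le_rpow ht.le htT (sub_nonneg.2 hβ1.le)
    have c2 := Real.rpow_le_rpow ht.le htT (sub_nonneg.2 hββ')
    have hp : 0 ≤ δ ^ β := by positivity
    rw [mildInt, map_add, add_sub_add_comm]
    refine (norm_add_le _ _).trans ((add_le_add b1 b2).trans ?_)
    calc _ ≤ C * betaInt 0 (-β) * T ^ (1 - β) * δ ^ β +
          |pairFactor α| * pairIntConst α β β' γ β * (M * L) * 2 ^ (β + γ) * T ^ (β' - β) *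
            δ ^ β := by gcongr
      _ = K₂ * δ ^ β := by simp only [K₂]; ring
      _ ≤ (K₁ + K₂) * δ ^ β := by gcongr; linarith

variable {F : V → V} {G : V → V →L[ℝ] V} {LG : ℝ≥0}

omit [CompleteSpace V] in
/-- Global continuous extensions of the coefficients along a weighted Hölder path. -/
lemma MildPath.exists_coefficients (hF : Continuous F) (hG : ∀ u v, ‖G u - G v‖ ≤ LG * ‖u - v‖)
    (hβ : 0 ≤ β) {U T : ℝ} (hT : 0 ≤ T) {u : ℝ → V} (hu : MildPath β U T u) :
    ∃ (f : ℝ → V) (B : ℝ → V →L[ℝ] V) (C M : ℝ), Continuous f ∧ (∀ r, ‖f r‖ ≤ C) ∧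
      WeightedPath β M 0 B ∧ ∀ r ∈ Icc 0 T, F (u r) = f r ∧ G (u r) = B r := by
  have hw := hu.weightedPath_clamp hT hβ
  have hU := hu.nonneg hT
  have hGc : Continuous G := (LipschitzWith.of_dist_le_mul fun x y => by
    rw [dist_eq_norm, dist_eq_norm]; exact hG x y).continuous
  obtain ⟨C, hC⟩ := isCompact_Icc.exists_bound_of_continuousOn (s := Icc 0 T)
    (hF.comp_continuousOn hu.cont)
  -- The constant `‖G 0‖ + LG * U` bounds both the size and the weighted Hölder increments of `G`
  -- along the path.
  refine ⟨fun r => F (u (max 0 (min r T))), fun r => G (u (max 0 (min r T))), C,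
    ‖G 0‖ + LG * U, hF.comp hw.cont, fun r => hC _ ⟨le_max_left _ _,
      max_le hT (min_le_right _ _)⟩, ⟨hGc.comp hw.cont, fun r => ?_, fun r q hq hr => ?_⟩,
      fun r hr => ?_⟩
  · have h1 := hG (u (max 0 (min r T))) 0
    rw [sub_zero] at h1
    have h2 := norm_le_norm_add_norm_sub' (G (u (max 0 (min r T)))) (G 0)
    have h3 := mul_le_mul_of_nonneg_left (hw.norm_le r) LG.2
    have h4 : ‖G (u (max 0 (min r T)))‖ ≤ ‖G 0‖ + ‖G (u (max 0 (min r T))) - G 0‖ := h2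
    exact h4.trans (by simpa using h1.trans h3)
  · have h0 : 0 ≤ (q - 0) ^ (-β) * (r - q) ^ β :=
      mul_nonneg (Real.rpow_nonneg (by linarith) _) (Real.rpow_nonneg (by linarith) _)
    refine (hG _ _).trans ((mul_le_mul_of_nonneg_left (hw.sub_le r q hq hr) LG.2).trans ?_)
    rw [← mul_assoc]
    exact mul_le_mul_of_nonneg_right (le_add_of_nonneg_left (norm_nonneg _)) h0
  · have h0 : max 0 (min r T) = r := by rw [min_eq_left hr.2, max_eq_right hr.1]
    simp only [h0, and_self]

lemma mildInt_add_of_mildPath (hS : IsDiagonalSemigroup e S μ) {γ : ℝ}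
    (hx : Exponents α β β' γ 0) (hγ1 : γ ≤ 1) (hF : Continuous F)
    (hG : ∀ u v, ‖G u - G v‖ ≤ LG * ‖u - v‖) {s t U : ℝ} (hs : 0 ≤ s) (ht : 0 ≤ t)
    {u : ℝ → V} (hu : MildPath β U (s + t) u) (ω : PathSpace V β') :
    mildInt e S α (s + t) (fun r => F (u r)) (fun r => G (u r)) ω.1 =
      S t (mildInt e S α s (fun r => F (u r)) (fun r => G (u r)) ω.1) +
        mildInt e S α t (fun r => F (u (s + r))) (fun r => G (u (s + r))) (wienerShift s ω.1) := by
  have hst := add_nonneg hs ht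
  obtain ⟨f, B, C, M, hf, -, hB, hfB⟩ := hu.exists_coefficients hF hG hx.β_nonneg hst
  obtain ⟨L, -, hL⟩ := ω.exists_holderPath (s + t)
  rw [mildInt_congr e S α hst _ hfB,
    mildInt_congr e S α hs _ fun r hr => hfB r ⟨hr.1, by linarith [hr.2]⟩,
    mildInt_congr e S α ht _ fun r hr => hfB (s + r) ⟨by linarith [hr.1], by linarith [hr.2]⟩]
  exact mildInt_add hS hx hγ1 hs ht hf hB ω (hL.mono (by linarith) le_rfl)

/-! ### Regularity of mild solutions -/

/-- A mild solution starting from a point with a Hölder continuous orbit is Hölder continuous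
up to time zero. -/
lemma holder_of_isMildSolution (hS : IsDiagonalSemigroup e S μ) {γ : ℝ}
    (hx : Exponents α β β' γ 0) (hxβ : Exponents α β β' γ β) (hββ' : β ≤ β') (hγ1 : γ ≤ 1)
    (hF : Continuous F) (hG : ∀ u v, ‖G u - G v‖ ≤ LG * ‖u - v‖) {T C₀ : ℝ} (hT : 0 ≤ T)
    (ω : PathSpace V β') {x : V} {v : ℝ → V} (hv : IsMildSolution e S F G α β ω.1 x T v)
    (hC₀ : ∀ δ, 0 ≤ δ → ‖S δ x - x‖ ≤ C₀ * δ ^ β) :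
    ∃ C, ∀ a b, 0 ≤ a → a < b → b ≤ T → ‖v b - v a‖ ≤ C * (b - a) ^ β := by
  obtain ⟨⟨U, hU⟩, heq⟩ := isMildSolution_iff.1 hv
  obtain ⟨f, B, C, M, hf, hfC, hB, hfB⟩ := hU.exists_coefficients hF hG hx.β_nonneg hT
  obtain ⟨L, hL0, hL⟩ := ω.exists_holderPath T
  obtain ⟨K, hK0, hK⟩ := exists_mildInt_bound hS hx hxβ hββ' hγ1
    ((norm_nonneg _).trans (hfC 0)) hB.nonneg hL0 hT
  refine ⟨C₀ + K + K, fun a b ha hab hb => ?_⟩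
  have hd : 0 ≤ b - a := by linarith
  have hva : v a = S a x + mildInt e S α a f B ω.1 := by
    rw [heq a ⟨ha, hab.le.trans hb⟩, mildInt_congr e S α ha _ fun r hr =>
      hfB r ⟨hr.1, by linarith [hr.2]⟩]
  have hvb : v b = S (b - a) (S a x) + (S (b - a) (mildInt e S α a f B ω.1) +
      mildInt e S α (b - a) (fun r => f (a + r)) (fun r => B (a + r)) (wienerShift a ω.1)) := by
    have h1 := mildInt_add hS hx hγ1 ha hd hf hB ω (L := L)
      (hL.mono (by linarith) (by linarith))
    rw [add_sub_cancel] at h1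
    rw [← h1, ← hS.apply_add hd ha, sub_add_cancel, heq b ⟨by linarith, hb⟩,
      mildInt_congr e S α (by linarith) _ fun r hr => hfB r ⟨hr.1, by linarith [hr.2]⟩]
  -- The increment splits into the orbit of the initial point, controlled by `C₀`, the semigroup
  -- acting on the integral up to `a`, and the new integral over `[a, b]`. Each is of order `(b - a)
  -- ^ β` uniformly as `a` tends to zero.
  have e1 : v b - v a = S a (S (b - a) x - x) +
      (S (b - a) (mildInt e S α a f B ω.1) - mildInt e S α a f B ω.1) +
      mildInt e S α (b - a) (fun r => f (a + r)) (fun r => B (a + r)) (wienerShift a ω.1) := by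
    rw [hva, hvb, map_sub, ← hS.apply_add ha hd, ← hS.apply_add hd ha, add_comm a]
    abel
  rw [e1]
  have b1 := (hS.norm_apply_le ha (S (b - a) x - x)).trans (hC₀ _ hd)
  have b2 := (hK f B ω.1 a hf hfC hB (hL.mono (by linarith) (by linarith)) ha
    (by linarith)).2 (b - a) hd
  have b3 := (hK (fun r => f (a + r)) (fun r => B (a + r)) (wienerShift a ω.1) (b - a)
    (by fun_prop) (fun r => hfC _) (hB.comp_add hx.β_nonneg ha)
    (HolderPath.wienerShift ha (hL.mono (by linarith) (by linarith))) hd (by linarith)).1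
  refine (norm_add₃_le).trans ?_
  linarith

/-- The value of a mild solution at a positive time has a Hölder continuous orbit. -/
lemma exists_orbit_bound_of_isMildSolution (hS : IsDiagonalSemigroup e S μ) {γ : ℝ}
    (hx : Exponents α β β' γ 0) (hxβ : Exponents α β β' γ β) (hββ' : β ≤ β') (hγ1 : γ ≤ 1)
    (hF : Continuous F) (hG : ∀ u v, ‖G u - G v‖ ≤ LG * ‖u - v‖) {s : ℝ} (hs : 0 < s)
    (ω : PathSpace V β') {x : V} {u : ℝ → V} (hu : IsMildSolution e S F G α β ω.1 x s u) :
    ∃ C, ∀ δ, 0 ≤ δ → ‖S δ (u s) - u s‖ ≤ C * δ ^ β := by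
  obtain ⟨⟨U, hU⟩, heq⟩ := isMildSolution_iff.1 hu
  obtain ⟨f, B, C, M, hf, hfC, hB, hfB⟩ := hU.exists_coefficients hF hG hx.β_nonneg hs.le
  obtain ⟨L, hL0, hL⟩ := ω.exists_holderPath s
  obtain ⟨K, hK0, hK⟩ := exists_mildInt_bound hS hx hxβ hββ' hγ1
    ((norm_nonneg _).trans (hfC 0)) hB.nonneg hL0 hs.le
  refine ⟨s ^ (-β) * ‖x‖ + K, fun δ hδ => ?_⟩
  rw [heq s ⟨hs.le, le_rfl⟩, mildInt_congr e S α hs.le _ hfB, map_add, add_sub_add_comm]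
  -- Here positivity of `s` is essential: smoothing costs `s ^ (-β)` for an arbitrary initial value.
  have b1 := hS.norm_apply_sub_le hx.β_nonneg hx.β_lt.le hs (by linarith : s ≤ δ + s) x
  rw [add_sub_cancel_right, hS.apply_add hδ hs.le] at b1
  have b2 := (hK f B ω.1 s hf hfC hB (hL.mono (by linarith) le_rfl) hs.le le_rfl).2 δ hδ
  refine (norm_add_le _ _).trans ?_
  linarith

/-! ### Shifting and gluing solutions -/

lemma shift_mem_globalSolutions (hS : IsDiagonalSemigroup e S μ) {γ : ℝ}
    (hx : Exponents α β β' γ 0) (hγ1 : γ ≤ 1) (hF : Continuous F)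
    (hG : ∀ u v, ‖G u - G v‖ ≤ LG * ‖u - v‖) {s : ℝ} (hs : 0 ≤ s)
    (ω : PathSpace V β') {u₀ : V} {u : ℝ → V} (hu : u ∈ globalSolutions e S F G α β u₀ ω.1) :
    (fun r => u (s + r)) ∈ globalSolutions e S F G α β (u s) (ω.shift s).1 := by
  intro T hT
  obtain ⟨⟨U, hU⟩, heq⟩ := isMildSolution_iff.1 (hu (s + T) (by linarith))
  refine isMildSolution_iff.2 ⟨⟨U, hU.comp_add hx.β_nonneg hs hT.le⟩, fun t ht => ?_⟩
  rw [heq (s + t) ⟨by linarith [ht.1], by linarith [ht.2]⟩, heq s ⟨hs, by linarith⟩,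
    mildInt_add_of_mildPath hS hx hγ1 hF hG hs ht.1 (hU.mono_time (by linarith [ht.2])) ω,
    map_add, add_comm s t, hS.apply_add ht.1 hs, add_assoc]
  rfl

omit [CompleteSpace V] [Countable ι] in
lemma apply_zero_of_mem_globalSolutions (hS : IsDiagonalSemigroup e S μ) {w : ℝ → V} {u₀ : V}
    {u : ℝ → V} (hu : u ∈ globalSolutions e S F G α β u₀ w) : u 0 = u₀ := by
  have := (isMildSolution_iff.1 (hu 1 one_pos)).2 0 ⟨le_rfl, zero_le_one⟩
  rwa [mildInt_zero, hS.apply_zero, add_zero] at this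

omit [CompleteSpace V] [Countable ι] in
lemma IsMildSolution.mono {w : ℝ → V} {u₀ : V} {T T' : ℝ} (hT : T' ≤ T) {u : ℝ → V}
    (hu : IsMildSolution e S F G α β w u₀ T u) : IsMildSolution e S F G α β w u₀ T' u := by
  obtain ⟨⟨U, hU⟩, heq⟩ := isMildSolution_iff.1 hu
  exact isMildSolution_iff.2 ⟨⟨U, hU.mono_time hT⟩, fun t ht => heq t ⟨ht.1, ht.2.trans hT⟩⟩

/-- Since `v 0 = u s`, the single formula equals `u` up to time `s` and the translate of `v`
afterwards. The Hölder regularity of `v` at its initial time puts it in `C^β_β`; additivity of the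
mild integral then gives the equation beyond `s`. -/
lemma glue_mem_globalSolutions (hS : IsDiagonalSemigroup e S μ) {γ : ℝ}
    (hx : Exponents α β β' γ 0) (hxβ : Exponents α β β' γ β) (hββ' : β ≤ β') (hγ1 : γ ≤ 1)
    (hF : Continuous F) (hG : ∀ u v, ‖G u - G v‖ ≤ LG * ‖u - v‖) {s : ℝ} (hs : 0 < s)
    (ω : PathSpace V β') {u₀ : V} {u v : ℝ → V} (hu : u ∈ globalSolutions e S F G α β u₀ ω.1)
    (hv : v ∈ globalSolutions e S F G α β (u s) (ω.shift s).1) :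
    (fun q => u (min q s) + v (max (q - s) 0) - v 0) ∈ globalSolutions e S F G α β u₀ ω.1 := by
  have hv0 : v 0 = u s := apply_zero_of_mem_globalSolutions hS hv
  set w : ℝ → V := fun q => u (min q s) + v (max (q - s) 0) - v 0 with hw
  have hwu : ∀ q ≤ s, w q = u q := fun q hq => by
    simp only [hw]
    rw [min_eq_left hq, max_eq_right (by linarith), add_sub_cancel_right]
  have hwv : ∀ r, 0 ≤ r → w (s + r) = v r := fun r hr => by
    simp only [hw]
    rw [min_eq_right (by linarith), max_eq_left (by linarith), hv0, add_sub_cancel_left,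
      add_sub_cancel_left]
  suffices H : ∀ T, 0 < T → IsMildSolution e S F G α β ω.1 u₀ (s + T) w from
    fun T hT => (H T hT).mono (by linarith)
  intro T hT
  obtain ⟨C₀, hC₀⟩ := exists_orbit_bound_of_isMildSolution hS hx hxβ hββ' hγ1 hF hG hs ω (hu s hs)
  obtain ⟨C, hC⟩ := holder_of_isMildSolution hS hx hxβ hββ' hγ1 hF hG hT.le (ω.shift s) (hv T hT)
    hC₀
  obtain ⟨⟨U, hU⟩, hequ⟩ := isMildSolution_iff.1 (hu s hs)
  obtain ⟨⟨U', hU'⟩, heqv⟩ := isMildSolution_iff.1 (hv T hT)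
  obtain ⟨W, hW⟩ : ∃ W, MildPath β W (s + T) w := hU.glue hx.β_nonneg hs.le hT.le hU'.cont hC
  have hleft : ∀ t, 0 ≤ t → t ≤ s → w t = S t u₀ +
      mildInt e S α t (fun r => F (w r)) (fun r => G (w r)) ω.1 := fun t ht hts => by
    rw [hwu t hts, hequ t ⟨ht, hts⟩]
    congr 1
    refine mildInt_congr e S α ht _ fun r hr => ?_
    rw [hwu r (hr.2.trans hts)]
    exact ⟨rfl, rfl⟩
  refine isMildSolution_iff.2 ⟨⟨W, hW⟩, fun t ht => ?_⟩
  rcases le_total t s with hts | hts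
  · exact hleft t ht.1 hts
  · obtain ⟨r, rfl⟩ : ∃ r, t = s + r := ⟨t - s, by ring⟩
    have hr : 0 ≤ r := by linarith
    rw [mildInt_add_of_mildPath hS hx hγ1 hF hG hs.le hr (hW.mono_time ht.2) ω, hwv r hr,
      heqv r ⟨hr, by linarith [ht.2]⟩, ← hwu s le_rfl, hleft s hs.le le_rfl, map_add,
      add_comm s r, hS.apply_add hr hs.le, add_assoc]
    congr 2
    refine mildInt_congr e S α hr _ fun q hq => ?_
    rw [hwv q hq.1]
    exact ⟨rfl, rfl⟩

omit [CompleteSpace V] in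
lemma PathSpace.shift_zero (ω : PathSpace V β') : ω.shift 0 = ω := by
  refine Subtype.ext (funext fun r => ?_)
  change wienerShift 0 ω.1 r = ω.1 r
  rw [wienerShift, zero_add, ω.2.2.1, sub_zero]

end Mild

end RoughEvolution

end

/-! ### Choice of exponents and the two inclusions. -/

theorem mainTheorem5 {V : Type*} [NormedAddCommGroup V] [InnerProductSpace ℝ V]
    [CompleteSpace V] [TopologicalSpace.SeparableSpace V] {ι : Type*}
    (α β β' : ℝ) (hβ : 1 / 2 < β) (hββ' : β < β') (hβ' : β' < 1)
    (hα : 1 - β' < α) (hαβ : α < β)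
    (A : V →ₗ.[ℝ] V) (hA : RoughEvolution.IsPosSymmCompactInv (-A))
    (S : ℝ → V →L[ℝ] V) (hS : RoughEvolution.IsC0Semigroup S)
    (hAS : RoughEvolution.IsGenerator A S)
    (e : HilbertBasis ι ℝ V) (he : ∀ i, ∃ μ : ℝ, (e i, μ • e i) ∈ (-A).graph)
    (F : V → V) (hF : Continuous F)
    (hFgrowth : ∃ cF > 0, ∃ LF > 0, ∀ u : V, ‖F u‖ ≤ cF + LF * ‖u‖)
    (G : V → V →L[ℝ] V) (hG : ∀ u : V, RoughEvolution.hsNorm e (G u) < ⊤)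
    (hGlip : ∃ LG : ℝ≥0, ∀ u v : V,
      RoughEvolution.hsNorm e (G u - G v) ≤ LG * ‖u - v‖ₑ)
    (t s : ℝ≥0) (ω : RoughEvolution.PathSpace V β') (u₀ : V) :
    RoughEvolution.solutionMap e S F G α β (t + s) ω u₀ =
      ⋃ x ∈ RoughEvolution.solutionMap e S F G α β s ω u₀,
        RoughEvolution.solutionMap e S F G α β t (RoughEvolution.PathSpace.shift s ω) x := by
  have hcount := RoughEvolution.countable_of_hilbertBasis e
  obtain ⟨μ, hd⟩ := RoughEvolution.exists_isDiagonalSemigroup hA hS hAS e he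
  obtain ⟨LG, hLG⟩ := hGlip
  have hLip := RoughEvolution.norm_sub_le_of_hsNorm_lipschitz e hLG
  -- The orbit exponent `γ` must exceed `α`, while `β + γ < β' + α` requires `γ - α < β' - β`; half
  -- of that gap satisfies both.
  have hx : ∀ ρ, ρ ≤ β → RoughEvolution.Exponents α β β' (α + (β' - β) / 2) ρ := fun ρ hρ =>
    ⟨by linarith, hαβ, by linarith, by linarith, hβ', hα, by linarith⟩
  have hx0 := hx 0 (by linarith)
  have hγ1 : α + (β' - β) / 2 ≤ 1 := by linarith
  refine Subset.antisymm ?_ ?_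
  · rintro _ ⟨u, hu, rfl⟩
    refine mem_iUnion₂.2 ⟨u s, ⟨u, hu, rfl⟩, fun r => u (s + r), ?_, ?_⟩
    · exact RoughEvolution.shift_mem_globalSolutions hd hx0 hγ1 hF hLip s.coe_nonneg ω hu
    · simp only [NNReal.coe_add, add_comm]
  · refine iUnion₂_subset ?_
    rintro _ ⟨u, hu, rfl⟩ _ ⟨v, hv, rfl⟩
    -- For `s = 0` the orbit of the initial value need not be Hölder, but then `v` itself is the
    -- required solution.
    rcases eq_or_lt_of_le s.coe_nonneg with hs | hs
    · have hs0 : s = 0 := NNReal.coe_injective hs.symm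
      subst hs0
      rw [NNReal.coe_zero, RoughEvolution.PathSpace.shift_zero,
        RoughEvolution.apply_zero_of_mem_globalSolutions hd hu] at hv
      exact ⟨v, hv, by rw [add_zero]⟩
    · refine ⟨_, RoughEvolution.glue_mem_globalSolutions hd hx0 (hx β le_rfl) hββ'.le hγ1 hF hLip
        hs ω hu hv, ?_⟩
      have h0 : v 0 = u s := RoughEvolution.apply_zero_of_mem_globalSolutions hd hv
      have e1 : min ((t + s : ℝ≥0) : ℝ) s = s := min_eq_right (by simp)
      have e2 : max (((t + s : ℝ≥0) : ℝ) - s) 0 = t := by simp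
      simp only [e1, e2, h0, add_sub_cancel_left]
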